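/- Let $0\le N\le d$ be integers, let $W=\mathbb C_d[x]$ be the space of complex polynomials of degree $\le d$, let $z_1,\dots,z_n\in\mathbb C$ be distinct, and for every $z\in\{z_1,\dots,z_n,\infty\}$ let $\mathbf a(z)=(a_1(z)\ge\dots\ge a_{N+1}(z)\ge 0)$ be integers with $a_1(z)\le d-N$, such that $\sum_{z}\sum_{j} a_j(z)=(N+1)(d-N)$, where $z$ runs over $z_1,\dots,z_n,\infty$. For $0\le u\le d+1$ put $F_u(z)=(x-z)^{d+1-u}\mathbb C[x]\cap W$ if $z\in\mathbb C$, and let $F_u(\infty)$ be the space of polynomials of degree $<u$. With $a_0=d-N$, $a_{N+2}=0$, let $$\Omega^o_{\mathbf a}(F)=\{V\in \mathrm{Gr}(N+1,W): \dim (V\cap F_u)=\ell \text{ for } d-N+\ell-a_\ell\le u<d-N+\ell+1-a_{\ell+1},\ \ell=0,\dots,N+1\}$$ be the Schubert cell (a reduced, locally closed subscheme), and let $\Omega=\bigcap_{z\in\{z_1,\dots,z_n,\infty\}}\Omega^o_{\mathbf a(z)}(F(z))$, a scheme-theoretic intersection in $\mathrm{Gr}(N+1,W)$. Put $$K_i=\prod_{s}(x-z_s)^{\sum_{\ell=1}^i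 a_{N+1-i+\ell}(z_s)},\qquad T_i=\prod_s (x-z_s)^{a_{N+1-i}(z_s)-a_{N+2-i}(z_s)},$$ $$l_i=i(d-i+1)-\sum_{\ell=1}^i a_{N+1-i+\ell}(\infty)-\sum_{s}\sum_{\ell=1}^i a_{N+1-i+\ell}(z_s)\qquad(1\le i\le N).$$ Let $\mathrm{Fl}^o$ be the set of pairs $(V,E_\bullet)$ where $V$ is a point of $\Omega$ and $E_1\subsetneq\dots\subsetneq E_{N+1}=V$ is a complete filtration such that (i) for every $z\in\{z_1,\dots,z_n,\infty\}$, $E_\bullet$ lies in the open Schubert cell of the flag variety of $V$ with respect to the complete filtration $F_{d-N+j-a_j(z)}(z)\cap V$, $j=1,\dots,N+1$; and (ii) for $1\le i\le N-1$ the Wronskians $\mathrm{Wr}(E_i)$ and $\mathrm{Wr}(E_{i+1})$ have no common roots in $\mathbb C\setminus\{z_1,\dots,z_n\}$. Let $\tilde R=\prod_{i=1}^N\mathbb C^{l_i}$ with coordinates $t^{(i)}_j$, and let $\tilde R^o\subset\tilde R$ be the open subset of the points with $t^{(i)}_j\ne t^{(i)}_k$ for $j\neq k$, $t^{(i)}_j\neq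 t^{(i+1)}_k$ and $t^{(i)}_j\ne z_s$. Let $\Phi$ be the master function $$\Phi=\prod_{i=1}^N\prod_{j=1}^{l_i}T_i(t^{(i)}_j)^{-1}\ \prod_{i=1}^{N-1}\prod_{j=1}^{l_i}\prod_{k=1}^{l_{i+1}}(t^{(i)}_j-t^{(i+1)}_k)^{-1}\ \prod_{i=1}^N\prod_{1\le j<k\le l_i}(t^{(i)}_j-t^{(i)}_k)^2,$$ a regular function on $\tilde R^o$, and let $\tilde{\mathcal A}'\subset \tilde R^o$ be its critical scheme (the zero scheme of $d\Phi$). Let also $\tilde{\mathcal A}\subset\tilde R^o$ be the closed subscheme given by the conditions that $y_i$ divides $\mathrm{Wr}(y_i',T_iy_{i-1}y_{i+1})$ for $1\le i\le N$, where $y_i=\prod_{j=1}^{l_i}(x-t^{(i)}_j)$ and $y_0=y_{N+1}=1$. The geometric multiplicity of an irreducible component of a scheme is the length of the local ring of the scheme at the generic point of the component. **Theorem.** Let $(V,E_\bullet)\in \mathrm{Fl}^o$, and let $t\in\tilde R$ be such that, up to nonzero constants, $\mathrm{Wr}(E_i)=K_i\prod_{j=1}^{l_i}(x-t^{(i)}_j)$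 for $i=1,\dots,N$. Then $t$ lies on exactly one irreducible component of $\tilde{\mathcal A}'$, and the geometric multiplicity of this component equals the geometric multiplicity of $\Omega$ at $V$, i.e. the length of the local ring $\mathcal O_{\Omega,V}$. The same holds with $\tilde{\mathcal A}$ in place of $\tilde{\mathcal A}'$. -/

import Mathlib

open Polynomial

noncomputable section

/-! ### Spaces of polynomials, flags, Schubert cells -/

/-- `W = ℂ_d[x]`, the space of polynomials of degree at most `d`. -/
abbrev polySpace (d : ℕ) : Submodule ℂ ℂ[X] := degreeLT ℂ (d + 1)

/-- The flag at a finite point `z`: `F_u(z) = (x - z)^(d+1-u) ℂ[x] ∩ W`, for `0 ≤ u ≤ d + 1`. -/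
def flagAt (d : ℕ) (z : ℂ) (u : ℕ) : Submodule ℂ ℂ[X] :=
  (Ideal.span {(X - C z) ^ (d + 1 - u)} : Ideal ℂ[X]).restrictScalars ℂ ⊓ polySpace d

/-- The flag at infinity: `F_u(∞)` is the space of polynomials of degree `< u`,
for `0 ≤ u ≤ d + 1`. -/
def flagAtInfty (d : ℕ) (u : ℕ) : Submodule ℂ ℂ[X] :=
  degreeLT ℂ u ⊓ polySpace d

/-- The Schubert cell `Ω°_a(F)` in `Gr(N+1, W)`, where `a = (a_1, …, a_{N+1})` is a ramification
sequence (extended by `a_0 = d - N` and `a_{N+2} = 0`) and `F` is a flag on `W`. -/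
def schubertCell (N d : ℕ) (F : ℕ → Submodule ℂ ℂ[X]) (a : ℕ → ℕ) :
    Set (Submodule ℂ ℂ[X]) :=
  {V | V ≤ polySpace d ∧ Module.finrank ℂ V = N + 1 ∧
    ∀ ℓ ≤ N + 1, ∀ u, d - N + ℓ - a ℓ ≤ u → u < d - N + ℓ + 1 - a (ℓ + 1) →
      Module.finrank ℂ (V ⊓ F u : Submodule ℂ ℂ[X]) = ℓ}

/-- `E_0 ⊂ E_1 ⊂ … ⊂ E_m = V` is a complete filtration of `V` (so `dim V = m` and `E_0 = 0`);
the values `E i` for `i > m` are irrelevant. -/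
def IsCompleteFlag (m : ℕ) (V : Submodule ℂ ℂ[X]) (E : ℕ → Submodule ℂ ℂ[X]) : Prop :=
  E m = V ∧ (∀ i < m, E i ≤ E (i + 1)) ∧
    ∀ i ≤ m, Module.Finite ℂ (E i) ∧ Module.finrank ℂ (E i) = i

/-- The filtration `E` lies in the Schubert cell `G°_w(F)` of the flag variety of an
`m`-dimensional space carrying the complete flag `F`: there is a basis `u_1, …, u_m` with
`E_i = span (u_1, …, u_i)` and `u_i ∈ F_{w(i)}`. The indices in `Fin m` are shifted by one. -/
def InFlagCell (m : ℕ) (w : Equiv.Perm (Fin m)) (F E : ℕ → Submodule ℂ ℂ[X]) : Prop :=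
  ∃ u : Fin m → ℂ[X], LinearIndependent ℂ u ∧
    (∀ i : Fin m, E (i + 1) = Submodule.span ℂ (u '' {k | k ≤ i})) ∧
    ∀ i : Fin m, u i ∈ F (w i + 1)

/-! ### Wronskians -/

/-- The Wronskian `Wr(u_1, …, u_k) = det (u_i^{(j)})` of a tuple of polynomials. -/
def tupleWronskian {k : ℕ} (u : Fin k → ℂ[X]) : ℂ[X] :=
  (Matrix.of fun i j : Fin k => derivative^[(j : ℕ)] (u i)).det

/-- `p` represents the Wronskian `Wr(E) ∈ ℂ[x] / ℂ^*` of a finite dimensional space `E` of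
polynomials: up to a nonzero constant, `p` is the Wronskian of a basis of `E`. -/
def IsWronskianOf (E : Submodule ℂ ℂ[X]) (p : ℂ[X]) : Prop :=
  ∃ (k : ℕ) (u : Module.Basis (Fin k) ℂ E),
    Associated p (tupleWronskian fun i => (u i : ℂ[X]))

/-! ### Multiplicities -/

/-- The length of the local ring `R_𝔭 / J R_𝔭` of the closed subscheme `Spec (R / J)` of `Spec R`
at the point `x = 𝔭`. If `𝔭` is a minimal prime over `J`, this is the geometric multiplicity of the
irreducible component of `Spec (R / J)` with generic point `x`. -/
def lengthAt {R : Type} [CommRing R] (J : Ideal R) (x : PrimeSpectrum R) : ℕ∞ :=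
  Module.length (Localization.AtPrime x.asIdeal)
    (Localization.AtPrime x.asIdeal ⧸ J.map (algebraMap R (Localization.AtPrime x.asIdeal)))

/-! ### The affine charts of the Grassmannian -/

/-- Let `b` be a basis of `W`, divided into `N + 1` vectors `e_i` and `d - N` vectors `f_j`. The
affine chart of `Gr(N+1, W)` attached to `b` consists of the complements of `span (f_j)`; the point
with coordinates `c_{ij}` is the span of the vectors `e_i + ∑_j c_{ij} f_j`. -/
def chartPoint {N d : ℕ} (b : Module.Basis (Fin (N + 1) ⊕ Fin (d - N)) ℂ (polySpace d))
    (c : Fin (N + 1) × Fin (d - N) → ℂ) : Submodule ℂ ℂ[X] :=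
  Submodule.span ℂ (Set.range fun i : Fin (N + 1) =>
    (b (Sum.inl i) : ℂ[X]) + ∑ j, c (i, j) • (b (Sum.inr j) : ℂ[X]))

/-! ### The basic situation -/

/-- The basic situation: distinct points `z_1, …, z_n` of `ℂ` and ramification sequences
`a(z_1), …, a(z_n)`, `a(∞)` (the index `none` stands for `∞`) of total size
`dim Gr(N+1, W) = (N+1)(d-N)`. A ramification sequence `(a_1, …, a_{N+1})` with `a_1 ≤ d - N`
is extended by `a_0 = d - N` and by `a_k = 0` for `k ≥ N + 2`. -/
structure BasicSituation (N d n : ℕ) where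
  le : N ≤ d
  z : Fin n → ℂ
  z_injective : Function.Injective z
  a : Option (Fin n) → ℕ → ℕ
  a_antitone : ∀ s, Antitone (a s)
  a_zero : ∀ s, a s 0 = d - N
  a_eq_zero : ∀ s k, N + 1 < k → a s k = 0
  sum_a : ∑ s, ∑ k ∈ Finset.Icc 1 (N + 1), a s k = (N + 1) * (d - N)

namespace BasicSituation

variable {N d n : ℕ} (S : BasicSituation N d n)

/-- The flags `F(z_1), …, F(z_n), F(∞)`. -/
def flag : Option (Fin n) → ℕ → Submodule ℂ ℂ[X]
  | none => flagAtInfty d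
  | some s => flagAt d (S.z s)

/-- The Schubert cells `Ω°_{a(z)}(F(z))`, for `z ∈ {z_1, …, z_n, ∞}`. -/
def cell (s : Option (Fin n)) : Set (Submodule ℂ ℂ[X]) :=
  schubertCell N d (S.flag s) (S.a s)

/-- The ideal, in the coordinate ring of an affine chart of the Grassmannian, of the
scheme-theoretic intersection of the closures of the cells: the sum of the ideals of the functions
which vanish on the respective cell. Every cell is open in its closure, so that near a point of
the intersection of the cells this is the ideal of the scheme `Ω`. -/
def omegaIdeal (b : Module.Basis (Fin (N + 1) ⊕ Fin (d - N)) ℂ (polySpace d)) :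
    Ideal (MvPolynomial (Fin (N + 1) × Fin (d - N)) ℂ) :=
  ⨆ s, MvPolynomial.vanishingIdeal ℂ {c | chartPoint b c ∈ S.cell s}

/-- The multiplicity of the scheme `Ω` at the origin of the chart attached to `b`, that is at the
span of the first `N + 1` vectors of `b`: the length of the local ring of `Ω` at this point. -/
def omegaMultiplicity (b : Module.Basis (Fin (N + 1) ⊕ Fin (d - N)) ℂ (polySpace d)) : ℕ∞ :=
  lengthAt (S.omegaIdeal b) (MvPolynomial.pointToPoint (0 : Fin (N + 1) × Fin (d - N) → ℂ))

/-- The distinguished complete filtration on `V ∈ Ω` induced by the flag with index `s`; its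
`j`-th member is `F_{d-N+j-a_j} ∩ V`. -/
def distinguishedFlag (s : Option (Fin n)) (V : Submodule ℂ ℂ[X]) (j : ℕ) :
    Submodule ℂ ℂ[X] :=
  V ⊓ S.flag s (d - N + j - S.a s j)

/-- `(V, E) ∈ Fl°`: `V` is a point of `Ω`; `E` is a complete filtration of `V`, which lies in the
open Schubert cell (the one of the longest permutation) with respect to each of the `n + 1`
distinguished filtrations on `V`; and `Wr(E_i)` and `Wr(E_{i+1})`, for `1 ≤ i ≤ N - 1`, have no
common roots in `ℂ - {z_1, …, z_n}`. -/
def InFlo (V : Submodule ℂ ℂ[X]) (E : ℕ → Submodule ℂ ℂ[X]) : Prop :=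
  (∀ s, V ∈ S.cell s) ∧
  IsCompleteFlag (N + 1) V E ∧
  (∀ s, InFlagCell (N + 1) Fin.revPerm (S.distinguishedFlag s V) E) ∧
  ∀ i, 1 ≤ i → i + 1 ≤ N → ∀ p q : ℂ[X], IsWronskianOf (E i) p → IsWronskianOf (E (i + 1)) q →
    ∀ x : ℂ, (∀ s, x ≠ S.z s) → ¬ (p.IsRoot x ∧ q.IsRoot x)

/-- `K_i = ∏_s (x - z_s)^{a_{N+2-i}(z_s) + … + a_{N+1}(z_s)}`, for `0 ≤ i ≤ N + 1`. -/
def K (i : ℕ) : ℂ[X] :=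
  ∏ s : Fin n, (X - C (S.z s)) ^ (∑ ℓ ∈ Finset.Icc 1 i, S.a (some s) (N + 1 - i + ℓ))

/-- `T_i = ∏_s (x - z_s)^{a_{N+1-i}(z_s) - a_{N+2-i}(z_s)}`, for `1 ≤ i ≤ N`. -/
def T (i : ℕ) : ℂ[X] :=
  ∏ s : Fin n, (X - C (S.z s)) ^ (S.a (some s) (N + 1 - i) - S.a (some s) (N + 2 - i))

/-- `l_i = i (d - i + 1) - ∑_{ℓ=1}^i a_{N+1-i+ℓ}(∞) - ∑_s ∑_{ℓ=1}^i a_{N+1-i+ℓ}(z_s)`, for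
`1 ≤ i ≤ N`. If this number is negative, then `Fl°` is empty. -/
def l (i : ℕ) : ℕ :=
  ((i : ℤ) * ((d : ℤ) - i + 1) -
    ∑ s : Option (Fin n), ∑ ℓ ∈ Finset.Icc 1 i, (S.a s (N + 1 - i + ℓ) : ℤ)).toNat

/-- The indices of the root coordinates `t^{(i)}_j`, `1 ≤ i ≤ N`, `1 ≤ j ≤ l_i`. The first index
is shifted by one: `⟨i, j⟩` is the index of a root of the polynomial `y_{i+1}`. -/
abbrev Var : Type := Σ i : Fin N, Fin (S.l (i + 1))

/-- `Γ(t)_i = ∏_j (x - t^{(i)}_j)`, with the index `i` shifted by one. -/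
def Gam (t : S.Var → ℂ) (i : Fin N) : ℂ[X] :=
  ∏ j : Fin (S.l (i + 1)), (X - C (t ⟨i, j⟩))

/-- `Γ(t) = Θ(V, E)`, that is `Wr(E_i) = K_i Γ(t)_i` up to nonzero constants, `1 ≤ i ≤ N`. -/
def GamEqTheta (t : S.Var → ℂ) (E : ℕ → Submodule ℂ ℂ[X]) : Prop :=
  ∀ i : Fin N, IsWronskianOf (E (i + 1)) (S.K (i + 1) * S.Gam t i)

/-! ### The master function and its critical scheme -/

/-- The pairs of indices of coordinates `t^{(i)}_j`, `t^{(i)}_k` with `j < k`. -/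
def samePairs : Finset (S.Var × S.Var) :=
  Finset.univ.filter fun p => p.1.1 = p.2.1 ∧ (p.1.2 : ℕ) < (p.2.2 : ℕ)

/-- The pairs of indices of coordinates `t^{(i)}_j`, `t^{(i+1)}_k`. -/
def adjacentPairs : Finset (S.Var × S.Var) :=
  Finset.univ.filter fun p => (p.2.1 : ℕ) = (p.1.1 : ℕ) + 1

/-- The product of the functions `t^{(i)}_j - z_s`, `t^{(i)}_j - t^{(i)}_k` (`j < k`) and
`t^{(i)}_j - t^{(i+1)}_k`; the open set `R̃°` is the set where it does not vanish. -/
def discr : MvPolynomial S.Var ℂ :=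
  (∏ v : S.Var, ∏ s : Fin n, (MvPolynomial.X v - MvPolynomial.C (S.z s))) *
  (∏ p ∈ S.samePairs, (MvPolynomial.X p.1 - MvPolynomial.X p.2)) *
  ∏ p ∈ S.adjacentPairs, (MvPolynomial.X p.1 - MvPolynomial.X p.2)

/-- The ring of regular functions on the affine variety `R̃°`. -/
abbrev RegFun : Type := Localization.Away S.discr

/-- The coordinate functions `t^{(i)}_j` on `R̃°`. -/
def coord (v : S.Var) : S.RegFun :=
  algebraMap (MvPolynomial S.Var ℂ) S.RegFun (MvPolynomial.X v)

/-- The master function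
`Φ = ∏ T_i(t^{(i)}_j)⁻¹ ∏ (t^{(i)}_j - t^{(i+1)}_k)⁻¹ ∏_{j<k} (t^{(i)}_j - t^{(i)}_k)²`,
a regular function on `R̃°`. The elements which are inverted are units, see
`isUnit_aeval_T` and `isUnit_coord_sub_coord`. -/
def masterFunction : S.RegFun :=
  (∏ v : S.Var, Ring.inverse (aeval (S.coord v) (S.T (v.1 + 1)))) *
  (∏ p ∈ S.adjacentPairs, Ring.inverse (S.coord p.1 - S.coord p.2)) *
  ∏ p ∈ S.samePairs, (S.coord p.1 - S.coord p.2) ^ 2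

theorem isUnit_discr : IsUnit (algebraMap (MvPolynomial S.Var ℂ) S.RegFun S.discr) :=
  IsLocalization.Away.algebraMap_isUnit S.discr

theorem isUnit_coord_sub_coord {p : S.Var × S.Var} (hp : p ∈ S.adjacentPairs) :
    IsUnit (S.coord p.1 - S.coord p.2) := by
  have h : (MvPolynomial.X p.1 - MvPolynomial.X p.2 : MvPolynomial S.Var ℂ) ∣ S.discr :=
    (Finset.dvd_prod_of_mem (fun p : S.Var × S.Var =>
      (MvPolynomial.X p.1 - MvPolynomial.X p.2 : MvPolynomial S.Var ℂ)) hp).mul_left _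
  have h2 := isUnit_of_dvd_unit
    (map_dvd (algebraMap (MvPolynomial S.Var ℂ) S.RegFun) h) S.isUnit_discr
  simpa [coord] using h2

theorem isUnit_aeval_T (v : S.Var) (i : ℕ) : IsUnit (aeval (S.coord v) (S.T i)) := by
  unfold T
  rw [map_prod]
  refine (Finset.prod_induction _ (fun x => IsUnit x) (fun _ _ => IsUnit.mul) isUnit_one ?_)
  intro s _
  rw [map_pow]
  refine IsUnit.pow _ ?_
  have h : (MvPolynomial.X v - MvPolynomial.C (S.z s) : MvPolynomial S.Var ℂ) ∣ S.discr := by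
    refine Dvd.dvd.mul_right (Dvd.dvd.mul_right ?_ _) _
    exact (Finset.dvd_prod_of_mem (fun s : Fin n =>
      (MvPolynomial.X v - MvPolynomial.C (S.z s) : MvPolynomial S.Var ℂ))
        (Finset.mem_univ s)).trans
      (Finset.dvd_prod_of_mem (fun v : S.Var => ∏ s : Fin n,
        (MvPolynomial.X v - MvPolynomial.C (S.z s) : MvPolynomial S.Var ℂ)) (Finset.mem_univ v))
  have h2 := isUnit_of_dvd_unit
    (map_dvd (algebraMap (MvPolynomial S.Var ℂ) S.RegFun) h) S.isUnit_discr
  have e : algebraMap (MvPolynomial S.Var ℂ) S.RegFun (MvPolynomial.C (S.z s)) =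
      algebraMap ℂ S.RegFun (S.z s) :=
    (IsScalarTower.algebraMap_apply ℂ (MvPolynomial S.Var ℂ) S.RegFun (S.z s)).symm
  rw [map_sub, e] at h2
  simpa [coord] using h2

/-- The ideal of the critical scheme of `Φ` in `R̃°`, i.e. of the zero scheme of `dΦ`. It is
generated by the derivatives `D Φ` of `Φ` along all vector fields `D` on `R̃°`, equivalently by the
partial derivatives of `Φ` with respect to the coordinates `t^{(i)}_j`. -/
def criticalIdeal : Ideal S.RegFun :=
  Ideal.span (Set.range fun D : Derivation ℂ S.RegFun S.RegFun => D S.masterFunction)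

/-- The universal polynomials `y_i = ∏_j (x - t^{(i)}_j)` over `R̃°`; `y_0 = y_{N+1} = 1`. -/
def univPoly (i : ℕ) : S.RegFun[X] :=
  ∏ v : S.Var with (v.1 : ℕ) + 1 = i, (X - C (S.coord v))

/-- The ideal of the scheme `Ã = Γ⁻¹(A)` in `R̃°`, given by the conditions that `y_i` divides
`Wr(y_i', T_i y_{i-1} y_{i+1})` for `1 ≤ i ≤ N`: it is generated by the coefficients of the
remainders of the division by the monic polynomials `y_i`. -/
def divisibilityIdeal : Ideal S.RegFun :=
  Ideal.span {c | ∃ (i : Fin N) (k : ℕ),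
    c = ((wronskian (derivative (S.univPoly (i + 1)))
      ((S.T (i + 1)).map (algebraMap ℂ S.RegFun) * S.univPoly i * S.univPoly (i + 2))) %ₘ
        S.univPoly (i + 1)).coeff k}

/-- `x` is the generic point of an irreducible component of the closed subscheme of `R̃°` with
ideal `J`, and this component contains the point with coordinates `t`. -/
def IsComponentThrough (J : Ideal S.RegFun) (t : S.Var → ℂ) (x : PrimeSpectrum S.RegFun) : Prop :=
  x.asIdeal ∈ J.minimalPrimes ∧
    PrimeSpectrum.comap (algebraMap (MvPolynomial S.Var ℂ) S.RegFun) x ≤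
      MvPolynomial.pointToPoint t

end BasicSituation

end

/-!
Let `B` be the local ring of `Ω` at `V`. The idea is that `Ã` near `t` looks like the product of `Ω`
near `V` and an affine space: the second factor is the cell of the variety of flags in `V`, whose
coordinates are the entries above the diagonal of a unitriangular matrix. So there is one component
through `t`, and the nilpotents of `Ã` at its generic point are those of `B`. The argument works with
points over local `ℂ`-algebras and avoids completions.

*One scheme.* The critical ideal of `Φ` and the divisibility ideal are equal: after multiplication by
units, the logarithmic derivatives of `Φ` are the values of `Wr(y_i', T_i y_{i-1} y_{i+1})` at the roots
of `y_i` (`BasicSituation.criticalIdeal_eq_divisibilityIdeal`).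

*`Ω` is finite.* The Wronskian of a point of `Ω` is prescribed, and the Wronski map is finite
(`coeff_mem_range_of_wrs_eq`): after a degeneration this is the rigidity of spaces of polynomials whose
Wronskian is a monomial. Hence `B` is Artinian (`BasicSituation.isNilpotent_span_omegaCoord`), and the
multiplicity of `Ω` at `V` is a finite number.

*From `Ã` to `Ω`.* Let the `y_i`, with roots in a local `ℂ`-algebra, satisfy the divisibility
conditions. Solving `Wr(y_i, p_i) = T_i y_{i-1} p_{i+1}` for decreasing `i` gives a flag of polynomials
with the Wronskians `K_i y_i`. The solutions can be normalised with respect to any one of the points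
`z_1, …, z_n, ∞`, and then form a basis adapted to the flag there. Flags with the same Wronskians
coincide, so the conditions hold at all points at once, and the span is a point of `Ω`
(`BasicSituation.exists_family`, `BasicSituation.Bases.exists_normalForm`).

*From `Ω` to `Ã`.* A flag in a point of `Ω` near `V` has Wronskians `K_i y_i` near those of `E`; by
Hensel's lemma the `y_i` have roots near `t`, and these satisfy the divisibility conditions by the
Desnanot–Jacobi identity for Wronskians (`BasicSituation.Bases.exists_point`). A flag written in
unitriangular form is determined by its Wronskians (`eq_of_wrs_flagVec_eq`), so the two
constructions are inverse to each other.

*Comparison.* Applied to the local ring `A` of `Ã` at `t` and to the ring `B⟦X⟧` of power series in the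
unitriangular coordinates, the constructions give local homomorphisms `B → A` and `A → B⟦X⟧`
(`BasicSituation.Bases.exists_comparison`). As `B` is Artinian, the kernel of the composite of
`A → B⟦X⟧` with `B⟦X⟧ → ℂ⟦X⟧` is the only minimal prime of `A`. The localization of `A` there is an
extension of `B` whose maximal ideal is generated by that of `B`, and every ideal of `B` is the
contraction of its extension. Such an extension preserves the length (`Module.length_eq_of_extension`,
`exists_component_lengthAt_eq`).
-/

open Polynomial

noncomputable section

/-! ### Wronskians over commutative rings -/

section Wronskian

variable {R R' : Type*} [CommRing R] [CommRing R']

/-- The Wronskian `det (u_i^{(j)})` of a tuple of polynomials over a commutative ring. -/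
def wr {k : ℕ} (u : Fin k → R[X]) : R[X] :=
  (Matrix.of fun i j : Fin k => derivative^[(j : ℕ)] (u i)).det

/-- The Wronskian of the first `i` members of a sequence. -/
def wrs (u : ℕ → R[X]) (i : ℕ) : R[X] := wr fun j : Fin i => u j

/-- The Wronskian of the first `i` members of a sequence, followed by `v`. -/
def wrx (u : ℕ → R[X]) (i : ℕ) (v : R[X]) : R[X] :=
  wr (Fin.snoc (α := fun _ => R[X]) (fun j : Fin i => u j) v)

theorem wr_map (f : R →+* R') {k : ℕ} (u : Fin k → R[X]) :
    wr (fun i => (u i).map f) = (wr u).map f := by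
  unfold wr
  rw [← coe_mapRingHom, RingHom.map_det]
  congr 1
  ext1 i j
  simp [iterate_derivative_map]

theorem wrs_map (f : R →+* R') (u : ℕ → R[X]) (i : ℕ) :
    wrs (fun j => (u j).map f) i = (wrs u i).map f := wr_map f _

theorem wrs_succ (u : ℕ → R[X]) (i : ℕ) : wrs u (i + 1) = wrx u i (u i) := by
  unfold wrs wrx
  congr 1
  ext1 j
  refine Fin.lastCases ?_ (fun j => ?_) j <;> simp

@[simp] theorem wrs_zero (u : ℕ → R[X]) : wrs u 0 = 1 := by
  simp [wrs, wr]

theorem wrx_zero (u : ℕ → R[X]) (v : R[X]) : wrx u 0 v = v := by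
  simp [wrx, wr, Fin.snoc]

theorem wr_linearCombination {k : ℕ} (A : Matrix (Fin k) (Fin k) R) (u : Fin k → R[X]) :
    wr (fun i => ∑ j, C (A i j) * u j) = C A.det * wr u := by
  have h : (C : R →+* R[X]) A.det = (A.map C).det := by
    rw [RingHom.map_det, RingHom.mapMatrix_apply]
  rw [h]
  unfold wr
  rw [← Matrix.det_mul]
  congr 1
  ext1 i j
  simp [Matrix.mul_apply, iterate_derivative_sum]

/-- The Wronskian is multilinear and alternating in its entries. -/
def wrAlt (R : Type*) [CommRing R] (k : ℕ) : R[X] [⋀^Fin k]→ₗ[R] R[X] where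
  toFun := wr
  map_update_add' u i x y := by
    have := Matrix.det_updateRow_add (Matrix.of fun i j : Fin k => derivative^[(j : ℕ)] (u i)) i
      (fun j => derivative^[(j : ℕ)] x) (fun j => derivative^[(j : ℕ)] y)
    unfold wr
    refine Eq.trans ?_ (this.trans ?_)
    · congr 1
      ext1 a b
      by_cases h : a = i <;> simp [h, Matrix.updateRow_apply, Function.update_apply]
    · congr 2 <;>
      · ext1 a b
        by_cases h : a = i <;> simp [h, Matrix.updateRow_apply, Function.update_apply]
  map_update_smul' u i c x := by
    have := Matrix.det_updateRow_smul (Matrix.of fun i j : Fin k => derivative^[(j : ℕ)] (u i)) i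
      (C c) (fun j => derivative^[(j : ℕ)] x)
    unfold wr
    rw [smul_eq_C_mul]
    refine Eq.trans ?_ (this.trans ?_)
    · congr 1
      ext1 a b
      by_cases h : a = i <;> simp [h, Matrix.updateRow_apply, Function.update_apply]
    · rw [smul_eq_C_mul]
      congr 2
      ext1 a b
      by_cases h : a = i <;> simp [h, Matrix.updateRow_apply, Function.update_apply]
  map_eq_zero_of_eq' u i j h hij := by
    refine Matrix.det_zero_of_row_eq hij ?_
    ext1 a
    simp [h]

theorem wrAlt_apply {k : ℕ} (u : Fin k → R[X]) : wrAlt R k u = wr u := rfl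

/-- If a submodule contains the Wronskians of all `k`-tuples of distinct members of a family, it
contains the Wronskian of any `k` elements of the span of the family. -/
theorem wr_mem_of_mem_span {ι : Type*} {k : ℕ} (v : ι → R[X]) (M : Submodule R R[X])
    (hM : ∀ r : Fin k → ι, Function.Injective r → wr (v ∘ r) ∈ M) (w : Fin k → R[X])
    (hw : ∀ i, w i ∈ Submodule.span R (Set.range v)) : wr w ∈ M := by
  classical
  choose c hc using fun i => (Finsupp.mem_span_range_iff_exists_finsupp.1 (hw i))
  have hw' : w = fun i => ∑ a ∈ (c i).support, c i a • v a := by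
    ext1 i; rw [← hc i]; rfl
  rw [← wrAlt_apply, hw', ← AlternatingMap.coe_multilinearMap, MultilinearMap.map_sum_finset]
  refine Submodule.sum_mem _ fun r _ => ?_
  rw [MultilinearMap.map_smul_univ]
  refine Submodule.smul_mem _ _ ?_
  by_cases h : Function.Injective r
  · exact hM r h
  · have : wrAlt R k (fun i => v (r i)) = 0 := by
      obtain ⟨a, b, hab, hne⟩ := Function.not_injective_iff.1 h
      exact AlternatingMap.map_eq_zero_of_eq _ _ (by simp [hab]) hne
    rw [AlternatingMap.coe_multilinearMap, this]
    exact zero_mem _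

theorem wrx_add (u : ℕ → R[X]) (i : ℕ) (v w : R[X]) :
    wrx u i (v + w) = wrx u i v + wrx u i w := by
  have := (wrAlt R (i + 1)).map_update_add
    (Fin.snoc (α := fun _ => R[X]) (fun j : Fin i => u j) 0) (Fin.last i) v w
  simpa only [Fin.update_snoc_last, wrAlt_apply, wrx] using this

theorem wrx_smul (u : ℕ → R[X]) (i : ℕ) (c : R) (v : R[X]) :
    wrx u i (C c * v) = C c * wrx u i v := by
  have := (wrAlt R (i + 1)).map_update_smul
    (Fin.snoc (α := fun _ => R[X]) (fun j : Fin i => u j) 0) (Fin.last i) c v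
  simpa only [Fin.update_snoc_last, wrAlt_apply, smul_eq_C_mul, wrx] using this

theorem wrx_sub (u : ℕ → R[X]) (i : ℕ) (v w : R[X]) :
    wrx u i (v - w) = wrx u i v - wrx u i w := by
  have := wrx_add u i v (C (-1) * w)
  rw [wrx_smul] at this
  simpa [sub_eq_add_neg] using this

theorem wrx_of_lt (u : ℕ → R[X]) {i j : ℕ} (h : j < i) : wrx u i (u j) = 0 := by
  refine (wrAlt R (i + 1)).map_eq_zero_of_eq _ (i := Fin.castSucc ⟨j, h⟩) (j := Fin.last i) ?_
    (Fin.castSucc_lt_last _).ne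
  rw [Fin.snoc_castSucc, Fin.snoc_last]

/-! ### The Desnanot–Jacobi identity -/

open Matrix in
/-- The difference of the two sides of the Desnanot–Jacobi identity. -/
def djDefect {m : Type*} [Fintype m] [DecidableEq m] (A : Matrix m m R)
    (B : Matrix m (Fin 2) R) (Cc : Matrix (Fin 2) m R) (D : Matrix (Fin 2) (Fin 2) R) : R :=
  A.det * (fromBlocks A B Cc D).det -
    ((fromBlocks A (B.submatrix id fun _ : Fin 1 => 0) (Cc.submatrix (fun _ : Fin 1 => 0) id)
          (D.submatrix (fun _ => 0) fun _ => 0)).det *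
        (fromBlocks A (B.submatrix id fun _ : Fin 1 => 1) (Cc.submatrix (fun _ : Fin 1 => 1) id)
          (D.submatrix (fun _ => 1) fun _ => 1)).det -
      (fromBlocks A (B.submatrix id fun _ : Fin 1 => 1) (Cc.submatrix (fun _ : Fin 1 => 0) id)
          (D.submatrix (fun _ => 0) fun _ => 1)).det *
        (fromBlocks A (B.submatrix id fun _ : Fin 1 => 0) (Cc.submatrix (fun _ : Fin 1 => 1) id)
          (D.submatrix (fun _ => 1) fun _ => 0)).det)

theorem djDefect_map {m : Type*} [Fintype m] [DecidableEq m] (f : R →+* R') (A : Matrix m m R)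
    (B : Matrix m (Fin 2) R) (Cc : Matrix (Fin 2) m R) (D : Matrix (Fin 2) (Fin 2) R) :
    f (djDefect A B Cc D) = djDefect (A.map f) (B.map f) (Cc.map f) (D.map f) := by
  simp only [djDefect, map_mul, map_sub, RingHom.map_det, RingHom.mapMatrix_apply,
    Matrix.fromBlocks_map, Matrix.submatrix_map]

open Matrix in
/-- Over a field, for an invertible block, the identity follows from Schur complements. -/
theorem djDefect_eq_zero_of_det_ne_zero {F : Type*} [Field F] {m : Type*} [Fintype m]
    [DecidableEq m] (A : Matrix m m F) (B : Matrix m (Fin 2) F) (Cc : Matrix (Fin 2) m F)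
    (D : Matrix (Fin 2) (Fin 2) F) (hA : A.det ≠ 0) : djDefect A B Cc D = 0 := by
  let _ := Matrix.invertibleOfIsUnitDet A (isUnit_iff_ne_zero.2 hA)
  have hS : ∀ a b : Fin 2, (fromBlocks A (B.submatrix id fun _ : Fin 1 => b)
      (Cc.submatrix (fun _ : Fin 1 => a) id) (D.submatrix (fun _ => a) fun _ => b)).det =
      A.det * (D - Cc * ⅟A * B) a b := by
    intro a b
    rw [det_fromBlocks₁₁, Matrix.det_fin_one]
    simp [Matrix.mul_apply]
  rw [djDefect, hS, hS, hS, hS, det_fromBlocks₁₁, Matrix.det_fin_two]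
  ring

open Matrix in
/-- The Desnanot–Jacobi identity for a matrix with a distinguished square block. -/
theorem djDefect_eq_zero {m : Type*} [Fintype m] [DecidableEq m] (A : Matrix m m R)
    (B : Matrix m (Fin 2) R) (Cc : Matrix (Fin 2) m R) (D : Matrix (Fin 2) (Fin 2) R) :
    djDefect A B Cc D = 0 := by
  -- The generic matrix over `ℤ`, whose block has a non-vanishing determinant.
  let P := MvPolynomial ((m ⊕ Fin 2) × (m ⊕ Fin 2)) ℤ
  let G : Matrix (m ⊕ Fin 2) (m ⊕ Fin 2) P := mvPolynomialX (m ⊕ Fin 2) (m ⊕ Fin 2) ℤ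
  have hG : G.toBlocks₁₁.det ≠ 0 := by
    intro h
    have h1 := congrArg (MvPolynomial.eval
      (fun p : (m ⊕ Fin 2) × (m ⊕ Fin 2) => (1 : Matrix (m ⊕ Fin 2) (m ⊕ Fin 2) ℤ) p.1 p.2)) h
    rw [RingHom.map_det, map_zero] at h1
    have : (MvPolynomial.eval (fun p : (m ⊕ Fin 2) × (m ⊕ Fin 2) =>
        (1 : Matrix (m ⊕ Fin 2) (m ⊕ Fin 2) ℤ) p.1 p.2)).mapMatrix G.toBlocks₁₁ =
          (1 : Matrix m m ℤ) := by
      ext i j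
      simp [G, Matrix.toBlocks₁₁, Matrix.one_apply]
    rw [this] at h1
    simp at h1
  have hinj := FaithfulSMul.algebraMap_injective P (FractionRing P)
  have hP : djDefect G.toBlocks₁₁ G.toBlocks₁₂ G.toBlocks₂₁ G.toBlocks₂₂ = 0 := by
    apply hinj
    rw [djDefect_map, map_zero]
    refine djDefect_eq_zero_of_det_ne_zero _ _ _ _ ?_
    rw [← RingHom.mapMatrix_apply, ← RingHom.map_det]
    exact fun h => hG (hinj (by simpa using h))
  let f : P →+* R := MvPolynomial.eval₂Hom (Int.castRingHom R)
    (fun p => (fromBlocks A B Cc D) p.1 p.2)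
  have h2 := congrArg f hP
  rw [djDefect_map, map_zero] at h2
  have e11 : G.toBlocks₁₁.map f = A := by ext i j; exact MvPolynomial.eval₂_X _ _ _
  have e12 : G.toBlocks₁₂.map f = B := by ext i j; exact MvPolynomial.eval₂_X _ _ _
  have e21 : G.toBlocks₂₁.map f = Cc := by ext i j; exact MvPolynomial.eval₂_X _ _ _
  have e22 : G.toBlocks₂₂.map f = D := by ext i j; exact MvPolynomial.eval₂_X _ _ _
  rwa [e11, e12, e21, e22] at h2

/-- The derivative of a Wronskian: only the last column has to be differentiated. -/
theorem derivative_wr {k : ℕ} (u : Fin (k + 1) → R[X]) :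
    derivative (wr u) = (Matrix.of fun i j : Fin (k + 1) =>
      derivative^[if j = Fin.last k then k + 1 else (j : ℕ)] (u i)).det := by
  have key : derivative (wr u) = ∑ l : Fin (k + 1), (Matrix.of fun i j : Fin (k + 1) =>
      derivative^[if j = l then (j : ℕ) + 1 else (j : ℕ)] (u i)).det := by
    unfold wr
    simp only [Matrix.det_apply, Matrix.of_apply, derivative_sum]
    rw [Finset.sum_comm]
    refine Finset.sum_congr rfl fun σ _ => ?_
    rw [← Finset.smul_sum, Units.smul_def, Units.smul_def, derivative_smul, derivative_prod_finset]
    congr 1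
    refine Finset.sum_congr rfl fun l _ => ?_
    rw [← Finset.prod_erase_mul _ _ (Finset.mem_univ l)]
    congr 1
    · refine Finset.prod_congr rfl fun j hj => ?_
      rw [if_neg (Finset.ne_of_mem_erase hj)]
    · rw [if_pos rfl, Function.iterate_succ_apply']
  rw [key, Finset.sum_eq_single (Fin.last k)]
  · congr 1
    ext1 i j
    simp only [Matrix.of_apply]
    congr 1
    split_ifs with h
    · simp [h]
    · rfl
  · intro l _ hl
    have hl' : (l : ℕ) < k := Fin.val_lt_last hl
    refine Matrix.det_zero_of_column_eq (i := l) (j := ⟨l + 1, by omega⟩) ?_ ?_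
    · intro h; have := congrArg Fin.val h; simp at this
    · intro i
      have : (⟨l + 1, by omega⟩ : Fin (k + 1)) ≠ l := by
        intro h; have := congrArg Fin.val h; simp at this
      simp [this]
  · simp

/-- The Wronskian of the Wronskians `Wr(u_0, …, u_{i-1}, f)` and `Wr(u_0, …, u_{i-1}, g)`. -/
theorem wronskian_wrx (u : ℕ → R[X]) (i : ℕ) (f g : R[X]) :
    wronskian (wrx u i f) (wrx u i g) =
      wrs u i * wrx (Function.update u i f) (i + 1) g := by
  let A : Matrix (Fin i) (Fin i) R[X] := Matrix.of fun a b => derivative^[(b : ℕ)] (u a)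
  let B : Matrix (Fin i) (Fin 2) R[X] := Matrix.of fun a b => derivative^[i + (b : ℕ)] (u a)
  let Cc : Matrix (Fin 2) (Fin i) R[X] := Matrix.of fun a b => derivative^[(b : ℕ)] (![f, g] a)
  let D : Matrix (Fin 2) (Fin 2) R[X] := Matrix.of fun a b => derivative^[i + (b : ℕ)] (![f, g] a)
  have h := sub_eq_zero.1 (djDefect_eq_zero A B Cc D)
  have hA : A.det = wrs u i := rfl
  have hM : (Matrix.fromBlocks A B Cc D).det = wrx (Function.update u i f) (i + 1) g := by
    unfold wrx wr
    refine Eq.trans ?_ (Matrix.det_submatrix_equiv_self (finSumFinEquiv (m := i) (n := 2)) _)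
    congr 1
    ext1 a b
    rcases a with a | a <;> rcases b with b | b
    · simp [A, Fin.snoc, Function.update_of_ne a.2.ne]
    · simp [B, Fin.snoc, Function.update_of_ne a.2.ne]
    · fin_cases a <;> simp [Cc, Fin.snoc]
    · fin_cases a <;> simp [D, Fin.snoc]
  have hw : ∀ (c : Fin 2), (Matrix.fromBlocks A (B.submatrix id fun _ : Fin 1 => 0)
      (Cc.submatrix (fun _ : Fin 1 => c) id) (D.submatrix (fun _ => c) fun _ => 0)).det =
      wrx u i (![f, g] c) := by
    intro c
    unfold wrx wr
    rw [← Matrix.det_submatrix_equiv_self (finSumFinEquiv (m := i) (n := 1))]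
    congr 1
    ext1 a b
    rcases a with a | a <;> rcases b with b | b <;> simp [A, B, Cc, D, Fin.snoc]
  have hw' : ∀ (c : Fin 2), (Matrix.fromBlocks A (B.submatrix id fun _ : Fin 1 => 1)
      (Cc.submatrix (fun _ : Fin 1 => c) id) (D.submatrix (fun _ => c) fun _ => 1)).det =
      derivative (wrx u i (![f, g] c)) := by
    intro c
    unfold wrx
    rw [derivative_wr, ← Matrix.det_submatrix_equiv_self (finSumFinEquiv (m := i) (n := 1))]
    congr 1
    ext1 a b
    have hb : ∀ b : Fin i, ¬ (Fin.castAdd 1 b = Fin.last i) := by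
      intro b h; have := congrArg Fin.val h; simp at this; omega
    have hb' : ∀ b : Fin 1, (Fin.natAdd i b = Fin.last i) := by
      intro b; ext; simp
    rcases a with a | a <;> rcases b with b | b <;>
      simp [A, B, Cc, D, Fin.snoc, hb, hb']
  rw [hA, hM, hw, hw', hw, hw'] at h
  rw [h, wronskian]
  simp

theorem wronskian_wrs_succ_wrx (u : ℕ → R[X]) (i : ℕ) (g : R[X]) :
    wronskian (wrs u (i + 1)) (wrx u i g) = wrs u i * wrx u (i + 1) g := by
  rw [wrs_succ, wronskian_wrx, Function.update_eq_self]

/-! ### Order and degree of a Wronskian -/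

theorem coeff_X_pow_mul_iterate_derivative (p : R[X]) (j n : ℕ) :
    (X ^ j * derivative^[j] p).coeff n = (n.descFactorial j : R) * p.coeff n := by
  rw [coeff_X_pow_mul']
  split_ifs with h
  · rw [coeff_iterate_derivative, Nat.sub_add_cancel h, nsmul_eq_mul]
  · rw [Nat.descFactorial_of_lt (not_le.1 h)]
    simp

theorem X_pow_mul_wr {k : ℕ} (u : Fin k → R[X]) :
    X ^ (∑ j : Fin k, (j : ℕ)) * wr u =
      (Matrix.of fun i j : Fin k => X ^ (j : ℕ) * derivative^[(j : ℕ)] (u i)).det := by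
  rw [← Finset.prod_pow_eq_pow_sum, wr, ← Matrix.det_mul_row]
  rfl

/-- The determinant of the falling factorials of `e_i`, a Vandermonde determinant. It is the factor
in front of the extreme coefficient of a Wronskian of functions of orders (or degrees) `e_i`. -/
def fallingDet (R : Type*) [CommRing R] {k : ℕ} (e : Fin k → ℕ) : R :=
  (Matrix.of fun i j : Fin k => ((e i).descFactorial j : R)).det

theorem isUnit_fallingDet [Algebra ℂ R] {k : ℕ} (e : Fin k → ℕ) (he : Function.Injective e) :
    IsUnit (fallingDet R e) := by
  have h1 : fallingDet R e = algebraMap ℂ R (fallingDet ℂ e) := by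
    unfold fallingDet
    rw [RingHom.map_det]
    congr 1
    ext1 i j
    simp
  rw [h1]
  refine IsUnit.map _ (isUnit_iff_ne_zero.2 ?_)
  have h2 := Matrix.det_eval_matrixOfPolynomials_eq_det_vandermonde
    (fun i => (e i : ℂ)) (fun i : Fin k => descPochhammer ℂ i)
    (fun i => descPochhammer_natDegree ℂ i) (fun i => monic_descPochhammer ℂ i)
  have h3 : fallingDet ℂ e = (Matrix.vandermonde fun i => (e i : ℂ)).det := by
    rw [h2, fallingDet]
    congr 1
    ext1 i j
    simp [descPochhammer_eval_eq_descFactorial]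
  rw [h3]
  exact Matrix.det_vandermonde_ne_zero_iff.2 fun a b h => he (by exact_mod_cast h)

theorem exists_X_pow_mul_wr_eq {k : ℕ} (u : Fin k → R[X]) (e : Fin k → ℕ)
    (hu : ∀ i, X ^ e i ∣ u i) :
    ∃ H : R[X], X ^ (∑ j : Fin k, (j : ℕ)) * wr u = X ^ (∑ i, e i) * H ∧
      H.coeff 0 = fallingDet R e * ∏ i, (u i).coeff (e i) := by
  have h : ∀ i j : Fin k, ∃ h : R[X], X ^ (j : ℕ) * derivative^[(j : ℕ)] (u i) = X ^ e i * h := by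
    intro i j
    change (X : R[X]) ^ e i ∣ _
    rw [X_pow_dvd_iff]
    intro n hn
    rw [coeff_X_pow_mul_iterate_derivative, X_pow_dvd_iff.1 (hu i) n hn, mul_zero]
  choose h hh using h
  refine ⟨(Matrix.of h).det, ?_, ?_⟩
  · rw [X_pow_mul_wr, ← Finset.prod_pow_eq_pow_sum, ← Matrix.det_mul_column]
    congr 1
    ext1 i j
    simp [hh]
  · rw [← constantCoeff_apply, RingHom.map_det, fallingDet, mul_comm, ← Matrix.det_mul_column]
    congr 1
    ext1 i j
    have := congrArg (fun p => p.coeff (e i)) (hh i j)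
    simp only [coeff_X_pow_mul_iterate_derivative] at this
    have h0 : (X ^ e i * h i j).coeff (e i) = (h i j).coeff 0 := by
      simpa using coeff_X_pow_mul (h i j) (e i) 0
    rw [h0] at this
    simp [← this, mul_comm]

theorem coeff_prod_of_natDegree_le' {ι : Type*} (s : Finset ι) (f : ι → R[X]) (d : ι → ℕ)
    (h : ∀ i ∈ s, (f i).natDegree ≤ d i) :
    (∏ i ∈ s, f i).natDegree ≤ ∑ i ∈ s, d i ∧
      (∏ i ∈ s, f i).coeff (∑ i ∈ s, d i) = ∏ i ∈ s, (f i).coeff (d i) := by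
  classical
  induction s using Finset.induction_on with
  | empty => simp
  | insert a s ha ih =>
    obtain ⟨h1, h2⟩ := ih fun i hi => h i (Finset.mem_insert_of_mem hi)
    have h3 := h a (Finset.mem_insert_self a s)
    rw [Finset.prod_insert ha, Finset.sum_insert ha, Finset.prod_insert ha]
    exact ⟨natDegree_mul_le.trans (add_le_add h3 h1), by
      rw [coeff_mul_add_eq_of_natDegree_le h3 h1, h2]⟩

theorem natDegree_det_le_and_coeff {k : ℕ} (M : Matrix (Fin k) (Fin k) R[X]) (d : Fin k → ℕ)
    (h : ∀ i j, (M i j).natDegree ≤ d i) :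
    M.det.natDegree ≤ ∑ i, d i ∧
      M.det.coeff (∑ i, d i) = (Matrix.of fun i j => (M i j).coeff (d i)).det := by
  have key : ∀ σ : Equiv.Perm (Fin k), (∏ i, M (σ i) i).natDegree ≤ ∑ i, d i ∧
      (∏ i, M (σ i) i).coeff (∑ i, d i) = ∏ i, (M (σ i) i).coeff (d (σ i)) := by
    intro σ
    have := coeff_prod_of_natDegree_le' Finset.univ (fun i => M (σ i) i) (fun i => d (σ i))
      fun i _ => h _ _
    rwa [Equiv.sum_comp σ d] at this
  constructor
  · rw [Matrix.det_apply]
    refine natDegree_sum_le_of_forall_le _ _ fun σ _ => ?_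
    rw [Units.smul_def]
    exact (natDegree_smul_le _ _).trans (key σ).1
  · rw [Matrix.det_apply, Matrix.det_apply, finsetSum_coeff]
    refine Finset.sum_congr rfl fun σ _ => ?_
    rw [Units.smul_def, coeff_smul, (key σ).2]
    rfl

theorem natDegree_X_pow_mul_wr_le_and_coeff {k : ℕ} (u : Fin k → R[X]) (d : Fin k → ℕ)
    (hu : ∀ i, (u i).natDegree ≤ d i) :
    (X ^ (∑ j : Fin k, (j : ℕ)) * wr u).natDegree ≤ ∑ i, d i ∧
      (X ^ (∑ j : Fin k, (j : ℕ)) * wr u).coeff (∑ i, d i) =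
        fallingDet R d * ∏ i, (u i).coeff (d i) := by
  rw [X_pow_mul_wr]
  obtain ⟨h1, h2⟩ := natDegree_det_le_and_coeff
    (Matrix.of fun i j : Fin k => X ^ (j : ℕ) * derivative^[(j : ℕ)] (u i)) d (by
      intro i j
      rw [natDegree_le_iff_coeff_eq_zero]
      intro n hn
      rw [Matrix.of_apply, coeff_X_pow_mul_iterate_derivative,
        natDegree_le_iff_coeff_eq_zero.1 (hu i) n hn, mul_zero])
  refine ⟨h1, h2.trans ?_⟩
  rw [fallingDet, mul_comm, ← Matrix.det_mul_column]
  congr 1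
  ext1 i j
  simp [coeff_X_pow_mul_iterate_derivative, mul_comm]

theorem taylor_wr (z : R) {k : ℕ} (u : Fin k → R[X]) :
    wr (fun i => taylor z (u i)) = taylor z (wr u) := by
  have hd : ∀ (j : ℕ) (p : R[X]), derivative^[j] (taylor z p) = taylor z (derivative^[j] p) := by
    intro j
    induction j with
    | zero => intro p; rfl
    | succ j ih =>
      intro p
      rw [Function.iterate_succ_apply', ih, Function.iterate_succ_apply']
      simp [taylor_apply, derivative_comp]
  unfold wr
  have : taylor z (Matrix.of fun i j : Fin k => derivative^[(j : ℕ)] (u i)).det =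
      taylorAlgHom z (Matrix.of fun i j : Fin k => derivative^[(j : ℕ)] (u i)).det := rfl
  rw [this, AlgHom.map_det]
  congr 1
  ext1 i j
  simp [hd]

end Wronskian

/-! ### The equation `Wr(y, p) = q` -/

section Chains

variable {R : Type*} [CommRing R]

theorem coeff_X_mul_wronskian {y p : R[X]} {l m : ℕ} (hy : y.natDegree ≤ l)
    (hp : p.natDegree ≤ m) :
    (X * wronskian y p).coeff (l + m) = ((m : R) - l) * (y.coeff l * p.coeff m) := by
  have hX : ∀ (f : R[X]) (n : ℕ), (X * derivative f).coeff n = n * f.coeff n := by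
    intro f n
    simpa using coeff_X_pow_mul_iterate_derivative f 1 n
  have hXd : ∀ (f : R[X]) (n : ℕ), f.natDegree ≤ n → (X * derivative f).natDegree ≤ n := by
    intro f n hf
    rw [natDegree_le_iff_coeff_eq_zero]
    intro a ha
    rw [hX, natDegree_le_iff_coeff_eq_zero.1 hf a ha, mul_zero]
  have h : X * wronskian y p = y * (X * derivative p) - (X * derivative y) * p := by
    rw [wronskian]; ring
  rw [h, coeff_sub, coeff_mul_add_eq_of_natDegree_le hy (hXd p m hp),
    coeff_mul_add_eq_of_natDegree_le (hXd y l hy) hp, hX, hX]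
  ring

theorem mul_left_cancel_of_isUnit_leadingCoeff {y p q : R[X]} (hy : IsUnit y.leadingCoeff)
    (h : y * p = y * q) : p = q :=
  sub_eq_zero.1 ((isUnit_leadingCoeff_mul_right_eq_zero_iff hy).1 (by rw [mul_sub, h, sub_self]))

theorem dvd_wronskian_derivative_of_dvd {y₁ y₂ Q p : R[X]} (hc : IsCoprime y₁ y₂)
    (h : y₁ ∣ wronskian (derivative y₁) (Q * y₂)) (hp : y₁ ∣ wronskian y₂ p) :
    y₁ ∣ wronskian (derivative y₁) (Q * p) := by
  refine hc.dvd_of_dvd_mul_left (y := y₂) ?_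
  have : y₂ * wronskian (derivative y₁) (Q * p) =
      p * wronskian (derivative y₁) (Q * y₂) + derivative y₁ * Q * wronskian y₂ p := by
    simp only [wronskian, derivative_mul]; ring
  rw [this]
  exact dvd_add (h.mul_left _) (hp.mul_left _)

/-- The Wronskians of the polynomials obtained from the chains of `exists_chain`. -/
theorem wrx_chain (N : ℕ) (K y T : ℕ → R[X]) (p : ℕ → ℕ → R[X])
    (hK0 : K 0 = 1) (hy0 : y 0 = 1) (hK : ∀ i ≤ N, (K i).Monic) (hy : ∀ i ≤ N, (y i).Monic)
    (hKT : ∀ i, 1 ≤ i → i ≤ N → K i ^ 2 * T i = K (i - 1) * K (i + 1))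
    (hp : ∀ k, 1 ≤ k → k ≤ N + 1 → p k k = y k)
    (hw : ∀ k, k ≤ N + 1 → ∀ i, 1 ≤ i → i < k →
      wronskian (y i) (p k i) = T i * y (i - 1) * p k (i + 1)) (i : ℕ) :
    (i ≤ N + 1 → wrs (fun j => K 1 * p (j + 1) 1) i = K i * y i) ∧
      ∀ j, i ≤ j → j ≤ N →
        wrx (fun j => K 1 * p (j + 1) 1) i (K 1 * p (j + 1) 1) = K (i + 1) * p (j + 1) (i + 1) := by
  induction i with
  | zero => exact ⟨fun _ => by simp [hK0, hy0], fun j _ _ => by rw [wrx_zero]⟩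
  | succ i ih =>
    obtain ⟨ih1, ih2⟩ := ih
    have h1 : i + 1 ≤ N + 1 → wrs (fun j => K 1 * p (j + 1) 1) (i + 1) = K (i + 1) * y (i + 1) := by
      intro hi
      rw [wrs_succ, ih2 i le_rfl (by omega), hp (i + 1) (by omega) hi]
    refine ⟨h1, fun j hij hj => ?_⟩
    have h2 := wronskian_wrs_succ_wrx (fun j => K 1 * p (j + 1) 1) i (K 1 * p (j + 1) 1)
    rw [h1 (by omega), ih2 j (by omega) hj, ih1 (by omega)] at h2
    have h3 : wronskian (K (i + 1) * y (i + 1)) (K (i + 1) * p (j + 1) (i + 1)) =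
        K (i + 1) ^ 2 * wronskian (y (i + 1)) (p (j + 1) (i + 1)) := by
      simp only [wronskian, derivative_mul]; ring
    rw [h3, hw (j + 1) (by omega) (i + 1) (by omega) (by omega), Nat.add_sub_cancel] at h2
    have h4 := hKT (i + 1) (by omega) (by omega)
    rw [Nat.add_sub_cancel] at h4
    have h5 : IsUnit (K i * y i).leadingCoeff := by
      rw [((hK i (by omega)).mul (hy i (by omega))).leadingCoeff]; exact isUnit_one
    refine (mul_left_cancel_of_isUnit_leadingCoeff h5 ?_).symm
    rw [← h2]
    linear_combination (-(y i * p (j + 1) (i + 1 + 1))) * h4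

variable [Algebra ℂ R]

theorem isUnit_natCast_sub_natCast {m l : ℕ} (h : m ≠ l) : IsUnit ((m : R) - l) := by
  have h1 : ((m : R) - l) = algebraMap ℂ R ((m : ℂ) - l) := by simp
  rw [h1]
  exact IsUnit.map _ (isUnit_iff_ne_zero.2 (sub_ne_zero.2 (by exact_mod_cast h)))

theorem eq_C_mul_of_wronskian_eq_zero {y p : R[X]} (hy : IsUnit y.leadingCoeff)
    (h : wronskian y p = 0) : ∃ c, p = C c * y := by
  have key : ∀ r : R[X], wronskian y r = 0 → r.coeff y.natDegree = 0 → r = 0 := by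
    intro r hr hr0
    by_contra hne
    have hm : r.natDegree ≠ y.natDegree := by
      intro hm
      rw [← hm] at hr0
      exact hne (leadingCoeff_eq_zero.1 hr0)
    have h1 := coeff_X_mul_wronskian (R := R) (le_refl y.natDegree) (le_refl r.natDegree)
    rw [hr, mul_zero, coeff_zero, eq_comm, (isUnit_natCast_sub_natCast hm).mul_right_eq_zero,
      (show IsUnit (y.coeff y.natDegree) from hy).mul_right_eq_zero] at h1
    exact hne (leadingCoeff_eq_zero.1 h1)
  obtain ⟨u, hu⟩ := hy
  refine ⟨p.coeff y.natDegree * (u⁻¹ : Rˣ), sub_eq_zero.1 (key _ ?_ ?_)⟩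
  · have : wronskian y (p - C (p.coeff y.natDegree * (u⁻¹ : Rˣ)) * y) =
        wronskian y p - C (p.coeff y.natDegree * (u⁻¹ : Rˣ)) * wronskian y y := by
      simp only [wronskian, derivative_sub, derivative_mul, derivative_C]; ring
    rw [this, h, wronskian_self_eq_zero]; simp
  · have : y.coeff y.natDegree = u := hu.symm
    rw [coeff_sub, coeff_C_mul, this]
    simp

/-- A polynomial `v` with `Wr(η_0, …, η_{j-1}, v) = 0` is a combination of the `η_i`. -/
theorem exists_eq_sum_of_wrx_eq_zero (η : ℕ → R[X]) (j : ℕ)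
    (hη : ∀ i ≤ j, IsUnit (wrs η i).leadingCoeff) (v : R[X]) (hv : wrx η j v = 0) :
    ∃ c : ℕ → R, v = ∑ i ∈ Finset.range j, C (c i) * η i := by
  induction j generalizing v with
  | zero => exact ⟨0, by rw [wrx_zero] at hv; simp [hv]⟩
  | succ j ih =>
    have h1 := wronskian_wrs_succ_wrx η j v
    rw [hv, mul_zero] at h1
    obtain ⟨c, hc⟩ := eq_C_mul_of_wronskian_eq_zero (hη (j + 1) le_rfl) h1
    rw [wrs_succ, ← wrx_smul] at hc
    obtain ⟨b, hb⟩ := ih (fun i hi => hη i (by omega)) (v - C c * η j) (by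
      rw [wrx_sub, hc, sub_self])
    refine ⟨Function.update b j c, ?_⟩
    rw [Finset.sum_range_succ, Function.update_self, ← sub_eq_iff_eq_add, hb]
    refine Finset.sum_congr rfl fun i hi => ?_
    rw [Function.update_of_ne (Finset.mem_range.1 hi).ne]

/-- The flag of a sequence is determined by the Wronskians of its initial segments. -/
theorem exists_eq_sum_of_wrs_eq (η η' : ℕ → R[X]) (n : ℕ)
    (hη : ∀ i ≤ n, IsUnit (wrs η i).leadingCoeff)
    (h : ∀ i ≤ n, ∃ u : Rˣ, wrs η' i = C (u : R) * wrs η i) (j : ℕ) (hj : j < n) :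
    ∃ c : ℕ → R, η' j = ∑ i ∈ Finset.range (j + 1), C (c i) * η i := by
  have key : ∀ i ≤ n, ∃ a : Rˣ, ∀ v, wrx η' i v = C (a : R) * wrx η i v := by
    intro i
    induction i with
    | zero => exact fun _ => ⟨1, fun v => by simp [wrx_zero]⟩
    | succ i ih =>
      intro hi
      obtain ⟨a, ha⟩ := ih (by omega)
      obtain ⟨u, hu⟩ := h i (by omega)
      obtain ⟨u', hu'⟩ := h (i + 1) hi
      refine ⟨u⁻¹ * (u' * a), fun v => ?_⟩
      have h1 := wronskian_wrs_succ_wrx η' i v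
      have h2 := wronskian_wrs_succ_wrx η i v
      have h3 : wronskian (C (u' : R) * wrs η (i + 1)) (C (a : R) * wrx η i v) =
          C ((u' * a : Rˣ) : R) * wronskian (wrs η (i + 1)) (wrx η i v) := by
        simp only [wronskian, derivative_mul, derivative_C, Units.val_mul, C_mul]; ring
      rw [ha, hu', hu, h3, h2] at h1
      have h4 : wrs η i * (C ((u' * a : Rˣ) : R) * wrx η (i + 1) v) =
          wrs η i * (C (u : R) * wrx η' (i + 1) v) := by
        rw [← mul_assoc, mul_comm (wrs η i) (C _), mul_assoc, h1]; ring
      have h5 := mul_left_cancel_of_isUnit_leadingCoeff (hη i (by omega)) h4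
      have h6 : C ((u⁻¹ : Rˣ) : R) * C (u : R) = 1 := by rw [← C_mul]; simp
      rw [Units.val_mul, C_mul, mul_assoc, h5, ← mul_assoc, h6, one_mul]
  obtain ⟨a, ha⟩ := key (j + 1) hj
  refine exists_eq_sum_of_wrx_eq_zero η (j + 1) (fun i hi => hη i (by omega)) _ ?_
  have h1 := ha (η' j)
  rw [wrx_of_lt _ (Nat.lt_succ_self j)] at h1
  have h6 : C ((a⁻¹ : Rˣ) : R) * C (a : R) = 1 := by rw [← C_mul]; simp
  rw [← one_mul (wrx η _ _), ← h6, mul_assoc, ← h1, mul_zero]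

theorem exists_derivative_eq (h : R[X]) : ∃ H : R[X], derivative H = h := by
  induction h using Polynomial.induction_on' with
  | add p q hp hq =>
    obtain ⟨P, rfl⟩ := hp
    obtain ⟨Q, rfl⟩ := hq
    exact ⟨P + Q, by simp⟩
  | monomial n a =>
    refine ⟨monomial (n + 1) (a * algebraMap ℂ R ((n : ℂ) + 1)⁻¹), ?_⟩
    have : (algebraMap ℂ R ((n : ℂ) + 1)⁻¹) * ((n : R) + 1) = 1 := by
      have h0 : ((n : ℂ) + 1) ≠ 0 := by exact_mod_cast Nat.succ_ne_zero n
      rw [show ((n : R) + 1) = algebraMap ℂ R ((n : ℂ) + 1) by simp, ← map_mul,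
        inv_mul_cancel₀ h0, map_one]
    rw [derivative_monomial]
    simp [mul_assoc, this]

/-- If `y` is monic without multiple roots, then `Wr(y, p) = q` has a solution as soon as `y`
divides `Wr(y', q)`: this says that `q / y²` has no residues, and the solution is `y ∫ q / y²`. -/
theorem exists_wronskian_eq {y q : R[X]} (hy : y.Monic) (hc : IsCoprime y (derivative y))
    (h : y ∣ wronskian (derivative y) q) : ∃ p, wronskian y p = q := by
  nontriviality R
  have hy2 : (y ^ 2).Monic := hy.pow 2
  obtain ⟨H, hH⟩ := exists_derivative_eq (q /ₘ y ^ 2)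
  have hq := modByMonic_add_div q (y ^ 2)
  set r := q %ₘ y ^ 2 with hr
  have hrdeg : r.degree < (y ^ 2).degree := degree_modByMonic_lt q hy2
  have hyr : y ∣ wronskian (derivative y) r := by
    have h1 : wronskian (derivative y) r = wronskian (derivative y) q -
        y * (derivative y * (2 * derivative y * (q /ₘ y ^ 2) + y * derivative (q /ₘ y ^ 2)) -
          derivative (derivative y) * y * (q /ₘ y ^ 2)) := by
      rw [show wronskian (derivative y) q =
        wronskian (derivative y) (r + y ^ 2 * (q /ₘ y ^ 2)) by rw [hq]]
      simp only [wronskian, derivative_add, derivative_mul, derivative_pow]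
      simp only [Nat.cast_ofNat, map_ofNat, Nat.add_one_sub_one, pow_one]
      ring
    rw [h1]
    exact dvd_sub h (dvd_mul_right _ _)
  obtain ⟨a, b, hab⟩ := id hc
  set p := (-(r * b)) %ₘ y with hp
  have hpdeg : p.degree < y.degree := degree_modByMonic_lt _ hy
  have hpeq := modByMonic_add_div (-(r * b)) y
  rw [← hp] at hpeq
  have h0 : r - wronskian y p = 0 := by
    have hd1 : y ∣ r - wronskian y p := by
      refine ⟨r * a - derivative p - derivative y * ((-(r * b)) /ₘ y), ?_⟩
      have h2 : p = -(r * b) - y * ((-(r * b)) /ₘ y) := eq_sub_of_add_eq hpeq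
      have h3 : r = r * (a * y + b * derivative y) := by rw [hab, mul_one]
      rw [wronskian]
      linear_combination h3 + derivative y * h2
    obtain ⟨ρ, hρ⟩ := id hd1
    have hd2 : y ∣ derivative y * (derivative y * ρ) := by
      have h4 : derivative y * (derivative y * ρ) = wronskian (derivative y) (r - wronskian y p) -
          y * (derivative y * derivative ρ - derivative (derivative y) * ρ) := by
        rw [hρ]; simp only [wronskian, derivative_mul]; ring
      have h5 : wronskian (derivative y) (r - wronskian y p) = wronskian (derivative y) r -
          y * (derivative (derivative y) * derivative p - derivative y * derivative (derivative p))
            * (-1) := by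
        simp only [wronskian, derivative_mul, derivative_sub]; ring
      rw [h4, h5]
      exact dvd_sub (dvd_sub hyr ((dvd_mul_right _ _).mul_right _)) (dvd_mul_right _ _)
    have hd3 : y ∣ ρ := hc.dvd_of_dvd_mul_left (hc.dvd_of_dvd_mul_left hd2)
    have hd4 : y ^ 2 ∣ r - wronskian y p := by
      rw [hρ, pow_two]; exact mul_dvd_mul_left y hd3
    by_contra hne
    refine hy2.not_dvd_of_degree_lt hne ?_ hd4
    have hyb : y.degree ≠ ⊥ := by simpa [degree_eq_bot] using hy.ne_zero
    have h2y : (y ^ 2).degree = y.degree + y.degree := by rw [pow_two, hy.degree_mul]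
    have hlt : y.degree + p.degree < (y ^ 2).degree := by
      rw [h2y]; exact WithBot.add_lt_add_left hyb hpdeg
    refine (degree_sub_le _ _).trans_lt (max_lt hrdeg ?_)
    rw [wronskian]
    refine (degree_sub_le _ _).trans_lt (max_lt ?_ ?_)
    · exact ((degree_mul_le _ _).trans (add_le_add le_rfl degree_derivative_le)).trans_lt hlt
    · exact ((degree_mul_le _ _).trans (add_le_add degree_derivative_le le_rfl)).trans_lt hlt
  refine ⟨p + y * H, ?_⟩
  have h6 : wronskian y (p + y * H) = wronskian y p + y ^ 2 * derivative H := by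
    simp only [wronskian, derivative_mul, derivative_add]; ring
  rw [h6, hH, ← sub_eq_zero.1 h0, hq]

/-- Iterated solution of `Wr(y_i, p_i) = T_i y_{i-1} p_{i+1}`, downwards from `p_k = y_k`. The
solutions are unique up to multiples of `y_i`, so a normalisation `nrm` can be imposed. -/
theorem exists_chain (N : ℕ) (y T : ℕ → R[X]) (nrm : ℕ → R[X] → Prop)
    (hn : ∀ i p, 1 ≤ i → i ≤ N → ∃ c : R, nrm i (p + C c * y i))
    (hmon : ∀ i, 1 ≤ i → i ≤ N → (y i).Monic)
    (hcop : ∀ i, 1 ≤ i → i ≤ N → IsCoprime (y i) (derivative (y i)))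
    (hadj : ∀ i, 1 ≤ i → i ≤ N → IsCoprime (y i) (y (i + 1)))
    (hdiv : ∀ i, 1 ≤ i → i ≤ N →
      y i ∣ wronskian (derivative (y i)) (T i * y (i - 1) * y (i + 1)))
    (k : ℕ) (hk : k ≤ N + 1) :
    ∃ p : ℕ → R[X], p k = y k ∧ ∀ i, 1 ≤ i → i < k →
      wronskian (y i) (p i) = T i * y (i - 1) * p (i + 1) ∧ nrm i (p i) := by
  have key : ∀ j : ℕ, ∃ p : ℕ → R[X], p k = y k ∧ ∀ i, 1 ≤ i → i < k → k ≤ i + j →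
      wronskian (y i) (p i) = T i * y (i - 1) * p (i + 1) ∧ nrm i (p i) := by
    intro j
    induction j with
    | zero => exact ⟨y, rfl, fun i _ h1 h2 => by omega⟩
    | succ j ih =>
      obtain ⟨p, hp, hpi⟩ := ih
      by_cases hj : j + 2 ≤ k
      · obtain ⟨i, hi⟩ : ∃ i, k = i + (j + 1) := ⟨k - (j + 1), by omega⟩
        have h1 : 1 ≤ i := by omega
        have h2 : i ≤ N := by omega
        have hd : y i ∣ wronskian (y (i + 1)) (p (i + 1)) := by
          by_cases hik : i + 1 = k
          · rw [hik, hp, wronskian_self_eq_zero]; exact dvd_zero _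
          · rw [(hpi (i + 1) (by omega) (by omega) (by omega)).1, Nat.add_sub_cancel]
            exact (dvd_mul_left _ _).mul_right _
        obtain ⟨r, hr⟩ := exists_wronskian_eq (hmon i h1 h2) (hcop i h1 h2)
          (dvd_wronskian_derivative_of_dvd (hadj i h1 h2) (hdiv i h1 h2) hd)
        obtain ⟨c, hc⟩ := hn i r h1 h2
        refine ⟨Function.update p i (r + C c * y i), ?_, fun a ha1 ha2 ha3 => ?_⟩
        · rw [Function.update_of_ne (by omega), hp]
        · by_cases hai : a = i
          · subst hai
            rw [Function.update_self, Function.update_of_ne (by omega)]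
            refine ⟨?_, hc⟩
            rw [← hr]
            simp only [wronskian, derivative_add, derivative_mul, derivative_C]; ring
          · rw [Function.update_of_ne hai, Function.update_of_ne (by omega)]
            exact hpi a ha1 ha2 (by omega)
      · exact ⟨p, hp, fun i h1 h2 h3 => hpi i h1 h2 (by omega)⟩
  obtain ⟨p, hp, h⟩ := key k
  exact ⟨p, hp, fun i h1 h2 => h i h1 h2 (by omega)⟩

/-! ### Order and degree of a normalised solution -/

theorem pow_dvd_of_wronskian {y p : R[X]} {m : ℕ} (hy : IsUnit (y.coeff 0)) (hp : p.coeff 0 = 0)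
    (h : X ^ m ∣ wronskian y p) : X ^ (m + 1) ∣ p := by
  have key : ∀ j ≤ m + 1, 1 ≤ j → X ^ j ∣ p := by
    intro j hj hj1
    induction j, hj1 using Nat.le_induction with
    | base => rw [pow_one, X_dvd_iff]; exact hp
    | succ j hj1 ih =>
      obtain ⟨g, rfl⟩ := ih (by omega)
      obtain ⟨b, rfl⟩ : ∃ b, j = b + 1 := ⟨j - 1, by omega⟩
      rw [pow_succ]
      refine mul_dvd_mul_left _ (X_dvd_iff.2 ?_)
      have h1 : wronskian y (X ^ (b + 1) * g) = X ^ b *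
          (((b : R[X]) + 1) * (y * g) + X * (y * derivative g - derivative y * g)) := by
        simp only [wronskian, derivative_mul, derivative_X_pow, Nat.add_sub_cancel]
        push_cast
        simp only [map_add, map_natCast, map_one]
        ring
      have h2 := X_pow_dvd_iff.1 h b (by omega)
      have h4 : ∀ f : R[X], (X ^ b * f).coeff b = f.coeff 0 := fun f => by
        simpa only [zero_add] using coeff_X_pow_mul f b 0
      have h3 : (((b : R[X]) + 1) * (y * g)).coeff 0 = ((b : R) + 1) * (y.coeff 0 * g.coeff 0) := by
        simp [mul_coeff_zero]
      rw [h1, h4, coeff_add, h3, coeff_X_mul_zero, add_zero] at h2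
      have hb : IsUnit ((b : R) + 1) := by
        simpa using isUnit_natCast_sub_natCast (R := R) (Nat.succ_ne_zero b)
      rwa [hb.mul_right_eq_zero, hy.mul_right_eq_zero] at h2
  exact key (m + 1) le_rfl (by omega)

/-- The bound `B` on the degree is an integer, and it may be negative if `p = 0`. -/
theorem eq_zero_or_natDegree_le_of_wronskian {y p : R[X]} {l : ℕ} {B : ℤ} (hy : y.natDegree ≤ l)
    (hyl : IsUnit (y.coeff l)) (hp : p.coeff l = 0)
    (h : wronskian y p = 0 ∨ ((wronskian y p).natDegree : ℤ) + 1 ≤ B + l) :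
    p = 0 ∨ (p.natDegree : ℤ) ≤ B := by
  by_contra! hlt
  have hne : p.natDegree ≠ l := fun h1 => hlt.1 (leadingCoeff_eq_zero.1 (by
    rw [leadingCoeff, h1, hp]))
  have h1 := coeff_X_mul_wronskian hy (le_refl p.natDegree)
  have h2 : (X * wronskian y p).coeff (l + p.natDegree) = 0 := by
    rcases h with h | h
    · rw [h, mul_zero, coeff_zero]
    · refine coeff_eq_zero_of_natDegree_lt ?_
      have := natDegree_mul_le (p := (X : R[X])) (q := wronskian y p)
      have := natDegree_X_le (R := R)
      omega
  rw [h2, eq_comm, (isUnit_natCast_sub_natCast hne).mul_right_eq_zero,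
    hyl.mul_right_eq_zero] at h1
  exact hlt.1 (leadingCoeff_eq_zero.1 h1)

end Chains

/-! ### Coordinates adapted to the flags -/

theorem X_sub_C_pow_dvd_iff_taylor {R : Type*} [CommRing R] (z : R) (e : ℕ) (p : R[X]) :
    (X - C z) ^ e ∣ p ↔ X ^ e ∣ taylor z p := by
  have h : taylorEquiv z ((X - C z) ^ e) = X ^ e := by
    rw [map_pow]
    congr 1
    change taylor z (X - C z) = X
    simp
  rw [← h]
  exact (map_dvd_iff (taylorEquiv z)).symm

theorem sum_range_le_sum_of_card (f : ℕ → ℕ) (hf : Monotone f) (A : Finset ℕ) :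
    ∑ j ∈ Finset.range A.card, f j ≤ ∑ a ∈ A, f a := by
  induction h : A.card generalizing A with
  | zero => simp
  | succ i ih =>
    have hne : A.Nonempty := Finset.card_pos.1 (by omega)
    have hm := A.max'_mem hne
    have hi : i ≤ A.max' hne := by
      have : A ⊆ Finset.range (A.max' hne + 1) := fun a ha =>
        Finset.mem_range.2 (Nat.lt_succ_of_le (A.le_max' a ha))
      have := Finset.card_le_card this
      rw [Finset.card_range] at this
      omega
    rw [Finset.sum_range_succ, ← Finset.sum_erase_add _ _ hm]
    refine add_le_add ?_ (hf hi)
    have hc : (A.erase (A.max' hne)).card = i := by rw [Finset.card_erase_of_mem hm]; omega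
    exact ih _ hc

theorem sum_range_le_sum_injective (f : ℕ → ℕ) (hf : Monotone f) {i M : ℕ} (r : Fin i → Fin M)
    (hr : Function.Injective r) : ∑ j ∈ Finset.range i, f j ≤ ∑ j, f (r j) := by
  have hr' : Function.Injective fun j => (r j : ℕ) := Fin.val_injective.comp hr
  have h := sum_range_le_sum_of_card f hf (Finset.univ.image fun j => (r j : ℕ))
  rwa [Finset.card_image_of_injective _ hr', Finset.card_univ, Fintype.card_fin,
    Finset.sum_image (fun a _ b _ h => hr' h)] at h

namespace BasicSituation

variable {N d n : ℕ} (S : BasicSituation N d n)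
variable (R : Type*) {R' : Type*} [CommRing R] [CommRing R'] [Algebra ℂ R] [Algebra ℂ R']

/-- The exponents `j + a_{N+1-j}`, `0 ≤ j ≤ N`, of a space in the Schubert cell with index `s`: at a
finite point they are the orders of vanishing of its elements, at infinity their differences
from `d` are the degrees. -/
def ex (s : Option (Fin n)) (j : ℕ) : ℕ := j + S.a s (N + 1 - j)

theorem a_le (s : Option (Fin n)) (k : ℕ) : S.a s k ≤ d - N :=
  (S.a_antitone s (Nat.zero_le k)).trans (S.a_zero s).le

theorem ex_strictMono (s : Option (Fin n)) : StrictMono (S.ex s) := by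
  intro i j h
  have := S.a_antitone s (show N + 1 - j ≤ N + 1 - i by omega)
  unfold ex
  omega

theorem ex_le (s : Option (Fin n)) {j : ℕ} (hj : j ≤ N) : S.ex s j ≤ d := by
  have := S.a_le s (N + 1 - j)
  have := S.le
  unfold ex
  omega

/-- The pivots `d - j - a_{N+1-j}` of a space in the Schubert cell with index `s`. -/
def piv (s : Option (Fin n)) (j : ℕ) : ℕ := d - S.ex s j

theorem piv_add_ex (s : Option (Fin n)) {j : ℕ} (hj : j ≤ N) : S.piv s j + S.ex s j = d :=
  Nat.sub_add_cancel (S.ex_le s hj)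

theorem piv_le (s : Option (Fin n)) (j : ℕ) : S.piv s j ≤ d := Nat.sub_le _ _

theorem piv_lt (s : Option (Fin n)) {i j : ℕ} (hij : i < j) (hj : j ≤ N) :
    S.piv s j < S.piv s i := by
  have := S.ex_strictMono s hij
  have := S.piv_add_ex s hj
  have := S.piv_add_ex s (hij.le.trans hj)
  omega

theorem piv_injective (s : Option (Fin n)) {i j : ℕ} (hi : i ≤ N) (hj : j ≤ N)
    (h : S.piv s i = S.piv s j) : i = j := by
  rcases lt_trichotomy i j with hlt | rfl | hlt
  · exact absurd h (S.piv_lt s hlt hj).ne'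
  · rfl
  · exact absurd h (S.piv_lt s hlt hi).ne

/-- The coordinates of a polynomial of degree at most `d` adapted to the flag with index `s`: the
coefficient of `x^m` at infinity, the coefficient of `(x - z)^(d-m)` at a finite point `z`. -/
def fc : Option (Fin n) → ℕ → R[X] →ₗ[R] R
  | none, m => lcoeff R m
  | some i, m => (lcoeff R (d - m)).comp (taylor (algebraMap ℂ R (S.z i)))

/-- The vectors `x^m`, respectively `(x - z)^(d-m)`, dual to the coordinates `fc`. -/
def fb : Option (Fin n) → ℕ → R[X]
  | none, m => X ^ m
  | some i, m => (X - C (algebraMap ℂ R (S.z i))) ^ (d - m)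

variable {R}

theorem fc_map (f : R →ₐ[ℂ] R') (s : Option (Fin n)) (m : ℕ) (v : R[X]) :
    S.fc R' s m (v.map (f : R →+* R')) = f (S.fc R s m v) := by
  cases s with
  | none => simp [fc]
  | some i =>
    simp only [fc, LinearMap.comp_apply, lcoeff_apply]
    have : (algebraMap ℂ R') (S.z i) = (f : R →+* R') (algebraMap ℂ R (S.z i)) := by simp
    rw [this, ← map_taylor, coeff_map]
    rfl

theorem fb_map (f : R →ₐ[ℂ] R') (s : Option (Fin n)) (m : ℕ) :
    (S.fb R s m).map (f : R →+* R') = S.fb R' s m := by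
  cases s <;> simp [fb]

theorem natDegree_fb_le (s : Option (Fin n)) {m : ℕ} (hm : m ≤ d) :
    (S.fb R s m).natDegree ≤ d := by
  cases s with
  | none => exact (natDegree_X_pow_le m).trans hm
  | some i =>
    refine (natDegree_pow_le_of_le (m := 1) _ ?_).trans (by omega)
    exact natDegree_sub_le_of_le natDegree_X_le ((natDegree_C _).le.trans zero_le_one)

theorem fc_fb (s : Option (Fin n)) {m m' : ℕ} (hm : m ≤ d) (hm' : m' ≤ d) :
    S.fc R s m (S.fb R s m') = if m = m' then 1 else 0 := by
  cases s with
  | none => simp [fc, fb, coeff_X_pow]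
  | some i =>
    simp only [fc, fb, LinearMap.comp_apply, lcoeff_apply, taylor_pow]
    have : taylor (algebraMap ℂ R (S.z i)) (X - C (algebraMap ℂ R (S.z i))) = X := by simp
    rw [this, coeff_X_pow]
    congr 1
    simp only [eq_iff_iff]
    omega

theorem eq_sum_fc_fb (s : Option (Fin n)) {v : R[X]} (hv : v.natDegree ≤ d) :
    v = ∑ m ∈ Finset.range (d + 1), C (S.fc R s m v) * S.fb R s m := by
  cases s with
  | none => exact as_sum_range_C_mul_X_pow' v (Nat.lt_succ_of_le hv)
  | some i =>
    apply taylor_injective (algebraMap ℂ R (S.z i))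
    rw [map_sum]
    simp only [fc, fb, LinearMap.comp_apply, lcoeff_apply, taylor_mul, taylor_C, taylor_pow]
    have : taylor (algebraMap ℂ R (S.z i)) (X - C (algebraMap ℂ R (S.z i))) = X := by simp
    rw [this]
    have h2 := as_sum_range_C_mul_X_pow' (taylor (algebraMap ℂ R (S.z i)) v) (n := d + 1)
      (by rw [natDegree_taylor]; omega)
    rw [← Finset.sum_range_reflect] at h2
    refine h2.trans (Finset.sum_congr rfl fun j hj => ?_)
    rw [show d + 1 - 1 - j = d - j by omega]

/-- `v` lies in the member `F_{q+1}` of the flag with index `s`. -/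
def Low (s : Option (Fin n)) (q : ℕ) (v : R[X]) : Prop :=
  v.natDegree ≤ d ∧ ∀ m, q < m → m ≤ d → S.fc R s m v = 0

theorem low_iff_natDegree {q : ℕ} (hq : q ≤ d) (v : R[X]) :
    S.Low none q v ↔ v.natDegree ≤ q := by
  constructor
  · rintro ⟨h1, h2⟩
    rw [natDegree_le_iff_coeff_eq_zero]
    intro m hm
    by_cases hmd : m ≤ d
    · exact h2 m hm hmd
    · exact coeff_eq_zero_of_natDegree_lt (by omega)
  · exact fun h => ⟨h.trans hq, fun m hm _ => coeff_eq_zero_of_natDegree_lt (by omega)⟩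

theorem low_iff_dvd (i : Fin n) (q : ℕ) (v : R[X]) :
    S.Low (some i) q v ↔
      v.natDegree ≤ d ∧ (X - C (algebraMap ℂ R (S.z i))) ^ (d - q) ∣ v := by
  unfold Low
  rw [X_sub_C_pow_dvd_iff_taylor, X_pow_dvd_iff]
  refine and_congr_right fun hv => ⟨fun h m hm => ?_, fun h m hm hmd => ?_⟩
  · have := h (d - m) (by omega) (by omega)
    simpa [fc, show d - (d - m) = m by omega] using this
  · exact h (d - m) (by omega)

theorem Low.map (f : R →ₐ[ℂ] R') {s : Option (Fin n)} {q : ℕ} {v : R[X]} (h : S.Low s q v) :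
    S.Low s q (v.map (f : R →+* R')) :=
  ⟨natDegree_map_le.trans h.1, fun m hm hmd => by rw [fc_map, h.2 m hm hmd, map_zero]⟩

/-! ### The polynomials `K_i` and `T_i` -/

/-- The sum of the `i` smallest members of a ramification sequence. -/
def sa (s : Option (Fin n)) (i : ℕ) : ℕ := ∑ j ∈ Finset.range i, S.a s (N + 1 - j)

theorem sum_Icc_a (s : Option (Fin n)) (i : ℕ) (hi : i ≤ N + 1) :
    ∑ ℓ ∈ Finset.Icc 1 i, S.a s (N + 1 - i + ℓ) = S.sa s i := by
  unfold sa
  rw [← Finset.sum_range_reflect]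
  have : Finset.Icc 1 i = (Finset.range i).image (· + 1) := by
    ext x; simp only [Finset.mem_Icc, Finset.mem_image, Finset.mem_range]
    exact ⟨fun h => ⟨x - 1, by omega, by omega⟩, by rintro ⟨y, hy, rfl⟩; omega⟩
  rw [this, Finset.sum_image (by simp)]
  refine Finset.sum_congr rfl fun j hj => ?_
  have := Finset.mem_range.1 hj
  congr 1
  omega

theorem sa_succ (s : Option (Fin n)) (i : ℕ) : S.sa s (i + 1) = S.sa s i + S.a s (N + 1 - i) :=
  Finset.sum_range_succ _ _

theorem sum_ex (s : Option (Fin n)) (i : ℕ) :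
    ∑ j ∈ Finset.range i, S.ex s j = ∑ j ∈ Finset.range i, j + S.sa s i :=
  Finset.sum_add_distrib

theorem K_eq (i : ℕ) (hi : i ≤ N + 1) :
    S.K i = ∏ s : Fin n, (X - C (S.z s)) ^ S.sa (some s) i := by
  unfold K
  exact Finset.prod_congr rfl fun s _ => by rw [S.sum_Icc_a _ i hi]

theorem K_monic (i : ℕ) : (S.K i).Monic :=
  monic_prod_of_monic _ _ fun _ _ => (monic_X_sub_C _).pow _

theorem K_zero : S.K 0 = 1 := by
  rw [S.K_eq 0 (by omega)]
  simp [sa]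

/-- This identity turns the Wronskian relation between the polynomials `K_i y_i` into one between
the `y_i`, in which `T_i` appears. -/
theorem K_sq_mul_T (i : ℕ) (h1 : 1 ≤ i) (hi : i ≤ N) :
    S.K i ^ 2 * S.T i = S.K (i - 1) * S.K (i + 1) := by
  rw [S.K_eq i (by omega), S.K_eq (i - 1) (by omega), S.K_eq (i + 1) (by omega), T,
    ← Finset.prod_pow, ← Finset.prod_mul_distrib, ← Finset.prod_mul_distrib]
  refine Finset.prod_congr rfl fun s _ => ?_
  rw [← pow_mul, ← pow_add, ← pow_add]
  congr 1
  have e1 := S.sa_succ (some s) i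
  have e2 := S.sa_succ (some s) (i - 1)
  rw [Nat.sub_add_cancel h1, show N + 1 - (i - 1) = N + 2 - i by omega] at e2
  have := S.a_antitone (some s) (show N + 1 - i ≤ N + 2 - i by omega)
  omega

theorem natDegree_K (i : ℕ) (hi : i ≤ N + 1) : (S.K i).natDegree = ∑ s : Fin n, S.sa (some s) i := by
  rw [S.K_eq i hi, natDegree_prod_of_monic _ _ fun _ _ => (monic_X_sub_C _).pow _]
  refine Finset.sum_congr rfl fun s _ => ?_
  rw [(monic_X_sub_C _).natDegree_pow, natDegree_X_sub_C, mul_one]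

theorem T_monic (i : ℕ) : (S.T i).Monic :=
  monic_prod_of_monic _ _ fun _ _ => (monic_X_sub_C _).pow _

theorem sum_sa : ∑ s : Fin n, S.sa (some s) (N + 1) + S.sa none (N + 1) = (N + 1) * (d - N) := by
  rw [← S.sum_a, Fintype.sum_option, add_comm]
  have h : ∀ s, S.sa s (N + 1) = ∑ k ∈ Finset.Icc 1 (N + 1), S.a s k := by
    intro s
    rw [← S.sum_Icc_a s (N + 1) le_rfl]
    simp
  simp only [h]

/-- The degree of the Wronskian of the first `i` members of a generic flag. -/
def wdeg (i : ℕ) : ℤ := (i : ℤ) * ((d : ℤ) - i + 1) - S.sa none i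

theorem l_eq (i : ℕ) (hi : i ≤ N + 1) : S.l i = (S.wdeg i - (S.K i).natDegree).toNat := by
  unfold l wdeg
  rw [S.natDegree_K i hi, Fintype.sum_option]
  congr 1
  have h : ∀ s, ∑ ℓ ∈ Finset.Icc 1 i, (S.a s (N + 1 - i + ℓ) : ℤ) = S.sa s i := by
    intro s
    rw [← S.sum_Icc_a s i hi]
    push_cast
    rfl
  simp only [h]
  push_cast
  ring

/-- The numbers `a_k` have the total size `(N + 1)(d - N)`, so that the degree of the Wronskian of
`V` is used up by its prescribed zeros: this is where the dimension condition on `Ω` enters. -/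
theorem wdeg_last : S.wdeg (N + 1) = (S.K (N + 1)).natDegree := by
  unfold wdeg
  rw [S.natDegree_K _ le_rfl]
  have h := S.sum_sa
  have := S.le
  zify [this] at h
  push_cast at h ⊢
  linear_combination -h

theorem sum_piv (s : Option (Fin n)) (i : ℕ) (hi : i ≤ N + 1) :
    ((∑ j ∈ Finset.range i, S.piv s j : ℕ) : ℤ) =
      i * ((d : ℤ) - i + 1) - S.sa s i + (∑ j ∈ Finset.range i, j : ℕ) := by
  have h1 : ∑ j ∈ Finset.range i, (S.piv s j + S.ex s j) = i * d := by
    rw [Finset.sum_congr rfl fun j hj => S.piv_add_ex s (by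
      have := Finset.mem_range.1 hj; omega : j ≤ N)]
    simp
  rw [Finset.sum_add_distrib, S.sum_ex] at h1
  have h2 := Finset.sum_range_id_mul_two i
  have h3 : ((i - 1 : ℕ) : ℤ) * i = ((i : ℤ) - 1) * i := by
    cases i <;> simp
  zify at h1 h2
  rw [mul_comm (i : ℤ) ((i - 1 : ℕ) : ℤ), h3] at h2
  push_cast at h1 h2 ⊢
  linear_combination h1 - h2

/-! ### Wronskians of elements of a space in the Schubert cells -/

theorem fc_piv_some (i : Fin n) {j : ℕ} (hj : j ≤ N) (v : R[X]) :
    S.fc R (some i) (S.piv (some i) j) v =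
      (taylor (algebraMap ℂ R (S.z i)) v).coeff (S.ex (some i) j) := by
  have := S.piv_add_ex (some i) hj
  simp only [fc, LinearMap.comp_apply, lcoeff_apply]
  congr 1
  omega

theorem X_pow_dvd_taylor_of_low {i : Fin n} {j : ℕ} (hj : j ≤ N) {v : R[X]}
    (h : S.Low (some i) (S.piv (some i) j) v) :
    X ^ S.ex (some i) j ∣ taylor (algebraMap ℂ R (S.z i)) v := by
  have h1 := ((S.low_iff_dvd i _ v).1 h).2
  have := S.piv_add_ex (some i) hj
  rwa [show d - S.piv (some i) j = S.ex (some i) j by omega, X_sub_C_pow_dvd_iff_taylor] at h1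

/-- Over any ring, the Wronskian of elements of a space which satisfies the Schubert conditions at
`z_s` vanishes at `z_s` to the order which is prescribed by the factor of `K_i` at `z_s`. -/
theorem X_sub_C_pow_dvd_wr {s : Fin n} (v : Fin (N + 1) → R[X])
    (hv : ∀ j : Fin (N + 1), S.Low (some s) (S.piv (some s) j) (v j)) {i : ℕ} (w : Fin i → R[X])
    (hw : ∀ j, w j ∈ Submodule.span R (Set.range v)) :
    (X - C (algebraMap ℂ R (S.z s))) ^ S.sa (some s) i ∣ wr w := by
  let M : Submodule R R[X] :=
    (Ideal.span {(X - C (algebraMap ℂ R (S.z s))) ^ S.sa (some s) i}).restrictScalars R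
  suffices h : wr w ∈ M from Ideal.mem_span_singleton.1 h
  refine wr_mem_of_mem_span v M (fun r hr => Ideal.mem_span_singleton.2 ?_) w hw
  rw [X_sub_C_pow_dvd_iff_taylor, ← taylor_wr]
  obtain ⟨H, hH, -⟩ := exists_X_pow_mul_wr_eq
    (fun j => taylor (algebraMap ℂ R (S.z s)) ((v ∘ r) j)) (fun j => S.ex (some s) (r j))
    fun j => S.X_pow_dvd_taylor_of_low (Nat.lt_succ_iff.1 (r j).2) (hv (r j))
  -- The sum of `i` distinct exponents is at least the sum of the first `i` of them.
  have h1 := sum_range_le_sum_injective (S.ex (some s)) (S.ex_strictMono _).monotone r hr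
  rw [S.sum_ex, ← Fin.sum_univ_eq_sum_range] at h1
  have h2 : X ^ (∑ j : Fin i, (j : ℕ)) * X ^ S.sa (some s) i ∣
      X ^ (∑ j : Fin i, (j : ℕ)) *
        wr fun j => taylor (algebraMap ℂ R (S.z s)) ((v ∘ r) j) := by
    rw [hH, ← pow_add]
    exact (pow_dvd_pow _ h1).mul_right _
  obtain ⟨g, hg⟩ := h2
  exact ⟨g, (isRegular_X_pow _).left (by simpa only [mul_assoc] using hg)⟩

/-- The Schubert condition at infinity bounds the degree of the Wronskians by `wdeg`. The bound is
stated in terms of coefficients because `wdeg` is an integer. -/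
theorem natDegree_wr_le (v : Fin (N + 1) → R[X])
    (hv : ∀ j : Fin (N + 1), S.Low none (S.piv none j) (v j)) {i : ℕ} (hi : i ≤ N + 1) (w : Fin i → R[X])
    (hw : ∀ j, w j ∈ Submodule.span R (Set.range v)) :
    ∀ m : ℕ, S.wdeg i < m → (wr w).coeff m = 0 := by
  intro m hm
  suffices h : wr w ∈ LinearMap.ker (lcoeff R m) from h
  refine wr_mem_of_mem_span v _ (fun r hr => LinearMap.mem_ker.2 ?_) w hw
  obtain ⟨h1, -⟩ := natDegree_X_pow_mul_wr_le_and_coeff (v ∘ r) (fun j => S.piv none (r j))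
    fun j => (S.low_iff_natDegree (S.piv_le _ _) _).1 (hv (r j))
  have h2 := sum_range_le_sum_injective (S.ex none) (S.ex_strictMono _).monotone r hr
  have h3 : ∑ j, (S.piv none (r j) + S.ex none (r j)) = i * d := by
    rw [Finset.sum_congr rfl fun j _ => S.piv_add_ex none (Nat.lt_succ_iff.1 (r j).2)]
    simp
  have h3' : ∑ j ∈ Finset.range i, (S.piv none j + S.ex none j) = i * d := by
    rw [Finset.sum_congr rfl fun j hj => S.piv_add_ex none (by
      have := Finset.mem_range.1 hj; omega : j ≤ N)]
    simp
  rw [Finset.sum_add_distrib] at h3 h3'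
  have h4 := S.sum_piv none i hi
  have h5 : (X ^ (∑ j : Fin i, (j : ℕ)) * wr (v ∘ r)).coeff (m + ∑ j : Fin i, (j : ℕ)) = 0 := by
    refine coeff_eq_zero_of_natDegree_lt (h1.trans_lt ?_)
    rw [Fin.sum_univ_eq_sum_range (fun j => j)]
    unfold wdeg at hm
    zify at h2 h3 h3' ⊢
    push_cast at h4
    linarith
  rwa [coeff_X_pow_mul] at h5

end BasicSituation

namespace BasicSituation

variable {N d n : ℕ} (S : BasicSituation N d n)
variable {R R' : Type*} [CommRing R] [CommRing R'] [Algebra ℂ R] [Algebra ℂ R']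

/-! ### Points of the Schubert cells -/

theorem mem_polySpace_iff (v : ℂ[X]) : v ∈ polySpace d ↔ v.natDegree ≤ d := by
  rw [polySpace, mem_degreeLT, degree_lt_iff_coeff_zero, natDegree_le_iff_coeff_eq_zero]
  exact Iff.rfl

theorem mem_flag_iff (s : Option (Fin n)) (u : ℕ) (v : ℂ[X]) :
    v ∈ S.flag s u ↔ v.natDegree ≤ d ∧ ∀ m, u ≤ m → m ≤ d → S.fc ℂ s m v = 0 := by
  cases s with
  | none =>
    simp only [flag, flagAtInfty, Submodule.mem_inf, mem_polySpace_iff]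
    rw [and_comm]
    refine and_congr_right fun hv => ?_
    rw [mem_degreeLT, degree_lt_iff_coeff_zero]
    refine ⟨fun h m hm _ => h m hm, fun h m hm => ?_⟩
    by_cases hmd : m ≤ d
    · exact h m hm hmd
    · exact coeff_eq_zero_of_natDegree_lt (by omega)
  | some i =>
    simp only [flag, flagAt, Submodule.mem_inf, mem_polySpace_iff,
      Submodule.restrictScalars_mem, Ideal.mem_span_singleton]
    rw [and_comm]
    refine and_congr_right fun hv => ?_
    rw [X_sub_C_pow_dvd_iff_taylor, X_pow_dvd_iff]
    refine ⟨fun h m hm hmd => h (d - m) (by omega), fun h m hm => ?_⟩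
    have := h (d - m) (by omega) (by omega)
    simpa [fc, show d - (d - m) = m by omega] using this

/-- `v` is an echelon family for the flag with index `s`: its `k`-th member has pivot `piv s k`. -/
def Exact (s : Option (Fin n)) (v : Fin (N + 1) → ℂ[X]) : Prop :=
  ∀ k : Fin (N + 1), S.Low s (S.piv s k) (v k) ∧ S.fc ℂ s (S.piv s k) (v k) ≠ 0

variable {S}

/-- Coefficients with respect to an echelon family are determined successively by the coordinates
at the pivots. -/
theorem Exact.coeff_eq_zero {s : Option (Fin n)} {v : Fin (N + 1) → ℂ[X]} (hv : S.Exact s v)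
    (c : Fin (N + 1) → ℂ) (K : ℕ)
    (h : ∀ j : Fin (N + 1), (j : ℕ) < K → S.fc ℂ s (S.piv s j) (∑ k, c k • v k) = 0)
    (j : Fin (N + 1)) (hj : (j : ℕ) < K) : c j = 0 := by
  obtain ⟨j, hjN⟩ := j
  induction j using Nat.strongRecOn with
  | ind j ih =>
    have h1 := h ⟨j, hjN⟩ hj
    rw [map_sum, Finset.sum_eq_single ⟨j, hjN⟩, map_smul, smul_eq_mul] at h1
    · exact (mul_eq_zero.1 h1).resolve_right (hv ⟨j, hjN⟩).2
    · intro k _ hk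
      rw [map_smul]
      rcases lt_trichotomy (k : ℕ) j with hlt | heq | hlt
      · rw [show c k = 0 from ih k hlt k.2 (hlt.trans hj), zero_smul]
      · exact absurd (Fin.ext heq) hk
      · rw [(hv k).1.2 _ (S.piv_lt s hlt (Nat.lt_succ_iff.1 k.2)) (S.piv_le _ _), smul_zero]
    · simp

theorem Exact.linearIndependent {s : Option (Fin n)} {v : Fin (N + 1) → ℂ[X]}
    (hv : S.Exact s v) : LinearIndependent ℂ v := by
  rw [Fintype.linearIndependent_iff]
  intro c hc j
  exact hv.coeff_eq_zero c (N + 1) (fun j _ => by rw [hc, map_zero]) j j.2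

/-- The dimension of the intersection of the span of an echelon family with a member of the flag
is the number of its pivots below the index of the member. -/
theorem Exact.finrank_inf {s : Option (Fin n)} {v : Fin (N + 1) → ℂ[X]} (hv : S.Exact s v)
    (u : ℕ) : Module.finrank ℂ (Submodule.span ℂ (Set.range v) ⊓ S.flag s u : Submodule ℂ ℂ[X]) =
      Fintype.card {k : Fin (N + 1) // S.piv s k < u} := by
  have h : Submodule.span ℂ (Set.range v) ⊓ S.flag s u =
      Submodule.span ℂ (Set.range fun k : {k : Fin (N + 1) // S.piv s k < u} => v k) := by
    apply le_antisymm
    · rintro w ⟨hw1, hw2⟩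
      obtain ⟨c, rfl⟩ := (Submodule.mem_span_range_iff_exists_fun ℂ).1 hw1
      rw [SetLike.mem_coe, mem_flag_iff] at hw2
      refine Submodule.sum_mem _ fun k _ => ?_
      by_cases hk : S.piv s k < u
      · exact Submodule.smul_mem _ _ (Submodule.subset_span ⟨⟨k, hk⟩, rfl⟩)
      · rw [hv.coeff_eq_zero c (k + 1) (fun j hj => hw2.2 _ ?_ (S.piv_le _ _)) k (by omega),
          zero_smul]
        · exact zero_mem _
        · rcases Nat.lt_succ_iff_lt_or_eq.1 hj with hlt | heq
          · exact (not_lt.1 hk).trans (S.piv_lt s hlt (Nat.lt_succ_iff.1 k.2)).le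
          · rw [heq]; exact not_lt.1 hk
    · rw [Submodule.span_le]
      rintro _ ⟨⟨k, hk⟩, rfl⟩
      refine ⟨Submodule.subset_span ⟨k, rfl⟩, (S.mem_flag_iff _ _ _).2 ⟨(hv k).1.1, fun m hm => ?_⟩⟩
      exact (hv k).1.2 m (hk.trans_le hm)
  rw [h, finrank_span_eq_card]
  exact hv.linearIndependent.comp _ Subtype.val_injective

/-- The Schubert cell consists of the spans of echelon families. -/
theorem mem_cell_iff (s : Option (Fin n)) (V : Submodule ℂ ℂ[X]) :
    V ∈ S.cell s ↔ ∃ v : Fin (N + 1) → ℂ[X], S.Exact s v ∧ Submodule.span ℂ (Set.range v) = V := by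
  have hle := S.le
  constructor
  · rintro ⟨h1, h2, h3⟩
    have : Module.Finite ℂ V := Module.finite_of_finrank_pos (by omega)
    have key : ∀ k : Fin (N + 1), ∃ w ∈ V, S.Low s (S.piv s k) w ∧
        S.fc ℂ s (S.piv s k) w ≠ 0 := by
      intro k
      have hk : (k : ℕ) ≤ N := Nat.lt_succ_iff.1 k.2
      have hp := S.piv_add_ex s hk
      have ha := S.a_le s (N + 1 - k)
      have ha' := S.a_le s (N - k)
      have hanti := S.a_antitone s (show N - k ≤ N + 1 - k by omega)
      have hanti' := S.a_antitone s (show N + 1 - k ≤ N + 1 - k + 1 by omega)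
      unfold ex at hp
      -- The dimension of the intersection with the flag jumps at the pivot.
      have e1 := h3 (N + 1 - k) (by omega) (S.piv s k + 1) (by omega) (by omega)
      have e2 := h3 (N - k) (by omega) (S.piv s k) (by omega) (by
        rw [show N - k + 1 = N + 1 - k by omega]; omega)
      by_contra! hcon
      have : V ⊓ S.flag s (S.piv s k + 1) ≤ V ⊓ S.flag s (S.piv s k) := by
        rintro w ⟨hw1, hw2⟩
        refine ⟨hw1, ?_⟩
        rw [SetLike.mem_coe, mem_flag_iff] at hw2 ⊢
        refine ⟨hw2.1, fun m hm hmd => ?_⟩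
        rcases hm.lt_or_eq with hlt | rfl
        · exact hw2.2 m hlt hmd
        · exact hcon w hw1 ⟨hw2.1, fun m hm => hw2.2 m hm⟩
      have hfin : Module.Finite ℂ (V ⊓ S.flag s (S.piv s k) : Submodule ℂ ℂ[X]) :=
        Submodule.finiteDimensional_inf_left _ _
      have := Submodule.finrank_mono this
      rw [e1, e2] at this
      omega
    choose v hv1 hv2 using key
    have hex : S.Exact s v := fun k => hv2 k
    refine ⟨v, hex, Submodule.eq_of_le_of_finrank_eq ?_ ?_⟩
    · rw [Submodule.span_le]; rintro _ ⟨k, rfl⟩; exact hv1 k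
    · rw [finrank_span_eq_card hex.linearIndependent, h2, Fintype.card_fin]
  · rintro ⟨v, hv, rfl⟩
    refine ⟨?_, ?_, fun ℓ hℓ u hu1 hu2 => ?_⟩
    · rw [Submodule.span_le]
      rintro _ ⟨k, rfl⟩
      exact (mem_polySpace_iff _).2 (hv k).1.1
    · rw [finrank_span_eq_card hv.linearIndependent, Fintype.card_fin]
    · rw [hv.finrank_inf, Fintype.card_subtype]
      have : (Finset.univ.filter fun k : Fin (N + 1) => S.piv s k < u) =
          Finset.univ.filter fun k : Fin (N + 1) => N + 1 - ℓ ≤ (k : ℕ) := by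
        ext k
        simp only [Finset.mem_filter, Finset.mem_univ, true_and]
        have hk : (k : ℕ) ≤ N := Nat.lt_succ_iff.1 k.2
        have hp := S.piv_add_ex s hk
        have ha := S.a_le s (N + 1 - k)
        have ha' := S.a_le s ℓ
        have ha'' := S.a_le s (ℓ + 1)
        unfold ex at hp
        constructor
        · intro h
          by_contra hlt
          have := S.a_antitone s (show ℓ + 1 ≤ N + 1 - k by omega)
          omega
        · intro h
          have := S.a_antitone s (show N + 1 - k ≤ ℓ by omega)
          omega
      rw [this]
      rw [← Finset.card_map Fin.valEmbedding]
      have : (Finset.univ.filter fun k : Fin (N + 1) => N + 1 - ℓ ≤ (k : ℕ)).map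
          Fin.valEmbedding = Finset.Ico (N + 1 - ℓ) (N + 1) := by
        ext x
        simp only [Finset.mem_map, Finset.mem_filter, Finset.mem_univ, true_and, Finset.mem_Ico]
        exact ⟨by rintro ⟨k, hk, rfl⟩; exact ⟨hk, k.2⟩, fun h => ⟨⟨x, h.2⟩, h.1, rfl⟩⟩
      rw [this, Nat.card_Ico]
      omega

/-! ### The universal space over an affine chart -/

variable (b : Module.Basis (Fin (N + 1) ⊕ Fin (d - N)) ℂ (polySpace d))

/-- The monomial `x^m` as an element of `W`. -/
def monomialElem (d : ℕ) (m : Fin (d + 1)) : polySpace d :=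
  ⟨X ^ (m : ℕ), (mem_polySpace_iff _).2
    ((natDegree_X_pow_le _).trans (Nat.lt_succ_iff.1 m.2))⟩

variable (R) in
/-- The coordinates with respect to the basis `b`, extended to polynomials over `R`. -/
def bco (k : Fin (N + 1) ⊕ Fin (d - N)) : R[X] →ₗ[R] R :=
  ∑ m : Fin (d + 1), algebraMap ℂ R (b.repr (monomialElem d m) k) • lcoeff R (m : ℕ)

variable (R) in
/-- The vectors of the basis `b`, as polynomials over `R`. -/
def bv (k : Fin (N + 1) ⊕ Fin (d - N)) : R[X] := (b k : ℂ[X]).map (algebraMap ℂ R)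

theorem bco_map (f : R →ₐ[ℂ] R') (k : Fin (N + 1) ⊕ Fin (d - N)) (v : R[X]) :
    bco R' b k (v.map (f : R →+* R')) = f (bco R b k v) := by
  simp [bco]

theorem bv_map (f : R →ₐ[ℂ] R') (k : Fin (N + 1) ⊕ Fin (d - N)) :
    (bv R b k).map (f : R →+* R') = bv R' b k := by
  rw [bv, bv, Polynomial.map_map]
  congr 1
  exact f.comp_algebraMap

theorem natDegree_bv_le (k : Fin (N + 1) ⊕ Fin (d - N)) : (bv R b k).natDegree ≤ d :=
  natDegree_map_le.trans ((mem_polySpace_iff _).1 (b k).2)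

theorem bco_complex (k : Fin (N + 1) ⊕ Fin (d - N)) (v : polySpace d) :
    bco ℂ b k v = b.repr v k := by
  have hv : v = ∑ m : Fin (d + 1), (v : ℂ[X]).coeff m • monomialElem d m := by
    apply Subtype.ext
    have h := as_sum_range_C_mul_X_pow' (v : ℂ[X]) (n := d + 1)
      (Nat.lt_succ_of_le ((mem_polySpace_iff _).1 v.2))
    rw [← Fin.sum_univ_eq_sum_range (fun m => C ((v : ℂ[X]).coeff m) * X ^ m)] at h
    refine h.trans ?_
    rw [Submodule.coe_sum]
    exact Finset.sum_congr rfl fun m _ => (smul_eq_C_mul _).symm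
  refine Eq.trans ?_ (congrArg (fun w => b.repr w k) hv).symm
  simp [bco, mul_comm]

theorem bco_bv (k k' : Fin (N + 1) ⊕ Fin (d - N)) :
    bco R b k (bv R b k') = if k = k' then 1 else 0 := by
  have h := bco_map b (Algebra.ofId ℂ R) k (b k' : ℂ[X])
  rw [bco_complex, Module.Basis.repr_self] at h
  refine h.trans ?_
  rw [Finsupp.single_apply]
  by_cases hk : k = k' <;> simp [hk, eq_comm]

theorem eq_sum_bco_bv {v : R[X]} (hv : v.natDegree ≤ d) :
    v = ∑ k, C (bco R b k v) * bv R b k := by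
  have hX : ∀ m : Fin (d + 1), (X ^ (m : ℕ) : R[X]) =
      ∑ k, C (bco R b k (X ^ (m : ℕ))) * bv R b k := by
    intro m
    let x : polySpace d := monomialElem d m
    have h1 := congrArg (fun w : polySpace d => (w : ℂ[X]).map (algebraMap ℂ R)) (b.sum_repr x)
    have h2 : ∀ k, bco R b k (X ^ (m : ℕ)) = algebraMap ℂ R (b.repr x k) := by
      intro k
      have := bco_map b (Algebra.ofId ℂ R) k (X ^ (m : ℕ))
      rw [show (X ^ (m : ℕ) : ℂ[X]) = x from rfl, bco_complex] at this
      refine Eq.trans ?_ this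
      congr 1
      simp [x, monomialElem]
    simp only [h2]
    refine Eq.trans (b := map (algebraMap ℂ R) (x : ℂ[X])) ?_ (h1.symm.trans ?_)
    · simp [x, monomialElem]
    · rw [Submodule.coe_sum, Polynomial.map_sum]
      refine Finset.sum_congr rfl fun k _ => ?_
      rw [Submodule.coe_smul, smul_eq_C_mul, Polynomial.map_mul, map_C, bv]
  have h := as_sum_range_C_mul_X_pow' v (n := d + 1) (Nat.lt_succ_of_le hv)
  rw [← Fin.sum_univ_eq_sum_range (fun m => C (v.coeff m) * X ^ m)] at h
  conv_lhs => rw [h]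
  conv_rhs => rw [h]
  simp only [map_sum, ← smul_eq_C_mul, map_smul]
  simp only [smul_eq_C_mul, Finset.sum_mul]
  rw [Finset.sum_comm]
  refine Finset.sum_congr rfl fun m _ => ?_
  conv_lhs => rw [hX m]
  rw [Finset.mul_sum]
  refine Finset.sum_congr rfl fun k _ => ?_
  rw [smul_eq_mul, C_mul, mul_assoc]

/-- The vectors `e_i + ∑_j c_{ij} f_j` spanning the space with chart coordinates `c`. -/
def cv (c : Fin (N + 1) × Fin (d - N) → R) (i : Fin (N + 1)) : R[X] :=
  bv R b (Sum.inl i) + ∑ j, C (c (i, j)) * bv R b (Sum.inr j)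

theorem cv_map (f : R →ₐ[ℂ] R') (c : Fin (N + 1) × Fin (d - N) → R) (i : Fin (N + 1)) :
    (cv b c i).map (f : R →+* R') = cv b (fun p => f (c p)) i := by
  simp only [cv, Polynomial.map_add, Polynomial.map_sum, Polynomial.map_mul, bv_map, map_C]
  rfl

theorem natDegree_cv_le (c : Fin (N + 1) × Fin (d - N) → R) (i : Fin (N + 1)) :
    (cv b c i).natDegree ≤ d :=
  natDegree_add_le_of_degree_le (natDegree_bv_le b _) (natDegree_sum_le_of_forall_le _ _
    fun _ _ => (natDegree_C_mul_le _ _).trans (natDegree_bv_le b _))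

theorem bco_inl_cv (c : Fin (N + 1) × Fin (d - N) → R) (k i : Fin (N + 1)) :
    bco R b (Sum.inl k) (cv b c i) = if k = i then 1 else 0 := by
  simp only [cv, map_add, map_sum, ← smul_eq_C_mul, map_smul, bco_bv]
  simp

theorem bco_inr_cv (c : Fin (N + 1) × Fin (d - N) → R) (j : Fin (d - N)) (i : Fin (N + 1)) :
    bco R b (Sum.inr j) (cv b c i) = c (i, j) := by
  simp only [cv, map_add, map_sum, ← smul_eq_C_mul, map_smul, bco_bv]
  simp

theorem chartPoint_eq (c : Fin (N + 1) × Fin (d - N) → ℂ) :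
    chartPoint b c = Submodule.span ℂ (Set.range (cv b c)) := by
  unfold chartPoint
  congr 2
  ext1 i
  simp [cv, bv, smul_eq_C_mul]

theorem bco_inl_sum_cv (c : Fin (N + 1) × Fin (d - N) → R) (P : Fin (N + 1) → R)
    (k : Fin (N + 1)) : bco R b (Sum.inl k) (∑ i, C (P i) * cv b c i) = P k := by
  simp only [map_sum, ← smul_eq_C_mul, map_smul, bco_inl_cv]
  simp

theorem bco_inr_sum_cv (c : Fin (N + 1) × Fin (d - N) → R) (P : Fin (N + 1) → R)
    (j : Fin (d - N)) : bco R b (Sum.inr j) (∑ i, C (P i) * cv b c i) = ∑ i, P i * c (i, j) := by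
  simp only [map_sum, ← smul_eq_C_mul, map_smul, bco_inr_cv, smul_eq_mul]

theorem sum_cv_eq {c : Fin (N + 1) × Fin (d - N) → R} {P : Fin (N + 1) → R} {v : R[X]}
    (hv : v.natDegree ≤ d) (hP : ∀ i, bco R b (Sum.inl i) v = P i)
    (hQ : ∀ j, bco R b (Sum.inr j) v = ∑ i, P i * c (i, j)) : v = ∑ i, C (P i) * cv b c i := by
  rw [eq_sum_bco_bv b hv, eq_sum_bco_bv b (v := ∑ i, C (P i) * cv b c i)
    (natDegree_sum_le_of_forall_le _ _ fun i _ =>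
      (natDegree_C_mul_le _ _).trans (natDegree_cv_le b c i))]
  refine Finset.sum_congr rfl fun k _ => ?_
  rcases k with k | k
  · rw [hP, bco_inl_sum_cv]
  · rw [hQ, bco_inr_sum_cv]

variable (S) in
/-- The space with chart coordinates `c` in `R` is an `R`-valued point of the Schubert cell with
index `s`: it has a basis compatible with the flag. -/
def Adapted (s : Option (Fin n)) (c : Fin (N + 1) × Fin (d - N) → R) : Prop :=
  ∃ P : Matrix (Fin (N + 1)) (Fin (N + 1)) R, IsUnit P.det ∧
    ∀ k : Fin (N + 1), S.Low s (S.piv s k) (∑ i, C (P k i) * cv b c i)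

theorem Adapted.map (f : R →ₐ[ℂ] R') {s : Option (Fin n)} {c : Fin (N + 1) × Fin (d - N) → R}
    (h : S.Adapted b s c) : S.Adapted b s fun p => f (c p) := by
  obtain ⟨P, hP, h⟩ := h
  refine ⟨P.map f, ?_, fun k => ?_⟩
  · have : (P.map f).det = f P.det := (f.map_det P).symm
    rw [this]; exact hP.map f
  · have := (h k).map S f
    simpa [Polynomial.map_sum, cv_map] using this

end BasicSituation

namespace BasicSituation

variable {N d n : ℕ} {S : BasicSituation N d n}
variable {R R' : Type*} [CommRing R] [CommRing R'] [Algebra ℂ R] [Algebra ℂ R']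
variable (b : Module.Basis (Fin (N + 1) ⊕ Fin (d - N)) ℂ (polySpace d))

/-! ### The functor of points of a Schubert cell -/

theorem Low.fc_top {s : Option (Fin n)} {q : ℕ} {v : R[X]} (h : S.Low s q v) (hq : q ≤ d) :
    v = ∑ m ∈ Finset.range (q + 1), C (S.fc R s m v) * S.fb R s m := by
  conv_lhs => rw [S.eq_sum_fc_fb s h.1]
  symm
  refine Finset.sum_subset (Finset.range_subset_range.2 (by omega)) fun m hm hm' => ?_
  rw [Finset.mem_range] at hm hm'
  rw [h.2 m (by omega) (by omega)]
  simp

theorem span_sum_cv {c : Fin (N + 1) × Fin (d - N) → ℂ}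
    {P : Matrix (Fin (N + 1)) (Fin (N + 1)) ℂ} (hP : IsUnit P.det) :
    Submodule.span ℂ (Set.range fun k => ∑ i, C (P k i) * cv b c i) = chartPoint b c := by
  rw [chartPoint_eq]
  apply le_antisymm
  · rw [Submodule.span_le]
    rintro _ ⟨k, rfl⟩
    refine Submodule.sum_mem _ fun i _ => ?_
    rw [← smul_eq_C_mul]
    exact Submodule.smul_mem _ _ (Submodule.subset_span ⟨i, rfl⟩)
  · rw [Submodule.span_le]
    rintro _ ⟨i, rfl⟩
    have h : cv b c i = ∑ k, P⁻¹ i k • ∑ i, C (P k i) * cv b c i := by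
      simp only [Finset.smul_sum, smul_eq_C_mul]
      rw [Finset.sum_comm]
      simp only [← mul_assoc, ← C_mul, ← Finset.sum_mul, ← map_sum]
      have := Matrix.nonsing_inv_mul P hP
      simp only [← Matrix.mul_apply, this, Matrix.one_apply]
      simp
    rw [h]
    exact Submodule.sum_mem _ fun k _ => Submodule.smul_mem _ _ (Submodule.subset_span ⟨k, rfl⟩)

variable (S) in
/-- The universal family of polynomials `v_k` satisfying the conditions `Low s (piv s k) v_k`. -/
def univVec (s : Option (Fin n)) (k : Fin (N + 1)) : (MvPolynomial (Fin (N + 1) × ℕ) ℂ)[X] :=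
  ∑ m ∈ Finset.range (S.piv s k + 1), C (MvPolynomial.X (k, m) : MvPolynomial (Fin (N + 1) × ℕ) ℂ) *
    S.fb (MvPolynomial (Fin (N + 1) × ℕ) ℂ) s m

variable (S) in
/-- The coordinates of the universal family with respect to the first part of the basis `b`. -/
def univMat (s : Option (Fin n)) :
    Matrix (Fin (N + 1)) (Fin (N + 1)) (MvPolynomial (Fin (N + 1) × ℕ) ℂ) :=
  Matrix.of fun k i => bco (MvPolynomial (Fin (N + 1) × ℕ) ℂ) b (Sum.inl i) (S.univVec s k)

variable (S) in
/-- The chart coordinates of the span of the universal family, on the open set where this span lies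
in the chart. -/
def univChart (s : Option (Fin n)) (p : Fin (N + 1) × Fin (d - N)) :
    Localization.Away (S.univMat b s).det :=
  (((S.univMat b s).map (algebraMap _ (Localization.Away (S.univMat b s).det)))⁻¹ *
    (Matrix.of fun k j => algebraMap _ (Localization.Away (S.univMat b s).det)
      (bco _ b (Sum.inr j) (S.univVec s k)))) p.1 p.2

/-- The universal property of the universal family: a specialisation whose span lies in the chart
is expressed through the chart coordinates. -/
theorem exists_lift_univChart (s : Option (Fin n))
    (g : MvPolynomial (Fin (N + 1) × ℕ) ℂ →ₐ[ℂ] R) (hg : IsUnit (g (S.univMat b s).det)) :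
    ∃ g' : Localization.Away (S.univMat b s).det →ₐ[ℂ] R, (∀ x, g' (algebraMap _ _ x) = g x) ∧
      IsUnit ((S.univMat b s).map g).det ∧ ∀ k, (S.univVec s k).map (g : _ →+* R) =
        ∑ i, C ((S.univMat b s).map g k i) * cv b (fun p => g' (S.univChart b s p)) i := by
  let U := MvPolynomial (Fin (N + 1) × ℕ) ℂ
  let L := Localization.Away (S.univMat b s).det
  let PL : Matrix (Fin (N + 1)) (Fin (N + 1)) L := (S.univMat b s).map (algebraMap U L)
  let QL : Matrix (Fin (N + 1)) (Fin (d - N)) L :=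
    Matrix.of fun k j => algebraMap U L (bco _ b (Sum.inr j) (S.univVec s k))
  have hPL : IsUnit PL.det := by
    have : PL.det = algebraMap U L (S.univMat b s).det :=
      ((algebraMap U L).map_det (S.univMat b s)).symm
    rw [this]
    exact IsLocalization.Away.algebraMap_isUnit (S.univMat b s).det
  have hcL : ∀ k j, ∑ i, PL k i * S.univChart b s (i, j) =
      algebraMap U L (bco _ b (Sum.inr j) (S.univVec s k)) := by
    intro k j
    have : PL * (PL⁻¹ * QL) = QL := by
      rw [← Matrix.mul_assoc, Matrix.mul_nonsing_inv _ hPL, Matrix.one_mul]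
    have := congrFun (congrFun this k) j
    rwa [Matrix.mul_apply] at this
  let g' : L →ₐ[ℂ] R := IsLocalization.liftAlgHom (M := Submonoid.powers (S.univMat b s).det)
    (f := g) (by
      rintro ⟨_, k, rfl⟩
      rw [map_pow]
      exact hg.pow k)
  have hg' : ∀ x, g' (algebraMap U L x) = g x := fun x => IsLocalization.lift_eq _ x
  refine ⟨g', hg', ?_, fun k => ?_⟩
  · have : ((S.univMat b s).map g).det = g (S.univMat b s).det := (g.map_det _).symm
    rwa [this]
  · refine sum_cv_eq b ?_ (fun i => ?_) fun j => ?_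
    · refine natDegree_map_le.trans (natDegree_sum_le_of_forall_le _ _ fun m hm => ?_)
      refine (natDegree_C_mul_le _ _).trans (S.natDegree_fb_le s ?_)
      have := Finset.mem_range.1 hm
      have := S.piv_le s k
      omega
    · rw [bco_map]; rfl
    · rw [bco_map]
      have := congrArg g' (hcL k j)
      rw [hg', map_sum] at this
      refine this.symm.trans (Finset.sum_congr rfl fun i _ => ?_)
      rw [map_mul]
      congr 1
      exact hg' _

theorem univVec_map (s : Option (Fin n)) (g : MvPolynomial (Fin (N + 1) × ℕ) ℂ →ₐ[ℂ] R)
    (k : Fin (N + 1)) : (S.univVec s k).map (g : _ →+* R) =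
      ∑ m ∈ Finset.range (S.piv s k + 1), C (g (MvPolynomial.X (k, m))) * S.fb R s m := by
  simp only [univVec, Polynomial.map_sum, Polynomial.map_mul, map_C, fb_map]
  rfl

/-- The functions vanishing on the Schubert cell vanish at its `R`-valued points: they vanish on the
universal family of adapted bases, since the generic member of this family spans a point of the
cell. -/
theorem Adapted.aeval_eq_zero {s : Option (Fin n)} {c : Fin (N + 1) × Fin (d - N) → R}
    (h : S.Adapted b s c) {f : MvPolynomial (Fin (N + 1) × Fin (d - N)) ℂ}
    (hf : f ∈ MvPolynomial.vanishingIdeal ℂ {c | chartPoint b c ∈ S.cell s}) :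
    MvPolynomial.aeval c f = 0 := by
  nontriviality R
  obtain ⟨P, hP, hlow⟩ := h
  let U := MvPolynomial (Fin (N + 1) × ℕ) ℂ
  let g : U →ₐ[ℂ] R := MvPolynomial.aeval fun p : Fin (N + 1) × ℕ =>
    S.fc R s p.2 (∑ i, C (P p.1 i) * cv b c i)
  have hvec : ∀ k, (S.univVec s k).map (g : U →+* R) = ∑ i, C (P k i) * cv b c i := by
    intro k
    rw [univVec_map, (hlow k).fc_top (S.piv_le s k)]
    refine Finset.sum_congr rfl fun m _ => ?_
    congr 2
    exact MvPolynomial.aeval_X _ _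
  have hmat : (S.univMat b s).map g = P := by
    ext k i
    rw [Matrix.map_apply, univMat, Matrix.of_apply, ← bco_map, hvec, bco_inl_sum_cv]
  have hgdet : IsUnit (g (S.univMat b s).det) := by
    have : ((S.univMat b s).map g).det = g (S.univMat b s).det := (g.map_det _).symm
    rw [← this, hmat]
    exact hP
  obtain ⟨g', hg', -, hg'c⟩ := exists_lift_univChart b s g hgdet
  have hc : ∀ p, g' (S.univChart b s p) = c p := by
    rintro ⟨i, j⟩
    have h1 : ∀ k, ∑ i, P k i * g' (S.univChart b s (i, j)) = ∑ i, P k i * c (i, j) := by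
      intro k
      have := hg'c k
      rw [hmat, hvec] at this
      have := congrArg (bco R b (Sum.inr j)) this
      rw [bco_inr_sum_cv, bco_inr_sum_cv] at this
      exact this.symm
    have h2 : P.mulVec (fun i => g' (S.univChart b s (i, j))) = P.mulVec (fun i => c (i, j)) :=
      funext h1
    have h3 := congrArg (P⁻¹.mulVec ·) h2
    simp only [Matrix.mulVec_mulVec, Matrix.nonsing_inv_mul P hP, Matrix.one_mulVec] at h3
    exact congrFun h3 i
  -- The universal case: the numerator of the value of `f` vanishes at all complex points at which
  -- the span lies in the chart and the pivots do not vanish.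
  have key : MvPolynomial.aeval (S.univChart b s) f = 0 := by
    obtain ⟨⟨x, y⟩, hxy⟩ := IsLocalization.surj (Submonoid.powers (S.univMat b s).det)
      (MvPolynomial.aeval (S.univChart b s) f)
    have hdet : (S.univMat b s).det ≠ 0 := by
      intro h0
      rw [h0, map_zero] at hgdet
      exact not_isUnit_zero hgdet
    have hx : x * ((S.univMat b s).det * ∏ k : Fin (N + 1), MvPolynomial.X (k, S.piv s k)) = 0 := by
      refine MvPolynomial.funext fun ρ => ?_
      by_cases h1 : MvPolynomial.eval ρ (S.univMat b s).det = 0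
      · simp [h1]
      by_cases h2 : MvPolynomial.eval ρ
          (∏ k : Fin (N + 1), (MvPolynomial.X (k, S.piv s k) : U)) = 0
      · rw [map_mul, map_mul, h2]
        simp
      have h2' : ∀ k : Fin (N + 1), ρ (k, S.piv s k) ≠ 0 := by
        rw [map_prod, ← ne_eq, Finset.prod_ne_zero_iff] at h2
        intro k
        simpa using h2 k (Finset.mem_univ k)
      obtain ⟨e', he', heu, hec⟩ := exists_lift_univChart b s (MvPolynomial.aeval ρ)
        (by rw [MvPolynomial.aeval_eq_eval]; exact isUnit_iff_ne_zero.2 h1)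
      have hmem : (fun p => e' (S.univChart b s p)) ∈ {c | chartPoint b c ∈ S.cell s} := by
        rw [Set.mem_ofPred_eq, ← span_sum_cv b heu, mem_cell_iff]
        refine ⟨_, fun k => ?_, rfl⟩
        rw [← hec, univVec_map]
        have hfc : ∀ m, m ≤ d → S.fc ℂ s m (∑ m ∈ Finset.range (S.piv s k + 1),
            C (MvPolynomial.aeval ρ (MvPolynomial.X (k, m) : U)) * S.fb ℂ s m) =
            if m < S.piv s k + 1 then ρ (k, m) else 0 := by
          intro m hm
          simp only [map_sum, ← smul_eq_C_mul, map_smul, smul_eq_mul, MvPolynomial.aeval_X]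
          have : ∀ m' ∈ Finset.range (S.piv s k + 1), ρ (k, m') * S.fc ℂ s m (S.fb ℂ s m') =
              if m = m' then ρ (k, m') else 0 := by
            intro m' hm'
            have := Finset.mem_range.1 hm'
            have := S.piv_le s k
            rw [S.fc_fb s hm (by omega)]
            split_ifs <;> simp
          rw [Finset.sum_congr rfl this, Finset.sum_ite_eq]
          simp
        refine ⟨⟨natDegree_sum_le_of_forall_le _ _ fun m hm => (natDegree_C_mul_le _ _).trans
          (S.natDegree_fb_le s ?_), fun m hm hmd => ?_⟩, ?_⟩
        · have := Finset.mem_range.1 hm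
          have := S.piv_le s k
          omega
        · rw [hfc m hmd, if_neg (by omega)]
        · rw [hfc _ (S.piv_le s k), if_pos (by omega)]
          exact h2' k
      have h3 := (MvPolynomial.mem_vanishingIdeal_iff.1 hf) _ hmem
      have h4 := congrArg e' hxy
      rw [map_mul, he', he', MvPolynomial.aeval_eq_eval] at h4
      have h5 : e' (MvPolynomial.aeval (S.univChart b s) f) = 0 := by
        rw [← h3, ← MvPolynomial.comp_aeval_apply]
      rw [h5, zero_mul] at h4
      rw [map_mul, ← h4]
      simp
    have hx0 : x = 0 := by
      refine (mul_eq_zero.1 hx).resolve_right (mul_ne_zero hdet ?_)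
      exact Finset.prod_ne_zero_iff.2 fun k _ => MvPolynomial.X_ne_zero _
    rw [hx0, map_zero] at hxy
    exact (IsUnit.mul_left_eq_zero (IsLocalization.map_units _ y)).1 hxy
  have : c = fun p => g' (S.univChart b s p) := funext fun p => (hc p).symm
  rw [this, ← MvPolynomial.comp_aeval_apply, key, map_zero]

/-- The combinations `∑ A_{ki} (e_i + ∑_j c_{ij} f_j)` with constant coefficients. -/
def constRow (A : Fin (N + 1) → Fin (N + 1) → ℂ) (c : Fin (N + 1) × Fin (d - N) → R)
    (k : Fin (N + 1)) : R[X] :=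
  ∑ i, C (algebraMap ℂ R (A k i)) * cv b c i

variable (S) in
/-- The matrix of the coordinates of `constRow` at the pivots. -/
def pivMat (s : Option (Fin n)) (A : Fin (N + 1) → Fin (N + 1) → ℂ)
    (c : Fin (N + 1) × Fin (d - N) → R) : Matrix (Fin (N + 1)) (Fin (N + 1)) R :=
  Matrix.of fun k k' => S.fc R s (S.piv s k') (constRow b A c k)

variable (S) in
/-- The result of the elimination of the pivots of `constRow`, without denominators. -/
def pivVec (s : Option (Fin n)) (A : Fin (N + 1) → Fin (N + 1) → ℂ)
    (c : Fin (N + 1) × Fin (d - N) → R) (k : Fin (N + 1)) : R[X] :=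
  ∑ k', C ((S.pivMat b s A c).adjugate k k') * constRow b A c k'

theorem constRow_map (f : R →ₐ[ℂ] R') (A : Fin (N + 1) → Fin (N + 1) → ℂ)
    (c : Fin (N + 1) × Fin (d - N) → R) (k : Fin (N + 1)) :
    (constRow b A c k).map (f : R →+* R') = constRow b A (fun p => f (c p)) k := by
  simp only [constRow, Polynomial.map_sum, Polynomial.map_mul, cv_map, map_C]
  refine Finset.sum_congr rfl fun i _ => ?_
  congr 2
  exact f.commutes _

theorem pivMat_map (f : R →ₐ[ℂ] R') (s : Option (Fin n)) (A : Fin (N + 1) → Fin (N + 1) → ℂ)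
    (c : Fin (N + 1) × Fin (d - N) → R) :
    (S.pivMat b s A c).map f = S.pivMat b s A fun p => f (c p) := by
  ext k k'
  simp only [pivMat, Matrix.map_apply, Matrix.of_apply, ← fc_map, constRow_map]

theorem pivVec_map (f : R →ₐ[ℂ] R') (s : Option (Fin n)) (A : Fin (N + 1) → Fin (N + 1) → ℂ)
    (c : Fin (N + 1) × Fin (d - N) → R) (k : Fin (N + 1)) :
    (S.pivVec b s A c k).map (f : R →+* R') = S.pivVec b s A (fun p => f (c p)) k := by
  simp only [pivVec, Polynomial.map_sum, Polynomial.map_mul, constRow_map, map_C]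
  refine Finset.sum_congr rfl fun i _ => ?_
  rw [← pivMat_map]
  congr 2
  exact congrFun (congrFun (f.map_adjugate (S.pivMat b s A c)) k) i

theorem fc_piv_pivVec (s : Option (Fin n)) (A : Fin (N + 1) → Fin (N + 1) → ℂ)
    (c : Fin (N + 1) × Fin (d - N) → R) (k j : Fin (N + 1)) :
    S.fc R s (S.piv s j) (S.pivVec b s A c k) = if k = j then (S.pivMat b s A c).det else 0 := by
  have := congrFun (congrFun (Matrix.adjugate_mul (S.pivMat b s A c)) k) j
  simp only [Matrix.mul_apply, Matrix.smul_apply, Matrix.one_apply] at this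
  simp only [pivVec, map_sum, ← smul_eq_C_mul, map_smul, smul_eq_mul]
  refine Eq.trans this ?_
  split_ifs <;> simp

/-- The eliminated vectors as combinations of the vectors `e_i + ∑_j c_{ij} f_j`. -/
theorem pivVec_eq (s : Option (Fin n)) (A : Fin (N + 1) → Fin (N + 1) → ℂ)
    (c : Fin (N + 1) × Fin (d - N) → R) (k : Fin (N + 1)) :
    S.pivVec b s A c k = ∑ i, C (((S.pivMat b s A c).adjugate *
      Matrix.of fun k i => algebraMap ℂ R (A k i)) k i) * cv b c i := by
  simp only [pivVec, constRow, Finset.mul_sum, Matrix.mul_apply, map_sum, Finset.sum_mul]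
  rw [Finset.sum_comm]
  refine Finset.sum_congr rfl fun i _ => Finset.sum_congr rfl fun k' _ => ?_
  rw [C_mul, mul_assoc]
  rfl

theorem aeval_det_pivMat (s : Option (Fin n)) (A : Fin (N + 1) → Fin (N + 1) → ℂ)
    (c : Fin (N + 1) × Fin (d - N) → R) :
    MvPolynomial.aeval c (S.pivMat b s A
      (MvPolynomial.X : _ → MvPolynomial (Fin (N + 1) × Fin (d - N)) ℂ)).det =
      (S.pivMat b s A c).det := by
  have h1 := (MvPolynomial.aeval (R := ℂ) c).map_det (S.pivMat b s A
    (MvPolynomial.X : _ → MvPolynomial (Fin (N + 1) × Fin (d - N)) ℂ))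
  refine h1.trans ?_
  have h2 := pivMat_map b (S := S) (MvPolynomial.aeval (R := ℂ) c) s A
    (MvPolynomial.X : _ → MvPolynomial (Fin (N + 1) × Fin (d - N)) ℂ)
  simp only [MvPolynomial.aeval_X] at h2
  exact congrArg Matrix.det h2

theorem aeval_fc_pivVec (s : Option (Fin n)) (A : Fin (N + 1) → Fin (N + 1) → ℂ)
    (c : Fin (N + 1) × Fin (d - N) → R) (m : ℕ) (k : Fin (N + 1)) :
    MvPolynomial.aeval c (S.fc _ s m (S.pivVec b s A
      (MvPolynomial.X : _ → MvPolynomial (Fin (N + 1) × Fin (d - N)) ℂ) k)) =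
      S.fc R s m (S.pivVec b s A c k) := by
  rw [← fc_map, pivVec_map]
  simp only [MvPolynomial.aeval_X]

/-- Conversely, over a local ring a point at which the functions vanishing on the Schubert cell
vanish is a point of the cell, provided that it specialises to a point of the cell: the entries
below the pivots after Gaussian elimination are functions which vanish on the cell. -/
theorem exists_reduced_of_aeval_eq_zero (π : R →ₐ[ℂ] ℂ) (hπ : ∀ a, π a ≠ 0 → IsUnit a)
    {s : Option (Fin n)} {c : Fin (N + 1) × Fin (d - N) → R} (hc : ∀ p, π (c p) = 0)
    (h0 : chartPoint b 0 ∈ S.cell s)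
    (hf : ∀ f ∈ MvPolynomial.vanishingIdeal ℂ {c | chartPoint b c ∈ S.cell s},
      MvPolynomial.aeval c f = 0) :
    ∃ P : Matrix (Fin (N + 1)) (Fin (N + 1)) R, IsUnit P.det ∧
      ∀ k : Fin (N + 1), S.Low s (S.piv s k) (∑ i, C (P k i) * cv b c i) ∧
        ∀ j : Fin (N + 1), S.fc R s (S.piv s j) (∑ i, C (P k i) * cv b c i) =
          if k = j then 1 else 0 := by
  obtain ⟨v, hv, hspan⟩ := (mem_cell_iff _ _).1 h0
  have hA : ∀ k, ∃ A : Fin (N + 1) → ℂ, ∑ i, C (A i) * cv b 0 i = v k := by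
    intro k
    have : v k ∈ Submodule.span ℂ (Set.range (cv b (0 : Fin (N + 1) × Fin (d - N) → ℂ))) := by
      rw [← chartPoint_eq, ← hspan]
      exact Submodule.subset_span ⟨k, rfl⟩
    obtain ⟨A, hA⟩ := (Submodule.mem_span_range_iff_exists_fun ℂ).1 this
    exact ⟨A, by simpa only [smul_eq_C_mul] using hA⟩
  choose A hA using hA
  have hrow0 : ∀ k, constRow b A (0 : Fin (N + 1) × Fin (d - N) → ℂ) k = v k := hA
  have hdet0 : (S.pivMat b s A (0 : Fin (N + 1) × Fin (d - N) → ℂ)).det ≠ 0 := by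
    rw [Matrix.det_of_isUpperTriangular]
    · refine Finset.prod_ne_zero_iff.2 fun k _ => ?_
      simp only [pivMat, Matrix.of_apply, hrow0]
      exact (hv k).2
    · intro k k' hkk'
      simp only [pivMat, Matrix.of_apply, hrow0]
      exact (hv k).1.2 _ (S.piv_lt s hkk' (Nat.lt_succ_iff.1 k.2)) (S.piv_le _ _)
  have hAdet : IsUnit (Matrix.of fun k i => algebraMap ℂ R (A k i)).det := by
    have h1 : S.pivMat b s A (0 : Fin (N + 1) × Fin (d - N) → ℂ) = Matrix.of A *
        Matrix.of fun i k' : Fin (N + 1) => S.fc ℂ s (S.piv s k') (cv b 0 i) := by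
      ext k k'
      simp only [pivMat, constRow, Matrix.mul_apply, Matrix.of_apply, map_sum, ← smul_eq_C_mul,
        map_smul, smul_eq_mul]
      rfl
    rw [h1, Matrix.det_mul] at hdet0
    have h2 : (Matrix.of fun k i => algebraMap ℂ R (A k i)).det =
        algebraMap ℂ R (Matrix.of A).det := ((algebraMap ℂ R).map_det (Matrix.of A)).symm
    rw [h2]
    exact (isUnit_iff_ne_zero.2 (left_ne_zero_of_mul hdet0)).map _
  have hdet : IsUnit (S.pivMat b s A c).det := by
    refine hπ _ ?_
    have h1 : π (S.pivMat b s A c).det = ((S.pivMat b s A c).map π).det := π.map_det _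
    rw [h1, pivMat_map]
    simp only [hc]
    exact hdet0
  obtain ⟨δ, hδ⟩ := hdet
  refine ⟨(↑δ⁻¹ : R) • ((S.pivMat b s A c).adjugate *
    Matrix.of fun k i => algebraMap ℂ R (A k i)), ?_, fun k => ?_⟩
  · rw [Matrix.det_smul, Matrix.det_mul, Matrix.det_adjugate, ← hδ]
    exact ((Units.isUnit _).pow _).mul (((Units.isUnit _).pow _).mul hAdet)
  have hsum : ∑ i, C (((↑δ⁻¹ : R) • ((S.pivMat b s A c).adjugate *
      Matrix.of fun k i => algebraMap ℂ R (A k i))) k i) * cv b c i =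
      C (↑δ⁻¹ : R) * S.pivVec b s A c k := by
    rw [pivVec_eq, Finset.mul_sum]
    refine Finset.sum_congr rfl fun i _ => ?_
    rw [Matrix.smul_apply, smul_eq_mul, C_mul, mul_assoc]
  rw [hsum]
  refine ⟨?_, fun j => ?_⟩
  swap
  · rw [← smul_eq_C_mul, map_smul, fc_piv_pivVec, smul_eq_mul, ← hδ]
    split_ifs <;> simp
  have hlow : S.Low s (S.piv s k) (S.pivVec b s A c k) := by
    refine ⟨?_, fun m hm hmd => ?_⟩
    · rw [pivVec_eq]
      exact natDegree_sum_le_of_forall_le _ _ fun i _ =>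
        (natDegree_C_mul_le _ _).trans (natDegree_cv_le b c i)
    have hmem : S.fc _ s m (S.pivVec b s A MvPolynomial.X k) *
        (S.pivMat b s A MvPolynomial.X).det ∈
        MvPolynomial.vanishingIdeal ℂ {c | chartPoint b c ∈ S.cell s} := by
      rw [MvPolynomial.mem_vanishingIdeal_iff]
      intro x hx
      rw [map_mul, aeval_det_pivMat, aeval_fc_pivVec]
      by_cases hx0 : (S.pivMat b s A x).det = 0
      · rw [hx0, mul_zero]
      obtain ⟨v', hv', hspan'⟩ := (mem_cell_iff _ _).1 hx
      have hin : S.pivVec b s A x k ∈ Submodule.span ℂ (Set.range v') := by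
        rw [hspan', chartPoint_eq, pivVec_eq]
        refine Submodule.sum_mem _ fun i _ => ?_
        rw [← smul_eq_C_mul]
        exact Submodule.smul_mem _ _ (Submodule.subset_span ⟨i, rfl⟩)
      obtain ⟨e, he⟩ := (Submodule.mem_span_range_iff_exists_fun ℂ).1 hin
      have hz := hv'.coeff_eq_zero e k fun j hj => by
        rw [he, fc_piv_pivVec, if_neg (fun h => by rw [h] at hj; exact lt_irrefl _ hj)]
      rw [← he, map_sum, Finset.sum_eq_zero, zero_mul]
      intro j _
      rw [map_smul]
      by_cases hj : (j : ℕ) < k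
      · rw [hz j hj, zero_smul]
      · rw [(hv' j).1.2 m ?_ hmd, smul_zero]
        rcases (not_lt.1 hj).lt_or_eq with h | h
        · exact (S.piv_lt s h (Nat.lt_succ_iff.1 j.2)).trans hm
        · rwa [← h]
    have h3 := hf _ hmem
    rw [map_mul, aeval_det_pivMat, aeval_fc_pivVec] at h3
    exact (hδ ▸ δ.isUnit : IsUnit (S.pivMat b s A c).det).mul_left_eq_zero.1 h3
  exact ⟨(natDegree_C_mul_le _ _).trans hlow.1, fun m hm hmd => by
    rw [← smul_eq_C_mul, map_smul, hlow.2 m hm hmd, smul_zero]⟩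

end BasicSituation

namespace BasicSituation

variable {N d n : ℕ} {S : BasicSituation N d n}

section

variable {R R' : Type*} [CommRing R] [CommRing R']

/-! ### The polynomials `y_i` with given roots -/

variable (S) in
/-- The polynomial `y_i = ∏_j (x - t^{(i)}_j)`; it is `1` unless `1 ≤ i ≤ N`. -/
def polyAt (t : S.Var → R) (i : ℕ) : R[X] := ∏ v : S.Var with (v.1 : ℕ) + 1 = i, (X - C (t v))

theorem polyAt_map (f : R →+* R') (t : S.Var → R) (i : ℕ) :
    (S.polyAt t i).map f = S.polyAt (fun v => f (t v)) i := by
  simp [polyAt, Polynomial.map_prod]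

theorem polyAt_monic (t : S.Var → R) (i : ℕ) : (S.polyAt t i).Monic :=
  monic_prod_of_monic _ _ fun _ _ => monic_X_sub_C _

theorem polyAt_zero (t : S.Var → R) : S.polyAt t 0 = 1 := by
  rw [polyAt, Finset.filter_false_of_mem (by intros; omega), Finset.prod_empty]

theorem polyAt_last (t : S.Var → R) : S.polyAt t (N + 1) = 1 := by
  rw [polyAt, Finset.filter_false_of_mem (by intro v _; have := v.1.2; omega), Finset.prod_empty]

theorem polyAt_eq_prod (t : S.Var → R) (i : Fin N) :
    S.polyAt t (i + 1) = ∏ j : Fin (S.l (i + 1)), (X - C (t ⟨i, j⟩)) := by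
  symm
  refine Finset.prod_bij (fun j _ => ⟨i, j⟩) (fun j _ => by simp) (fun j _ j' _ h => by simpa using h)
    (fun v hv => ?_) fun j _ => rfl
  obtain ⟨i', j⟩ := v
  have : i' = i := Fin.ext (by simpa using hv)
  subst this
  exact ⟨j, Finset.mem_univ _, rfl⟩

theorem Gam_eq (t : S.Var → ℂ) (i : Fin N) : S.Gam t i = S.polyAt t (i + 1) :=
  (polyAt_eq_prod t i).symm

theorem natDegree_polyAt [Nontrivial R] (t : S.Var → R) {i : ℕ} (h1 : 1 ≤ i) (hi : i ≤ N) :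
    (S.polyAt t i).natDegree = S.l i := by
  obtain ⟨i, rfl⟩ : ∃ j, i = j + 1 := ⟨i - 1, by omega⟩
  rw [polyAt_eq_prod t ⟨i, hi⟩, natDegree_prod_of_monic _ _ fun _ _ => monic_X_sub_C _]
  simp

end

variable {R : Type*} [CommRing R] [Algebra ℂ R]

/-! ### The bases of `V` adapted to the flags -/

theorem wr_associated_of_span_eq {k : ℕ} {u w : Fin k → ℂ[X]} (hw : LinearIndependent ℂ w)
    (h : ∀ i, w i ∈ Submodule.span ℂ (Set.range u)) : Associated (wr u) (wr w) := by
  have hA : ∀ i, ∃ A : Fin k → ℂ, ∑ j, C (A j) * u j = w i := by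
    intro i
    obtain ⟨A, hA⟩ := (Submodule.mem_span_range_iff_exists_fun ℂ).1 (h i)
    exact ⟨A, by simpa only [smul_eq_C_mul] using hA⟩
  choose A hA using hA
  have hdet : (Matrix.of A).det ≠ 0 := by
    intro h0
    obtain ⟨x, hx, hx0⟩ := Matrix.exists_vecMul_eq_zero_iff.2 h0
    refine hx (funext fun i => Fintype.linearIndependent_iff.1 hw x ?_ i)
    simp only [← hA, smul_eq_C_mul, Finset.mul_sum, ← mul_assoc, ← C_mul]
    rw [Finset.sum_comm]
    simp only [← Finset.sum_mul, ← map_sum]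
    refine Finset.sum_eq_zero fun j _ => ?_
    have := congrFun hx0 j
    simp only [Matrix.vecMul, dotProduct, Matrix.of_apply, Pi.zero_apply] at this
    rw [this, C_0, zero_mul]
  have h1 : wr w = C (Matrix.of A).det * wr u := by
    rw [← wr_linearCombination]
    congr 1
    exact funext fun i => (hA i).symm
  rw [h1]
  exact (associated_unit_mul_left _ _ ((isUnit_iff_ne_zero.2 hdet).map C)).symm

/-- A filtration in the open Schubert cell with respect to the filtration induced by a flag is
spanned by the initial segments of an echelon family for this flag: the vectors which are provided
by the cell are triangular combinations of an echelon basis of `V`. -/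
theorem InFlo.exists_exact {V : Submodule ℂ ℂ[X]} {E : ℕ → Submodule ℂ ℂ[X]}
    (h : S.InFlo V E) (s : Option (Fin n)) : ∃ u : ℕ → ℂ[X],
      S.Exact s (fun k : Fin (N + 1) => u k) ∧
        ∀ i ≤ N + 1, E i = Submodule.span ℂ (Set.range fun j : Fin i => u j) := by
  obtain ⟨hcell, hflag, hfc, -⟩ := h
  obtain ⟨v, hv, hspan⟩ := (mem_cell_iff s V).1 (hcell s)
  obtain ⟨u, hlin, hE, hu⟩ := hfc s
  refine ⟨fun k => if hk : k < N + 1 then u ⟨k, hk⟩ else 0, fun k => ?_, fun i hi => ?_⟩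
  · simp only [k.2, dif_pos, Fin.eta]
    have hlow : ∀ k : Fin (N + 1), S.Low s (S.piv s k) (u k) := by
      intro k
      have h1 := (hu k).2
      rw [SetLike.mem_coe, mem_flag_iff] at h1
      refine ⟨h1.1, fun m hm => h1.2 m ?_⟩
      have h2 : (Fin.revPerm k : ℕ) + 1 = N + 1 - k := by
        rw [Fin.revPerm_apply, Fin.val_rev]; omega
      have := S.piv_add_ex s (Nat.lt_succ_iff.1 k.2)
      have := S.le
      have := S.a_le s (N + 1 - k)
      unfold ex at *
      rw [h2]
      have := k.2
      omega
    have hA : ∀ k, ∃ A : Fin (N + 1) → ℂ, ∑ i, A i • v i = u k := by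
      intro k
      refine (Submodule.mem_span_range_iff_exists_fun ℂ).1 ?_
      rw [hspan]
      exact (hu k).1
    choose A hA using hA
    have hzero : ∀ k j : Fin (N + 1), j < k → A k j = 0 := by
      intro k j hjk
      refine hv.coeff_eq_zero (A k) k (fun j hj => ?_) j hjk
      rw [hA]
      exact (hlow k).2 _ (S.piv_lt s hj (Nat.lt_succ_iff.1 k.2)) (S.piv_le _ _)
    -- The triangular matrix `A` is invertible, so that its diagonal entries do not vanish.
    have hdet : (Matrix.of A).det ≠ 0 := by
      intro h0
      obtain ⟨x, hx, hx0⟩ := Matrix.exists_vecMul_eq_zero_iff.2 h0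
      refine hx (funext fun i => Fintype.linearIndependent_iff.1 hlin x ?_ i)
      simp only [← hA, Finset.smul_sum, smul_smul]
      rw [Finset.sum_comm]
      simp only [← Finset.sum_smul]
      refine Finset.sum_eq_zero fun j _ => ?_
      have := congrFun hx0 j
      simp only [Matrix.vecMul, dotProduct, Matrix.of_apply, Pi.zero_apply] at this
      rw [this, zero_smul]
    rw [Matrix.det_of_isUpperTriangular (M := Matrix.of A) fun k j hjk => hzero k j hjk] at hdet
    refine ⟨hlow k, ?_⟩
    rw [← hA, map_sum, Finset.sum_eq_single k, map_smul]
    · exact mul_ne_zero (Finset.prod_ne_zero_iff.1 hdet k (Finset.mem_univ k)) (hv k).2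
    · intro j _ hj
      rw [map_smul]
      rcases lt_or_gt_of_ne hj with hlt | hlt
      · rw [hzero k j hlt, zero_smul]
      · rw [(hv j).1.2 _ (S.piv_lt s hlt (Nat.lt_succ_iff.1 j.2)) (S.piv_le _ _), smul_zero]
    · simp
  · rcases i with _ | i
    · obtain ⟨hf, hr⟩ := hflag.2.2 0 hi
      rw [Submodule.finrank_eq_zero.1 hr]
      simp [Set.range_eq_empty]
    · rw [hE ⟨i, by omega⟩]
      congr 1
      ext p
      simp only [Set.mem_image, Set.mem_ofPred_eq, Set.mem_range]
      constructor
      · rintro ⟨k, hk, rfl⟩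
        refine ⟨⟨k, Nat.lt_succ_of_le hk⟩, ?_⟩
        rw [dif_pos k.2]
      · rintro ⟨k, rfl⟩
        refine ⟨⟨k, by omega⟩, Nat.lt_succ_iff.1 k.2, ?_⟩
        rw [dif_pos]

/-- Over any ring, the Wronskians of elements of a space which satisfies the Schubert conditions at
`z_1, …, z_n` are divisible by `K_i`. -/
theorem K_map_dvd_wr (v : Fin n → Fin (N + 1) → R[X])
    (hv : ∀ s (j : Fin (N + 1)), S.Low (some s) (S.piv (some s) j) (v s j)) {i : ℕ}
    (hi : i ≤ N + 1) (w : Fin i → R[X])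
    (hw : ∀ s j, w j ∈ Submodule.span R (Set.range (v s))) :
    (S.K i).map (algebraMap ℂ R) ∣ wr w := by
  rw [S.K_eq i hi, Polynomial.map_prod]
  refine Finset.prod_dvd_of_coprime (fun s _ s' _ hss' => ?_) fun s _ => ?_
  · simp only [Function.onFun, Polynomial.map_pow, Polynomial.map_sub, map_X, map_C]
    refine IsCoprime.pow (isCoprime_X_sub_C_of_isUnit_sub ?_)
    rw [← map_sub]
    exact (isUnit_iff_ne_zero.2 (sub_ne_zero.2 fun h => hss' (S.z_injective h))).map _
  · simp only [Polynomial.map_pow, Polynomial.map_sub, map_X, map_C]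
    exact S.X_sub_C_pow_dvd_wr (v s) (hv s) w (hw s)

/-- The order of the Wronskian of an echelon family at `z_s` is exactly the one prescribed by
`K_i`, so that `y_i` does not vanish at `z_s`. -/
theorem Exact.not_dvd_wrs {s : Fin n} {u : ℕ → ℂ[X]}
    (hu : S.Exact (some s) fun k : Fin (N + 1) => u k) {i : ℕ} (hi : i ≤ N + 1) :
    ¬ (X - C (S.z s)) ^ (S.sa (some s) i + 1) ∣ wrs u i := by
  rw [X_sub_C_pow_dvd_iff_taylor, wrs, ← taylor_wr]
  intro hdvd
  obtain ⟨H, hH, hH0⟩ := exists_X_pow_mul_wr_eq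
    (fun j : Fin i => taylor (S.z s) (u j)) (fun j => S.ex (some s) j) fun j =>
      S.X_pow_dvd_taylor_of_low (R := ℂ) (by omega) (hu ⟨j, by omega⟩).1
  rw [Fin.sum_univ_eq_sum_range (fun j => S.ex (some s) j), sum_ex, pow_add, mul_assoc,
    Fin.sum_univ_eq_sum_range (fun j => j)] at hH
  rw [(isRegular_X_pow _).left hH, pow_succ] at hdvd
  have h1 : X ∣ H := by
    obtain ⟨g, hg⟩ := hdvd
    exact ⟨g, (isRegular_X_pow _).left (by simpa only [mul_assoc] using hg)⟩
  rw [X_dvd_iff, hH0] at h1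
  refine mul_ne_zero (isUnit_fallingDet _ fun j j' h =>
    Fin.ext ((S.ex_strictMono _).injective h)).ne_zero (Finset.prod_ne_zero_iff.2 fun j _ => ?_) h1
  have := (hu ⟨j, by omega⟩).2
  rwa [S.fc_piv_some s (by simp only; omega)] at this

/-- The degree of the Wronskian of an echelon family for the flag at infinity is exactly `wdeg`. -/
theorem Exact.natDegree_wrs {u : ℕ → ℂ[X]} (hu : S.Exact none fun k : Fin (N + 1) => u k) {i : ℕ}
    (hi : i ≤ N + 1) : wrs u i ≠ 0 ∧ ((wrs u i).natDegree : ℤ) = S.wdeg i := by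
  obtain ⟨h1, h2⟩ := natDegree_X_pow_mul_wr_le_and_coeff (fun j : Fin i => u j)
    (fun j => S.piv none j) fun j =>
      (S.low_iff_natDegree (S.piv_le _ _) _).1 (hu ⟨j, by omega⟩).1
  have h3 : (X ^ (∑ j : Fin i, (j : ℕ)) * wrs u i).coeff (∑ j : Fin i, S.piv none j) ≠ 0 := by
    rw [wrs, h2]
    refine mul_ne_zero (isUnit_fallingDet _ fun j j' h =>
      Fin.ext (S.piv_injective none (by omega) (by omega) h)).ne_zero
      (Finset.prod_ne_zero_iff.2 fun j _ => (hu ⟨j, by omega⟩).2)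
  have h0 : wrs u i ≠ 0 := by
    intro h0
    rw [h0] at h3
    simp at h3
  refine ⟨h0, ?_⟩
  have h4 : (X ^ (∑ j : Fin i, (j : ℕ)) * wrs u i).natDegree = ∑ j : Fin i, S.piv none j :=
    le_antisymm h1 (le_natDegree_of_ne_zero h3)
  rw [natDegree_mul (pow_ne_zero _ X_ne_zero) h0, natDegree_X_pow,
    Fin.sum_univ_eq_sum_range (fun j => j), Fin.sum_univ_eq_sum_range (fun j => S.piv none j)] at h4
  have h5 := S.sum_piv none i hi
  rw [← h4] at h5
  push_cast at h5
  unfold wdeg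
  linarith

/-- The data of a point `(V, E)` of `Fl°` and of the roots `t` of its Wronskians, expressed through
bases `u` of `V` compatible with `E`, one for each of the flags. -/
structure Bases (S : BasicSituation N d n) (V : Submodule ℂ ℂ[X]) (t : S.Var → ℂ)
    (u : Option (Fin n) → ℕ → ℂ[X]) : Prop where
  exact : ∀ s, S.Exact s fun k : Fin (N + 1) => u s k
  span_last : ∀ s, Submodule.span ℂ (Set.range fun j : Fin (N + 1) => u s j) = V
  wrs_associated : ∀ s, ∀ i ≤ N + 1, Associated (wrs (u s) i) (S.K i * S.polyAt t i)
  not_isRoot : ∀ i, 1 ≤ i → i + 1 ≤ N → ∀ x, (∀ s, x ≠ S.z s) →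
    ¬ ((S.polyAt t i).IsRoot x ∧ (S.polyAt t (i + 1)).IsRoot x)

theorem Exact.linearIndependent_lt {s : Option (Fin n)} {u : ℕ → ℂ[X]}
    (hu : S.Exact s fun k : Fin (N + 1) => u k) {i : ℕ} (hi : i ≤ N + 1) :
    LinearIndependent ℂ fun j : Fin i => u j :=
  hu.linearIndependent.comp (Fin.castLE hi) (Fin.castLE_injective hi)

theorem associated_of_isWronskianOf {E : Submodule ℂ ℂ[X]} {i : ℕ} {u : Fin i → ℂ[X]}
    (hE : E = Submodule.span ℂ (Set.range u)) (hr : Module.finrank ℂ E = i) {p : ℂ[X]}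
    (h : IsWronskianOf E p) : Associated (wr u) p := by
  obtain ⟨k, w, hw⟩ := h
  rw [Module.finrank_eq_card_basis w, Fintype.card_fin] at hr
  subst hr
  refine Associated.trans (wr_associated_of_span_eq (w := fun j => (w j : ℂ[X])) ?_ fun j => ?_)
    hw.symm
  · exact w.linearIndependent.map' E.subtype (Submodule.ker_subtype _)
  · rw [← hE]
    exact (w j).2

theorem InFlo.wrs_associated {V : Submodule ℂ ℂ[X]} {E : ℕ → Submodule ℂ ℂ[X]}
    (h : S.InFlo V E) {t : S.Var → ℂ} (ht : S.GamEqTheta t E)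
    {u : ℕ → ℂ[X]} (hE : ∀ i ≤ N + 1, E i = Submodule.span ℂ (Set.range fun j : Fin i => u j))
    {i : ℕ} (hi : i ≤ N) : Associated (wrs u i) (S.K i * S.polyAt t i) := by
  rcases i with _ | i
  · rw [polyAt_zero, K_zero, wrs_zero, mul_one]
  have h1 := associated_of_isWronskianOf (hE (i + 1) (by omega))
    (h.2.1.2.2 (i + 1) (by omega)).2 (ht ⟨i, hi⟩)
  rwa [Gam_eq] at h1

/-- A point of `Fl°` provides the data of `Bases`; the Wronskian of `V` itself is `K_{N+1}` up to a
constant, by a comparison of degrees. -/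
theorem InFlo.exists_bases {V : Submodule ℂ ℂ[X]} {E : ℕ → Submodule ℂ ℂ[X]}
    (h : S.InFlo V E) {t : S.Var → ℂ} (ht : S.GamEqTheta t E) : ∃ u, S.Bases V t u := by
  choose u hu hE using h.exists_exact
  refine ⟨u, ⟨hu, fun s => ?_, fun s i hi => ?_, fun i h1 hi x hx => ?_⟩⟩
  · rw [← hE s _ le_rfl, h.2.1.1]
  · rcases hi.lt_or_eq with hlt | rfl
    · exact h.wrs_associated ht (hE s) (by omega)
    -- The Wronskian of `V` has degree `deg K_{N+1}` and is divisible by `K_{N+1}`.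
    have hspan : ∀ s s', ∀ j : Fin (N + 1), u s j ∈
        Submodule.span ℂ (Set.range fun j : Fin (N + 1) => u s' j) := by
      intro s s' j
      rw [← hE s' _ le_rfl, hE s _ le_rfl]
      exact Submodule.subset_span ⟨j, rfl⟩
    have h1 : Associated (wrs (u none) (N + 1)) (S.K (N + 1) * S.polyAt t (N + 1)) := by
      obtain ⟨hne, hdeg⟩ := (hu none).natDegree_wrs le_rfl
      have hdvd : S.K (N + 1) ∣ wrs (u none) (N + 1) := by
        have := K_map_dvd_wr (S := S) (fun s k => u (some s) k) (fun s j => (hu (some s) j).1)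
          le_rfl (fun j : Fin (N + 1) => u none j) fun s j => hspan _ _ _
        simpa [wrs] using this
      rw [wdeg_last] at hdeg
      rw [polyAt_last, mul_one]
      obtain ⟨g, hg⟩ := hdvd
      have hg0 : g ≠ 0 := fun h0 => hne (by rw [hg, h0, mul_zero])
      rw [hg, natDegree_mul (S.K_monic _).ne_zero hg0] at hdeg
      have : IsUnit g := isUnit_iff_degree_eq_zero.2 (by
        rw [degree_eq_natDegree hg0]
        exact_mod_cast (by omega : g.natDegree = 0))
      rw [hg]
      exact associated_mul_unit_left _ _ this
    exact (wr_associated_of_span_eq ((hu none).linearIndependent_lt le_rfl)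
      (hspan none s)).trans h1
  · have h2 := h.2.2.2 i h1 hi
    have hr : ∀ i, 1 ≤ i → i ≤ N → IsWronskianOf (E i) (S.K i * S.polyAt t i) := by
      intro i h1 hi
      have := ht ⟨i - 1, by omega⟩
      rw [Gam_eq] at this
      simpa [show i - 1 + 1 = i by omega] using this
    have := h2 _ _ (hr i h1 (by omega)) (hr (i + 1) (by omega) hi) x hx
    rintro ⟨h3, h4⟩
    exact this ⟨root_mul_left_of_isRoot _ h3, root_mul_left_of_isRoot _ h4⟩

variable {V : Submodule ℂ ℂ[X]} {t : S.Var → ℂ} {u : Option (Fin n) → ℕ → ℂ[X]}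

theorem Bases.wdeg_eq (h : S.Bases V t u) {i : ℕ} (hi : i ≤ N + 1) :
    S.wdeg i = S.l i + (S.K i).natDegree := by
  obtain ⟨hne, hdeg⟩ := (h.exact none).natDegree_wrs hi
  have h1 := natDegree_eq_of_degree_eq (degree_eq_degree_of_associated (h.wrs_associated none i hi))
  rw [(S.K_monic i).natDegree_mul (polyAt_monic t i)] at h1
  rw [S.l_eq i hi, ← hdeg, h1]
  omega

theorem Bases.eval_polyAt_ne_zero (h : S.Bases V t u) {i : ℕ} (hi : i ≤ N + 1) (s : Fin n) :
    ¬ (S.polyAt t i).IsRoot (S.z s) := by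
  intro h0
  refine (h.exact (some s)).not_dvd_wrs hi ?_
  rw [(h.wrs_associated (some s) i hi).dvd_iff_dvd_right, pow_succ]
  refine mul_dvd_mul ?_ (dvd_iff_isRoot.2 h0)
  rw [S.K_eq i hi]
  exact Finset.dvd_prod_of_mem (fun s : Fin n => (X - C (S.z s)) ^ S.sa (some s) i)
    (Finset.mem_univ s)

theorem Bases.not_isRoot_succ (h : S.Bases V t u) {i : ℕ} (hi : i ≤ N) (x : ℂ) :
    ¬ ((S.polyAt t i).IsRoot x ∧ (S.polyAt t (i + 1)).IsRoot x) := by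
  rintro ⟨h1, h2⟩
  by_cases hx : ∃ s, x = S.z s
  · obtain ⟨s, rfl⟩ := hx
    exact h.eval_polyAt_ne_zero (by omega) s h1
  push Not at hx
  rcases i with _ | i
  · rw [polyAt_zero] at h1
    simp at h1
  rcases hi.lt_or_eq with hlt | heq
  · exact h.not_isRoot (i + 1) (by omega) (by omega) x hx ⟨h1, h2⟩
  · rw [heq, polyAt_last] at h2
    simp at h2

/-- The `y_i` have simple roots: if `y_i` has a double root at `x`, the relation between the `y_i`
makes the product of its neighbours vanish at `x`, against the assumption on common roots. -/
theorem Bases.not_sq_dvd (h : S.Bases V t u) {i : ℕ} (h1 : 1 ≤ i) (hi : i ≤ N) (x : ℂ) :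
    ¬ (X - C x) ^ 2 ∣ S.polyAt t i := by
  intro hdvd
  obtain ⟨i, rfl⟩ : ∃ j, i = j + 1 := ⟨i - 1, by omega⟩
  have hroot : (S.polyAt t (i + 1)).IsRoot x :=
    dvd_iff_isRoot.1 ((dvd_pow_self _ two_ne_zero).trans hdvd)
  have hK : ∀ j ≤ N + 1, ¬ (S.K j).IsRoot x := by
    intro j hj h0
    rw [S.K_eq j hj, IsRoot, eval_prod, Finset.prod_eq_zero_iff] at h0
    obtain ⟨s, -, hs⟩ := h0
    refine pow_ne_zero (S.sa (some s) j) (sub_ne_zero.2 fun hxs => ?_) ((by simpa using hs) :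
      (x - S.z s) ^ S.sa (some s) j = 0)
    exact h.eval_polyAt_ne_zero (by omega) s (hxs ▸ hroot)
  have hW2 : (X - C x) ^ 2 ∣ wrs (u none) (i + 1) :=
    (hdvd.mul_left _).trans (h.wrs_associated none (i + 1) (by omega)).symm.dvd
  have hz : IsRoot (wrs (u none) i * wrs (u none) (i + 2)) x := by
    have := wronskian_wrs_succ_wrx (u none) i (u none (i + 1))
    rw [← wrs_succ] at this
    rw [← this]
    obtain ⟨g, hg⟩ := hW2
    simp [IsRoot, wronskian, hg, derivative_mul, derivative_X_sub_C_pow]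
  have key : ∀ j ≤ N + 1, (wrs (u none) j).IsRoot x → (S.polyAt t j).IsRoot x := by
    intro j hj h0
    have := (h.wrs_associated none j hj).dvd_iff_dvd_right.1 (dvd_iff_isRoot.2 h0)
    exact (root_mul.1 (dvd_iff_isRoot.1 this)).resolve_left (hK j hj)
  rcases root_mul.1 hz with h0 | h0
  · exact h.not_isRoot_succ (by omega) x ⟨key i (by omega) h0, hroot⟩
  · exact h.not_isRoot_succ (by omega) x ⟨hroot, key (i + 2) (by omega) h0⟩

/-- The point `t` lies in `R̃°`. -/
theorem Bases.eval_discr_ne_zero (h : S.Bases V t u) : MvPolynomial.eval t S.discr ≠ 0 := by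
  have hroot : ∀ v : S.Var, (S.polyAt t (v.1 + 1)).IsRoot (t v) := by
    intro v
    rw [← dvd_iff_isRoot]
    exact Finset.dvd_prod_of_mem (fun v => X - C (t v)) (by simp)
  unfold discr
  simp only [map_mul, map_prod, map_sub, MvPolynomial.eval_X, MvPolynomial.eval_C]
  refine mul_ne_zero (mul_ne_zero ?_ ?_) ?_
  · refine Finset.prod_ne_zero_iff.2 fun v _ => Finset.prod_ne_zero_iff.2 fun s _ => ?_
    refine sub_ne_zero.2 fun h0 => h.eval_polyAt_ne_zero (by omega) s (h0 ▸ hroot v)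
  · refine Finset.prod_ne_zero_iff.2 fun p hp => sub_ne_zero.2 fun h0 => ?_
    obtain ⟨-, h1, h2⟩ := Finset.mem_filter.1 hp
    refine h.not_sq_dvd (i := p.1.1 + 1) (by omega) p.1.1.2 (t p.1) ?_
    have hne : p.1 ≠ p.2 := fun h3 => by rw [h3] at h2; exact lt_irrefl _ h2
    rw [polyAt, pow_two]
    conv_lhs => rw [show X - C (t p.1) = X - C (t p.2) by rw [h0]]
    have : ∏ v ∈ {p.1, p.2}, (X - C (t v)) ∣ ∏ v : S.Var with (v.1 : ℕ) + 1 = p.1.1 + 1,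
        (X - C (t v)) := by
      refine Finset.prod_dvd_prod_of_subset _ _ _ fun v hv => ?_
      rcases Finset.mem_insert.1 hv with rfl | hv
      · simp
      · rw [Finset.mem_singleton] at hv
        simp [hv, h1]
    rw [Finset.prod_pair hne, h0] at this
    exact this
  · refine Finset.prod_ne_zero_iff.2 fun p hp => sub_ne_zero.2 fun h0 => ?_
    obtain ⟨-, h1⟩ := Finset.mem_filter.1 hp
    refine h.not_isRoot_succ (i := p.1.1 + 1) p.1.1.2 (t p.1) ⟨hroot _, ?_⟩
    rw [← h1, h0]
    exact hroot _

end BasicSituation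

/-! ### The critical equations -/

section LogDerivative

variable {A : Type*} [CommRing A]

section

variable [Algebra ℂ A]

/-- `g` is a logarithmic derivative of `x` along `D`. -/
def IsLogDeriv (D : Derivation ℂ A A) (x g : A) : Prop := D x = x * g

theorem IsLogDeriv.mul {D : Derivation ℂ A A} {x y g h : A} (hx : IsLogDeriv D x g)
    (hy : IsLogDeriv D y h) : IsLogDeriv D (x * y) (g + h) := by
  unfold IsLogDeriv at *
  rw [D.leibniz, hx, hy, smul_eq_mul, smul_eq_mul]
  ring

theorem IsLogDeriv.prod {ι : Type*} {D : Derivation ℂ A A} (s : Finset ι) (x g : ι → A)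
    (h : ∀ i ∈ s, IsLogDeriv D (x i) (g i)) :
    IsLogDeriv D (∏ i ∈ s, x i) (∑ i ∈ s, g i) := by
  classical
  induction s using Finset.induction_on with
  | empty => simp [IsLogDeriv]
  | insert a s ha ih =>
    rw [Finset.prod_insert ha, Finset.sum_insert ha]
    exact (h a (Finset.mem_insert_self a s)).mul
      (ih fun i hi => h i (Finset.mem_insert_of_mem hi))

theorem isLogDeriv_of_isUnit (D : Derivation ℂ A A) {x : A} (hx : IsUnit x) :
    IsLogDeriv D x (D x * Ring.inverse x) := by
  unfold IsLogDeriv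
  rw [mul_left_comm, Ring.mul_inverse_cancel x hx, mul_one]

theorem isLogDeriv_inverse (D : Derivation ℂ A A) {x : A} (hx : IsUnit x) :
    IsLogDeriv D (Ring.inverse x) (-(D x * Ring.inverse x)) := by
  have h1 := congrArg D (Ring.mul_inverse_cancel x hx)
  rw [D.leibniz, D.map_one_eq_zero, smul_eq_mul, smul_eq_mul] at h1
  unfold IsLogDeriv
  refine hx.mul_left_cancel ?_
  have h2 := Ring.mul_inverse_cancel x hx
  linear_combination h1 + D x * Ring.inverse x * h2

end

theorem ring_inverse_neg (x : A) : Ring.inverse (-x) = -Ring.inverse x := by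
  by_cases hx : IsUnit x
  · refine hx.neg.mul_left_cancel ?_
    rw [Ring.mul_inverse_cancel _ hx.neg, neg_mul_neg, Ring.mul_inverse_cancel _ hx]
  · rw [Ring.inverse_non_unit _ hx, Ring.inverse_non_unit _ (by rwa [IsUnit.neg_iff]), neg_zero]

/-- `g` is a logarithmic derivative at `a` of the polynomial `P`. -/
def IsLogDerivAt (a : A) (P : A[X]) (g : A) : Prop :=
  P.derivative.eval a = P.eval a * g

theorem IsLogDerivAt.mul {a : A} {P Q : A[X]} {g h : A} (hP : IsLogDerivAt a P g)
    (hQ : IsLogDerivAt a Q h) : IsLogDerivAt a (P * Q) (g + h) := by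
  unfold IsLogDerivAt at *
  rw [derivative_mul, eval_add, eval_mul, eval_mul, hP, hQ, eval_mul]
  ring

theorem IsLogDerivAt.prod_X_sub_C {ι : Type*} {a : A} (s : Finset ι) (x : ι → A)
    (h : ∀ i ∈ s, IsUnit (a - x i)) :
    IsLogDerivAt a (∏ i ∈ s, (X - C (x i))) (∑ i ∈ s, Ring.inverse (a - x i)) := by
  classical
  induction s using Finset.induction_on with
  | empty => simp [IsLogDerivAt]
  | insert b s hb ih =>
    rw [Finset.prod_insert hb, Finset.sum_insert hb]
    refine IsLogDerivAt.mul ?_ (ih fun i hi => h i (Finset.mem_insert_of_mem hi))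
    simp [IsLogDerivAt, Ring.mul_inverse_cancel _ (h b (Finset.mem_insert_self b s))]

/-- At a simple root `a` of `y = (x - a) y₁`, the value of `Wr(y', Q)` is a multiple of the
difference of the logarithmic derivatives of `Q` and of `y₁ ^ 2`. -/
theorem eval_wronskian_derivative {a : A} {y₁ Q : A[X]} {g h : A} (hy : IsLogDerivAt a y₁ g)
    (hQ : IsLogDerivAt a Q h) :
    (wronskian (derivative ((X - C a) * y₁)) Q).eval a =
      -(y₁.eval a * Q.eval a) * (2 * g - h) := by
  unfold IsLogDerivAt at *
  simp [wronskian, derivative_mul, hy, hQ]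
  ring

/-- The coefficients of the remainder of `F` modulo `∏ (x - t_v)` generate the same ideal as the
values of `F` at the `t_v`, when the differences of the `t_v` are units. -/
theorem coeff_modByMonic_mem_iff {ι : Type*} (s : Finset ι) (t : ι → A)
    (h : ∀ v ∈ s, ∀ w ∈ s, v ≠ w → IsUnit (t v - t w)) (F : A[X]) (I : Ideal A) :
    (∀ k, (F %ₘ ∏ v ∈ s, (X - C (t v))).coeff k ∈ I) ↔ ∀ v ∈ s, F.eval (t v) ∈ I := by
  have hmon : (∏ v ∈ s, (X - C (t v))).Monic := monic_prod_of_monic _ _ fun _ _ => monic_X_sub_C _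
  constructor
  · intro hk v hv
    have h1 : F.eval (t v) = (F %ₘ ∏ v ∈ s, (X - C (t v))).eval (t v) := by
      conv_lhs => rw [← modByMonic_add_div F (∏ v ∈ s, (X - C (t v)))]
      have h2 : (∏ v ∈ s, (X - C (t v))).eval (t v) = 0 := by
        rw [eval_prod, Finset.prod_eq_zero hv]
        simp
      rw [eval_add, eval_mul, h2, zero_mul, add_zero]
    rw [h1, eval_eq_sum_range]
    exact Ideal.sum_mem _ fun i _ => I.mul_mem_right _ (hk i)
  · intro hv k
    let f := Ideal.Quotient.mk I
    have h1 : ∏ v ∈ s, (X - C (f (t v))) ∣ F.map f := by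
      refine Finset.prod_dvd_of_coprime (fun v hv' w hw hvw => ?_) fun v hv' => ?_
      · refine isCoprime_X_sub_C_of_isUnit_sub ?_
        rw [← map_sub]
        exact (h v hv' w hw hvw).map f
      · rw [dvd_iff_isRoot, IsRoot, eval_map_apply]
        exact Ideal.Quotient.eq_zero_iff_mem.2 (hv v hv')
    have h2 : (F %ₘ ∏ v ∈ s, (X - C (t v))).map f = 0 := by
      rw [map_modByMonic _ hmon, modByMonic_eq_zero_iff_dvd (hmon.map f)]
      simpa [Polynomial.map_prod] using h1
    rw [← Ideal.Quotient.eq_zero_iff_mem, ← coeff_map, h2, coeff_zero]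

end LogDerivative

namespace BasicSituation

variable {N d n : ℕ} {S : BasicSituation N d n}

theorem aeval_coord (p : MvPolynomial S.Var ℂ) :
    MvPolynomial.aeval S.coord p = algebraMap _ S.RegFun p := by
  have : (MvPolynomial.aeval S.coord : MvPolynomial S.Var ℂ →ₐ[ℂ] S.RegFun) =
      IsScalarTower.toAlgHom ℂ (MvPolynomial S.Var ℂ) S.RegFun := by
    refine MvPolynomial.algHom_ext fun v => ?_
    simp [coord]
  exact DFunLike.congr_fun this p

theorem isUnit_coord_sub_of_samePairs {p : S.Var × S.Var} (hp : p ∈ S.samePairs) :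
    IsUnit (S.coord p.1 - S.coord p.2) := by
  have h : (MvPolynomial.X p.1 - MvPolynomial.X p.2 : MvPolynomial S.Var ℂ) ∣ S.discr :=
    ((Finset.dvd_prod_of_mem (fun p : S.Var × S.Var =>
      (MvPolynomial.X p.1 - MvPolynomial.X p.2 : MvPolynomial S.Var ℂ)) hp).mul_left _).mul_right _
  have h2 := isUnit_of_dvd_unit
    (map_dvd (algebraMap (MvPolynomial S.Var ℂ) S.RegFun) h) S.isUnit_discr
  simpa [coord] using h2

theorem isUnit_coord_sub_of_level_eq {v w : S.Var} (hvw : v ≠ w) (h : v.1 = w.1) :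
    IsUnit (S.coord v - S.coord w) := by
  have hne : (v.2 : ℕ) ≠ w.2 := by
    obtain ⟨i, j⟩ := v
    obtain ⟨i', j'⟩ := w
    simp only at h
    subst h
    exact fun h' => hvw (congrArg (Sigma.mk i) (Fin.ext h'))
  rcases lt_or_gt_of_ne hne with hlt | hlt
  · exact isUnit_coord_sub_of_samePairs (p := (v, w)) (by simp [samePairs, h, hlt])
  · rw [← neg_sub]
    exact (isUnit_coord_sub_of_samePairs (p := (w, v)) (by simp [samePairs, h, hlt])).neg

theorem isUnit_coord_sub_of_level_succ {v w : S.Var}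
    (h : (w.1 : ℕ) = v.1 + 1 ∨ (v.1 : ℕ) = w.1 + 1) : IsUnit (S.coord v - S.coord w) := by
  rcases h with h | h
  · exact S.isUnit_coord_sub_coord (p := (v, w)) (by simp [adjacentPairs, h])
  · rw [← neg_sub]
    exact (S.isUnit_coord_sub_coord (p := (w, v)) (by simp [adjacentPairs, h])).neg

variable (S) in
/-- The logarithmic derivative of the master function with respect to the coordinate with index
`v`. -/
def bethe (v : S.Var) : S.RegFun :=
  2 * (∑ w ∈ (Finset.univ.filter fun w : S.Var => (w.1 : ℕ) + 1 = v.1 + 1).erase v,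
      Ring.inverse (S.coord v - S.coord w)) -
    (aeval (S.coord v) (derivative (S.T (v.1 + 1))) *
        Ring.inverse (aeval (S.coord v) (S.T (v.1 + 1))) +
      (∑ w : S.Var with (w.1 : ℕ) + 1 = v.1, Ring.inverse (S.coord v - S.coord w)) +
      ∑ w : S.Var with (w.1 : ℕ) + 1 = v.1 + 2, Ring.inverse (S.coord v - S.coord w))

theorem sum_pairs_eq {ι A : Type*} [Fintype ι] [DecidableEq ι] [CommRing A] (P : Finset (ι × ι))
    (D : ι → A) (f : ι → ι → A) (hf : ∀ v w, f w v = -f v w) :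
    ∑ p ∈ P, (D p.1 - D p.2) * f p.1 p.2 =
      ∑ v, D v * ∑ w, ((if (v, w) ∈ P then f v w else 0) + if (w, v) ∈ P then f v w else 0) := by
  have h1 : ∑ p ∈ P, (D p.1 - D p.2) * f p.1 p.2 =
      ∑ v, ∑ w, if (v, w) ∈ P then (D v - D w) * f v w else 0 := by
    rw [← Finset.sum_product', Finset.univ_product_univ, ← Finset.sum_filter]
    exact Finset.sum_congr (by ext; simp) fun _ _ => rfl
  have h2 : ∀ v w, (if (v, w) ∈ P then (D v - D w) * f v w else 0) =
      (if (v, w) ∈ P then D v * f v w else 0) + if (v, w) ∈ P then D w * f w v else 0 := by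
    intro v w
    split_ifs
    · rw [hf v w]; ring
    · simp
  rw [h1]
  simp only [h2, Finset.sum_add_distrib]
  rw [Finset.sum_comm (f := fun v w => if (v, w) ∈ P then D w * f w v else 0),
    ← Finset.sum_add_distrib]
  refine Finset.sum_congr rfl fun v _ => ?_
  simp only [mul_add, Finset.mul_sum, mul_ite, mul_zero]

/-- The logarithmic derivative of `Φ` along a vector field is the combination of the Bethe
functions with the components of the vector field as coefficients. -/
theorem isLogDeriv_masterFunction (D : Derivation ℂ S.RegFun S.RegFun) :
    IsLogDeriv D S.masterFunction (∑ v, D (S.coord v) * S.bethe v) := by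
  classical
  have h1 := ((IsLogDeriv.prod (D := D) Finset.univ
    (fun v : S.Var => Ring.inverse (aeval (S.coord v) (S.T (v.1 + 1)))) _ fun v _ =>
      isLogDeriv_inverse D (S.isUnit_aeval_T v _)).mul
    (IsLogDeriv.prod (D := D) S.adjacentPairs
      (fun p => Ring.inverse (S.coord p.1 - S.coord p.2)) _ fun p hp =>
        isLogDeriv_inverse D (S.isUnit_coord_sub_coord hp))).mul
    (IsLogDeriv.prod (D := D) S.samePairs (fun p => (S.coord p.1 - S.coord p.2) ^ 2)
      (fun p => 2 * ((D (S.coord p.1) - D (S.coord p.2)) *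
        Ring.inverse (S.coord p.1 - S.coord p.2))) fun p hp => by
        have := isLogDeriv_of_isUnit D (isUnit_coord_sub_of_samePairs hp)
        rw [pow_two, two_mul, ← map_sub]
        exact this.mul this)
  refine Eq.mpr (congrArg (IsLogDeriv D S.masterFunction) ?_) h1
  have hf : ∀ v w : S.Var, Ring.inverse (S.coord w - S.coord v) =
      -Ring.inverse (S.coord v - S.coord w) := by
    intro v w
    rw [← neg_sub, ring_inverse_neg]
  simp only [map_sub, Finset.sum_neg_distrib, ← Finset.mul_sum]
  rw [sum_pairs_eq S.adjacentPairs (fun v => D (S.coord v))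
    (fun v w => Ring.inverse (S.coord v - S.coord w)) hf,
    sum_pairs_eq S.samePairs (fun v => D (S.coord v))
    (fun v w => Ring.inverse (S.coord v - S.coord w)) hf, Finset.mul_sum,
    ← Finset.sum_neg_distrib, ← Finset.sum_neg_distrib, ← Finset.sum_add_distrib,
    ← Finset.sum_add_distrib]
  refine Finset.sum_congr rfl fun v _ => ?_
  -- The pairs which contain `v` are collected from both of their positions.
  have e1 : ∑ w, ((if (v, w) ∈ S.adjacentPairs then Ring.inverse (S.coord v - S.coord w) else 0) +
      if (w, v) ∈ S.adjacentPairs then Ring.inverse (S.coord v - S.coord w) else 0) =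
      (∑ w : S.Var with (w.1 : ℕ) + 1 = v.1, Ring.inverse (S.coord v - S.coord w)) +
      ∑ w : S.Var with (w.1 : ℕ) + 1 = v.1 + 2, Ring.inverse (S.coord v - S.coord w) := by
    rw [Finset.sum_add_distrib, add_comm, Finset.sum_filter, Finset.sum_filter]
    congr 1
    · refine Finset.sum_congr rfl fun w _ => if_congr ?_ rfl rfl
      simp only [adjacentPairs, Finset.mem_filter, Finset.mem_univ, true_and]
      omega
    · refine Finset.sum_congr rfl fun w _ => if_congr ?_ rfl rfl
      simp only [adjacentPairs, Finset.mem_filter, Finset.mem_univ, true_and]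
      omega
  have e2 : ∑ w, ((if (v, w) ∈ S.samePairs then Ring.inverse (S.coord v - S.coord w) else 0) +
      if (w, v) ∈ S.samePairs then Ring.inverse (S.coord v - S.coord w) else 0) =
      ∑ w ∈ (Finset.univ.filter fun w : S.Var => (w.1 : ℕ) + 1 = v.1 + 1).erase v,
        Ring.inverse (S.coord v - S.coord w) := by
    have h0 : (Finset.univ.filter fun w : S.Var => (w.1 : ℕ) + 1 = v.1 + 1).erase v =
        Finset.univ.filter fun w : S.Var => v.1 = w.1 ∧ v ≠ w := by
      ext w
      simp only [Finset.mem_erase, Finset.mem_filter, Finset.mem_univ, true_and, Fin.ext_iff]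
      constructor
      · rintro ⟨h1, h2⟩
        exact ⟨by omega, fun h => h1 h.symm⟩
      · rintro ⟨h1, h2⟩
        exact ⟨fun h => h2 h.symm, by omega⟩
    rw [h0, Finset.sum_filter]
    refine Finset.sum_congr rfl fun w _ => ?_
    simp only [samePairs, Finset.mem_filter, Finset.mem_univ, true_and]
    by_cases hl : v.1 = w.1
    · have hne : v ≠ w ↔ (v.2 : ℕ) ≠ w.2 := by
        obtain ⟨i, j⟩ := v
        obtain ⟨i', j'⟩ := w
        simp only at hl
        subst hl
        simp [Fin.ext_iff]
      simp only [hl, true_and, hne]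
      rcases lt_trichotomy (v.2 : ℕ) w.2 with h | h | h
      · simp [h, h.ne, h.not_gt]
      · simp [h]
      · simp [h, h.ne', h.not_gt]
    · simp [hl, Ne.symm hl]
  rw [e1, e2, Derivation.map_aeval, smul_eq_mul, bethe]
  ring

variable (S) in
/-- The partial derivative with respect to the coordinate with index `v`, obtained from the
substitution `t_v ↦ t_v + ε` over the dual numbers. -/
theorem exists_partialDerivation (v : S.Var) :
    ∃ D : Derivation ℂ S.RegFun S.RegFun, ∀ w, D (S.coord w) = if w = v then 1 else 0 := by
  classical
  let f : MvPolynomial S.Var ℂ →ₐ[ℂ] TrivSqZeroExt S.RegFun S.RegFun :=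
    MvPolynomial.aeval fun w =>
      TrivSqZeroExt.inl (S.coord w) + TrivSqZeroExt.inr (if w = v then 1 else 0)
  let π : TrivSqZeroExt S.RegFun S.RegFun →ₐ[ℂ] S.RegFun := TrivSqZeroExt.fstHom ℂ _ _
  have hπf : ∀ p, π (f p) = algebraMap _ S.RegFun p := by
    intro p
    have : π.comp f = MvPolynomial.aeval S.coord :=
      MvPolynomial.algHom_ext fun w => by
        simp only [AlgHom.comp_apply, f, MvPolynomial.aeval_X, π, TrivSqZeroExt.fstHom_apply,
          TrivSqZeroExt.fst_add, TrivSqZeroExt.fst_inl, TrivSqZeroExt.fst_inr, add_zero]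
    rw [← aeval_coord, ← this]
    rfl
  let g : S.RegFun →ₐ[ℂ] TrivSqZeroExt S.RegFun S.RegFun :=
    IsLocalization.liftAlgHom (M := Submonoid.powers S.discr) (f := f) (by
      rintro ⟨_, k, rfl⟩
      rw [map_pow]
      refine IsUnit.pow k (TrivSqZeroExt.isUnit_iff_isUnit_fst.2 ?_)
      rw [show (f S.discr).fst = _ from hπf S.discr]
      exact S.isUnit_discr)
  have hg : ∀ p, g (algebraMap _ S.RegFun p) = f p := fun p => IsLocalization.lift_eq _ p
  have hπg : ∀ x, (g x).fst = x := by
    have : π.comp g = AlgHom.id ℂ S.RegFun := by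
      refine IsLocalization.algHom_ext (Submonoid.powers S.discr) ?_
      refine AlgHom.ext fun p => ?_
      exact (congrArg π (hg p)).trans (hπf p)
    exact fun x => DFunLike.congr_fun this x
  refine ⟨Derivation.mk' ((TrivSqZeroExt.sndHom S.RegFun S.RegFun).restrictScalars ℂ ∘ₗ
    g.toLinearMap) fun a b => ?_, fun w => ?_⟩
  · simp only [LinearMap.comp_apply, LinearMap.restrictScalars_apply, AlgHom.toLinearMap_apply,
      TrivSqZeroExt.sndHom_apply, map_mul, TrivSqZeroExt.snd_mul, hπg,
      op_smul_eq_smul]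
  · change (g (S.coord w)).snd = _
    rw [coord, hg, MvPolynomial.aeval_X, TrivSqZeroExt.snd_add, TrivSqZeroExt.snd_inl,
      TrivSqZeroExt.snd_inr, zero_add]

theorem isUnit_masterFunction : IsUnit S.masterFunction := by
  have key : ∀ {ι : Type} (s : Finset ι) (f : ι → S.RegFun), (∀ i ∈ s, IsUnit (f i)) →
      IsUnit (∏ i ∈ s, f i) := fun s f h =>
    Finset.prod_induction _ (fun x => IsUnit x) (fun _ _ => IsUnit.mul) isUnit_one h
  refine ((key _ _ fun v _ => ?_).mul (key _ _ fun p hp => ?_)).mul (key _ _ fun p hp => ?_)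
  · exact (S.isUnit_aeval_T v _).ringInverse
  · exact (S.isUnit_coord_sub_coord hp).ringInverse
  · exact (isUnit_coord_sub_of_samePairs hp).pow 2

variable (S) in
theorem criticalIdeal_eq : S.criticalIdeal = Ideal.span (Set.range S.bethe) := by
  apply le_antisymm
  · refine Ideal.span_le.2 ?_
    rintro _ ⟨D, rfl⟩
    have := isLogDeriv_masterFunction D
    unfold IsLogDeriv at this
    change D S.masterFunction ∈ _
    rw [this]
    exact Ideal.mul_mem_left _ _ (Ideal.sum_mem _ fun v _ =>
      Ideal.mul_mem_left _ _ (Ideal.subset_span ⟨v, rfl⟩))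
  · refine Ideal.span_le.2 ?_
    rintro _ ⟨v, rfl⟩
    obtain ⟨D, hD⟩ := S.exists_partialDerivation v
    have h1 := isLogDeriv_masterFunction D
    unfold IsLogDeriv at h1
    simp only [hD, ite_mul, one_mul, zero_mul, Finset.sum_ite_eq', Finset.mem_univ, if_true] at h1
    have h2 : D S.masterFunction ∈ S.criticalIdeal := Ideal.subset_span ⟨D, rfl⟩
    rw [h1] at h2
    exact (Ideal.unit_mul_mem_iff_mem _ isUnit_masterFunction).1 h2

/-- Up to a unit, the Bethe function with index `v` is the value of the Wronskian of the
divisibility condition at the root `t_v`. -/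
theorem eval_coord_wronskian (v : S.Var) : ∃ c : S.RegFun, IsUnit c ∧
    (wronskian (derivative (S.univPoly (v.1 + 1)))
      ((S.T (v.1 + 1)).map (algebraMap ℂ S.RegFun) * S.univPoly v.1 *
        S.univPoly (v.1 + 2))).eval (S.coord v) = c * S.bethe v := by
  classical
  have hv : v ∈ Finset.univ.filter fun w : S.Var => (w.1 : ℕ) + 1 = v.1 + 1 := by simp
  have hy : S.univPoly (v.1 + 1) = (X - C (S.coord v)) *
      ∏ w ∈ (Finset.univ.filter fun w : S.Var => (w.1 : ℕ) + 1 = v.1 + 1).erase v,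
        (X - C (S.coord w)) := (Finset.mul_prod_erase _ (fun w => X - C (S.coord w)) hv).symm
  have hu1 : ∀ w ∈ (Finset.univ.filter fun w : S.Var => (w.1 : ℕ) + 1 = v.1 + 1).erase v,
      IsUnit (S.coord v - S.coord w) := by
    intro w hw
    have h1 := (Finset.mem_filter.1 (Finset.mem_of_mem_erase hw)).2
    exact isUnit_coord_sub_of_level_eq (Finset.ne_of_mem_erase hw).symm (Fin.ext (by omega))
  have hu2 : ∀ w ∈ Finset.univ.filter fun w : S.Var => (w.1 : ℕ) + 1 = v.1,
      IsUnit (S.coord v - S.coord w) := fun w hw => by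
    have h1 := (Finset.mem_filter.1 hw).2
    exact isUnit_coord_sub_of_level_succ (by omega)
  have hu3 : ∀ w ∈ Finset.univ.filter fun w : S.Var => (w.1 : ℕ) + 1 = v.1 + 2,
      IsUnit (S.coord v - S.coord w) := fun w hw => by
    have h1 := (Finset.mem_filter.1 hw).2
    exact isUnit_coord_sub_of_level_succ (by omega)
  have hT : IsLogDerivAt (S.coord v) ((S.T (v.1 + 1)).map (algebraMap ℂ S.RegFun))
      (aeval (S.coord v) (derivative (S.T (v.1 + 1))) *
        Ring.inverse (aeval (S.coord v) (S.T (v.1 + 1)))) := by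
    unfold IsLogDerivAt
    rw [derivative_map, eval_map_algebraMap, eval_map_algebraMap, mul_left_comm,
      Ring.mul_inverse_cancel _ (S.isUnit_aeval_T v _), mul_one]
  have key : ∀ s : Finset S.Var, (∀ w ∈ s, IsUnit (S.coord v - S.coord w)) →
      IsUnit ((∏ w ∈ s, (X - C (S.coord w))).eval (S.coord v)) := by
    intro s hs
    rw [eval_prod]
    exact Finset.prod_induction _ (fun x => IsUnit x) (fun _ _ => IsUnit.mul) isUnit_one
      fun w hw => by simpa using hs w hw
  rw [hy]
  refine ⟨_, ?_, eval_wronskian_derivative (IsLogDerivAt.prod_X_sub_C _ _ hu1)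
    ((hT.mul (IsLogDerivAt.prod_X_sub_C _ _ hu2)).mul (IsLogDerivAt.prod_X_sub_C _ _ hu3))⟩
  rw [IsUnit.neg_iff, eval_mul, eval_mul]
  refine (key _ hu1).mul ((IsUnit.mul ?_ (key _ hu2)).mul (key _ hu3))
  rw [eval_map_algebraMap]
  exact S.isUnit_aeval_T v _

variable (S) in
theorem divisibilityIdeal_eq : S.divisibilityIdeal = Ideal.span (Set.range S.bethe) := by
  have key : ∀ I : Ideal S.RegFun, S.divisibilityIdeal ≤ I ↔ Ideal.span (Set.range S.bethe) ≤ I := by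
    intro I
    have h1 : S.divisibilityIdeal ≤ I ↔ ∀ i : Fin N, ∀ k,
        ((wronskian (derivative (S.univPoly (i + 1)))
          ((S.T (i + 1)).map (algebraMap ℂ S.RegFun) * S.univPoly i * S.univPoly (i + 2))) %ₘ
          S.univPoly (i + 1)).coeff k ∈ I := by
      rw [divisibilityIdeal, Ideal.span_le]
      exact ⟨fun h i k => h ⟨i, k, rfl⟩, by rintro h _ ⟨i, k, rfl⟩; exact h i k⟩
    rw [h1, Ideal.span_le, Set.range_subset_iff]
    have h2 : ∀ i : Fin N, (∀ k, ((wronskian (derivative (S.univPoly (i + 1)))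
        ((S.T (i + 1)).map (algebraMap ℂ S.RegFun) * S.univPoly i * S.univPoly (i + 2))) %ₘ
          S.univPoly (i + 1)).coeff k ∈ I) ↔ ∀ v : S.Var, v.1 = i → S.bethe v ∈ I := by
      intro i
      refine (coeff_modByMonic_mem_iff _ S.coord (fun v hv w hw hvw => ?_) _ I).trans ?_
      · have h1 := (Finset.mem_filter.1 hv).2
        have h2 := (Finset.mem_filter.1 hw).2
        exact isUnit_coord_sub_of_level_eq hvw (Fin.ext (by omega))
      · refine forall_congr' fun v => ?_
        have : v ∈ (Finset.univ.filter fun w : S.Var => (w.1 : ℕ) + 1 = i + 1) ↔ v.1 = i := by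
          simp [Fin.ext_iff]
        rw [this]
        refine imp_congr_right fun hv => ?_
        subst hv
        obtain ⟨c, hc, h⟩ := eval_coord_wronskian v
        rw [h, Ideal.unit_mul_mem_iff_mem _ hc]
    simp only [h2]
    exact ⟨fun h v => h v.1 v rfl, fun h i v _ => h v⟩
  exact le_antisymm ((key _).2 le_rfl) ((key _).1 le_rfl)

variable (S) in
/-- The schemes `Ã'` and `Ã` coincide: both are the zero scheme of the Bethe functions. -/
theorem criticalIdeal_eq_divisibilityIdeal : S.criticalIdeal = S.divisibilityIdeal := by
  rw [criticalIdeal_eq, divisibilityIdeal_eq]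

end BasicSituation

/-! ### Spaces whose Wronskian is a monomial -/

section Monomial

variable {L : Type*} [Field L]

/-- A space of polynomials over a field has a basis consisting of polynomials with distinct orders
of vanishing at the origin. -/
theorem exists_family_injective_order (r : ℕ) (W : Submodule L L[X]) [FiniteDimensional L W]
    (hr : Module.finrank L W = r) : ∃ (u : Fin r → L[X]) (e : Fin r → ℕ),
      Function.Injective e ∧ ∀ k, u k ∈ W ∧ X ^ e k ∣ u k ∧ (u k).coeff (e k) ≠ 0 := by
  classical
  induction r generalizing W with
  | zero => exact ⟨Fin.elim0, Fin.elim0, fun a => a.elim0, fun a => a.elim0⟩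
  | succ r ih =>
    have hex : ∃ m, ∃ w ∈ W, w.coeff m ≠ 0 := by
      by_contra! h
      have : W = ⊥ := (Submodule.eq_bot_iff W).2 fun w hw => Polynomial.ext fun m => by
        simpa using h m w hw
      rw [this, finrank_bot] at hr
      omega
    obtain ⟨w, hw, hwm⟩ := Nat.find_spec hex
    set m := Nat.find hex
    have hmin : ∀ v ∈ W, ∀ a < m, v.coeff a = 0 := fun v hv a ha => by
      by_contra h0
      exact Nat.find_min hex ha ⟨v, hv, h0⟩
    let f : W →ₗ[L] L := (lcoeff L m).domRestrict W
    have hf : Function.Surjective f := fun a => ⟨(a / w.coeff m) • ⟨w, hw⟩, by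
      rw [map_smul]
      exact div_mul_cancel₀ a hwm⟩
    have hker : Module.finrank L (LinearMap.ker f) = r := by
      have h1 := f.finrank_range_add_finrank_ker
      rw [LinearMap.range_eq_top.2 hf, finrank_top, Module.finrank_self, hr] at h1
      omega
    obtain ⟨u, e, he, hu⟩ := ih ((LinearMap.ker f).map W.subtype)
      ((Submodule.equivMapOfInjective _ W.subtype_injective _).finrank_eq.symm.trans hker)
    have hu' : ∀ k, u k ∈ W ∧ (u k).coeff m = 0 := by
      intro k
      obtain ⟨x, hx, hxu⟩ := (hu k).1
      rw [← hxu]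
      exact ⟨x.2, hx⟩
    refine ⟨Fin.cons w u, Fin.cons m e, Fin.cons_injective_iff.2 ⟨?_, he⟩, fun k => ?_⟩
    · rintro ⟨k, hk⟩
      exact (hu k).2.2 (hk ▸ (hu' k).2)
    · refine Fin.cases ?_ (fun k => ?_) k
      · exact ⟨hw, X_pow_dvd_iff.2 fun a ha => hmin w hw a ha, hwm⟩
      · exact ⟨(hu' k).1, (hu k).2⟩

/-- A space of polynomials in echelon form with pivots `x^{q_k}` whose Wronskian is a monomial is
spanned by monomials. Indeed the sum of its exponents at zero agrees with the sum of its degrees,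
so that the linear differential operator with this kernel is an Euler operator, that is, diagonal
with respect to the monomials. -/
theorem eq_X_pow_of_wrs_eq [Algebra ℂ L] {r D : ℕ} (q : ℕ → ℕ) (v : ℕ → L[X])
    (hq : ∀ i < r, ∀ j < r, q i = q j → i = j) (hdeg : ∀ k < r, (v k).natDegree ≤ q k)
    (hpiv : ∀ k < r, ∀ j < r, (v k).coeff (q j) = if k = j then 1 else 0) {c : L}
    (hwr : wrs v r = C c * X ^ D) {k m : ℕ} (hk : k < r) (hm : m ≠ q k) : (v k).coeff m = 0 := by
  have hqinj : Function.Injective fun j : Fin r => q j := fun i j h =>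
    Fin.ext (hq i i.2 j j.2 h)
  -- The degrees sum up to `D + (0 + 1 + … + (r - 1))`.
  obtain ⟨hd1, hd2⟩ := natDegree_X_pow_mul_wr_le_and_coeff (fun j : Fin r => v j)
    (fun j => q j) fun j => hdeg j j.2
  have hsumq : ∑ j : Fin r, q j = (∑ j : Fin r, (j : ℕ)) + D := by
    have h1 : (X ^ (∑ j : Fin r, (j : ℕ)) * wrs v r).coeff (∑ j : Fin r, q j) ≠ 0 := by
      rw [wrs, hd2]
      refine mul_ne_zero (isUnit_fallingDet _ hqinj).ne_zero
        (Finset.prod_ne_zero_iff.2 fun j _ => ?_)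
      rw [hpiv j j.2 j j.2, if_pos rfl]
      exact one_ne_zero
    rw [hwr, mul_left_comm, ← pow_add, coeff_C_mul, coeff_X_pow] at h1
    by_contra hne
    exact h1 (by rw [if_neg hne, mul_zero])
  -- A basis with distinct orders at zero.
  have hlin : LinearIndependent L fun j : Fin r => v j := by
    rw [Fintype.linearIndependent_iff]
    intro g hg i
    have h1 := congrArg (fun p => coeff p (q i)) hg
    simp only [finsetSum_coeff, coeff_smul, smul_eq_mul, coeff_zero] at h1
    rw [Finset.sum_congr rfl fun j _ => by rw [hpiv j j.2 i i.2]] at h1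
    simpa [Fin.val_inj] using h1
  have : FiniteDimensional L (Submodule.span L (Set.range fun j : Fin r => v j)) :=
    FiniteDimensional.span_of_finite L (Set.finite_range _)
  obtain ⟨u, e, he, hu⟩ := exists_family_injective_order r
    (Submodule.span L (Set.range fun j : Fin r => v j))
    ((finrank_span_eq_card hlin).trans (Fintype.card_fin r))
  obtain ⟨H, hH, hH0⟩ := exists_X_pow_mul_wr_eq u e fun k => (hu k).2.1
  have hH0' : H.coeff 0 ≠ 0 := by
    rw [hH0]
    exact mul_ne_zero (isUnit_fallingDet _ he).ne_zero
      (Finset.prod_ne_zero_iff.2 fun j _ => (hu j).2.2)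
  have hA : ∀ k, ∃ A : Fin r → L, ∑ j, C (A j) * v j = u k := by
    intro k
    obtain ⟨A, hA⟩ := (Submodule.mem_span_range_iff_exists_fun L).1 (hu k).1
    exact ⟨A, by simpa only [smul_eq_C_mul] using hA⟩
  choose A hA using hA
  have hwu : wr u = C (Matrix.of A).det * wrs v r := by
    rw [wrs, ← wr_linearCombination]
    congr 1
    exact funext fun i => (hA i).symm
  have hdet : (Matrix.of A).det ≠ 0 := by
    intro h0
    rw [hwu, h0, C_0, zero_mul, mul_zero] at hH
    have := (mul_eq_zero.1 hH.symm).resolve_left (pow_ne_zero _ X_ne_zero)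
    rw [this, coeff_zero] at hH0'
    exact hH0' rfl
  have hsume : ∑ j, e j = ∑ j : Fin r, q j := by
    rw [hsumq]
    rw [hwu, hwr, show X ^ (∑ j : Fin r, (j : ℕ)) * (C (Matrix.of A).det * (C c * X ^ D)) =
      C ((Matrix.of A).det * c) * X ^ ((∑ j : Fin r, (j : ℕ)) + D) by
        rw [C_mul, pow_add]; ring] at hH
    have h1 := congrArg (fun p => p.coeff (∑ j, e j)) hH
    simp only [coeff_C_mul, coeff_X_pow, coeff_X_pow_mul', le_refl, if_true, Nat.sub_self] at h1
    by_contra hne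
    rw [if_neg hne, mul_zero] at h1
    exact hH0' h1.symm
  have hvu : ∀ i : Fin r, v i ∈ Submodule.span L (Set.range u) := by
    intro i
    have h : v i = ∑ k, (Matrix.of A)⁻¹ i k • u k := by
      simp only [← hA, Finset.smul_sum, smul_eq_C_mul]
      rw [Finset.sum_comm]
      simp only [← mul_assoc, ← C_mul, ← Finset.sum_mul, ← map_sum]
      have := Matrix.nonsing_inv_mul (Matrix.of A) (isUnit_iff_ne_zero.2 hdet)
      have h2 : ∀ j, ∑ k, (Matrix.of A)⁻¹ i k * A k j = if i = j then 1 else 0 := by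
        intro j
        have := congrFun (congrFun this i) j
        rwa [Matrix.mul_apply, Matrix.one_apply] at this
      simp [h2]
    rw [h]
    exact Submodule.sum_mem _ fun k _ => Submodule.smul_mem _ _ (Submodule.subset_span ⟨k, rfl⟩)
  -- The operator is diagonal.
  have hdiag : ∀ m, ∃ χ : L, (m ∉ Set.range (fun j : Fin r => q j) → χ ≠ 0) ∧
      X ^ (∑ j : Fin (r + 1), (j : ℕ)) * wrx v r (X ^ m) =
        C χ * X ^ ((∑ j : Fin r, q j) + m) := by
    intro m
    have hdvd : X ^ ((∑ j : Fin r, q j) + m) ∣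
        X ^ (∑ j : Fin (r + 1), (j : ℕ)) * wrx v r (X ^ m) := by
      let M : Submodule L L[X] :=
        ((Ideal.span {X ^ ((∑ j : Fin r, q j) + m)} : Ideal L[X]).restrictScalars L).comap
          (LinearMap.mulLeft L (X ^ (∑ j : Fin (r + 1), (j : ℕ))))
      suffices h : wrx v r (X ^ m) ∈ M from Ideal.mem_span_singleton.1 h
      refine wr_mem_of_mem_span (Fin.snoc (α := fun _ => L[X]) u (X ^ m)) M (fun ρ hρ => ?_) _
        fun i => ?_
      · refine Ideal.mem_span_singleton.2 ?_
        obtain ⟨H, hH, -⟩ := exists_X_pow_mul_wr_eq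
          ((Fin.snoc (α := fun _ => L[X]) u (X ^ m)) ∘ ρ)
          ((Fin.snoc (α := fun _ => ℕ) e m) ∘ ρ) fun i => by
            simp only [Function.comp]
            refine Fin.lastCases ?_ (fun j => ?_) (ρ i)
            · simp
            · simpa using (hu j).2.1
        have h1 : ∑ i, ((Fin.snoc (α := fun _ => ℕ) e m) ∘ ρ) i = (∑ j : Fin r, q j) + m := by
          rw [← hsume]
          refine (Equiv.sum_comp (Equiv.ofBijective ρ (Finite.injective_iff_bijective.1 hρ))
            (Fin.snoc (α := fun _ => ℕ) e m)).trans ?_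
          rw [Fin.sum_univ_castSucc]
          simp
        rw [h1] at hH
        exact ⟨H, hH⟩
      · refine Fin.lastCases ?_ (fun j => ?_) i
        · rw [Fin.snoc_last]
          exact Submodule.subset_span ⟨Fin.last r, by simp⟩
        · rw [Fin.snoc_castSucc]
          refine Submodule.span_mono ?_ (hvu j)
          rintro _ ⟨k, rfl⟩
          exact ⟨k.castSucc, by simp⟩
    obtain ⟨h1, h2⟩ := natDegree_X_pow_mul_wr_le_and_coeff
      (Fin.snoc (α := fun _ => L[X]) (fun j : Fin r => v j) (X ^ m))
      (Fin.snoc (α := fun _ => ℕ) (fun j : Fin r => q j) m) fun i => by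
        refine Fin.lastCases ?_ (fun j => ?_) i
        · simp
        · simpa using hdeg j j.2
    have hs : ∑ i, Fin.snoc (α := fun _ => ℕ) (fun j : Fin r => q j) m i =
        (∑ j : Fin r, q j) + m := by
      rw [Fin.sum_univ_castSucc]
      simp
    rw [hs] at h1 h2
    rw [Fin.prod_univ_castSucc] at h2
    simp only [Fin.snoc_castSucc, Fin.snoc_last] at h2
    refine ⟨fallingDet L (Fin.snoc (α := fun _ => ℕ) (fun j : Fin r => q j) m), fun hm => ?_, ?_⟩
    · refine (isUnit_fallingDet _ (Fin.snoc_injective_iff.2 ⟨hqinj, hm⟩)).ne_zero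
    · obtain ⟨g, hg⟩ := hdvd
      have hprod : ∏ j : Fin r, (v j).coeff (q j) = 1 :=
        Finset.prod_eq_one fun j _ => by rw [hpiv j j.2 j j.2, if_pos rfl]
      rw [hprod, coeff_X_pow, if_pos rfl, mul_one, mul_one] at h2
      rw [← h2]
      change X ^ _ * wrx v r (X ^ m) = C ((X ^ _ * wrx v r (X ^ m)).coeff _) * _
      change (X ^ _ * wrx v r (X ^ m)).natDegree ≤ _ at h1
      rw [hg] at h1 ⊢
      rcases eq_or_ne g 0 with rfl | hg0
      · simp
      · rw [natDegree_mul (pow_ne_zero _ X_ne_zero) hg0, natDegree_X_pow] at h1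
        have : g = C (g.coeff 0) := eq_C_of_natDegree_le_zero (by omega)
        rw [this, coeff_mul_C, coeff_X_pow, if_pos rfl, one_mul, mul_comm]
  choose χ hχ hχ' using hdiag
  -- Apply the operator to `v k`.
  have hz : ∑ m ∈ Finset.range (q k + 1),
      C ((v k).coeff m * χ m) * X ^ ((∑ j : Fin r, q j) + m) = (0 : L[X]) := by
    have h0 := wrx_of_lt v hk
    rw [as_sum_range_C_mul_X_pow' (v k) (Nat.lt_succ_of_le (hdeg k hk))] at h0
    have hsum : ∀ (s : Finset ℕ), wrx v r (∑ m ∈ s, C ((v k).coeff m) * X ^ m) =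
        ∑ m ∈ s, C ((v k).coeff m) * wrx v r (X ^ m) := by
      intro s
      induction s using Finset.induction_on with
      | empty => simpa using wrx_smul v r 0 0
      | insert a s ha ih => rw [Finset.sum_insert ha, Finset.sum_insert ha, wrx_add, wrx_smul, ih]
    rw [hsum] at h0
    have h1 := congrArg (X ^ (∑ j : Fin (r + 1), (j : ℕ)) * ·) h0
    simp only [mul_zero, Finset.mul_sum] at h1
    rw [← h1]
    refine Finset.sum_congr rfl fun m _ => ?_
    rw [mul_left_comm, hχ', C_mul, mul_assoc]
  by_cases hmq : q k < m
  · exact coeff_eq_zero_of_natDegree_lt ((hdeg k hk).trans_lt hmq)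
  by_cases hr : m ∈ Set.range fun j : Fin r => q j
  · obtain ⟨j, rfl⟩ := hr
    rw [hpiv k hk j j.2, if_neg]
    rintro rfl
    exact hm rfl
  have h1 := congrArg (fun p => p.coeff ((∑ j : Fin r, q j) + m)) hz
  simp only [finsetSum_coeff, coeff_C_mul, coeff_X_pow, coeff_zero, add_right_inj, mul_ite,
    mul_one, mul_zero, Finset.sum_ite_eq, Finset.mem_range] at h1
  rw [if_pos (by omega)] at h1
  exact (mul_eq_zero.1 h1).resolve_right (hχ m hr)

end Monomial

/-! ### Rigidity of spaces with constant Wronskian -/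

section Valuation

theorem wr_comp {R : Type*} [CommRing R] (μ : R) {k : ℕ} (u : Fin k → R[X]) :
    wr (fun i => (u i).comp (C μ * X)) =
      C (μ ^ ∑ j : Fin k, (j : ℕ)) * (wr u).comp (C μ * X) := by
  have hd : ∀ (j : ℕ) (p : R[X]), derivative^[j] (p.comp (C μ * X)) =
      C (μ ^ j) * (derivative^[j] p).comp (C μ * X) := by
    intro j
    induction j with
    | zero => simp
    | succ j ih =>
      intro p
      rw [Function.iterate_succ_apply, Function.iterate_succ_apply, derivative_comp,
        derivative_C_mul, derivative_X, mul_one, ← smul_eq_C_mul, iterate_derivative_smul, ih,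
        smul_eq_C_mul, ← mul_assoc, ← C_mul, pow_succ']
  have h1 : (wr u).comp (C μ * X) =
      (Matrix.of fun i j : Fin k => (derivative^[(j : ℕ)] (u i)).comp (C μ * X)).det := by
    unfold wr
    rw [← coe_compRingHom_apply, RingHom.map_det]
    rfl
  rw [h1, ← Finset.prod_pow_eq_pow_sum, map_prod, ← Matrix.det_mul_row, wr]
  simp only [hd]
  rfl

theorem wr_C_mul {R : Type*} [CommRing R] {k : ℕ} (a : Fin k → R) (u : Fin k → R[X]) :
    wr (fun i => C (a i) * u i) = C (∏ i, a i) * wr u := by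
  have := wr_linearCombination (Matrix.diagonal a) u
  rw [Matrix.det_diagonal] at this
  rw [← this]
  congr 1
  funext i
  rw [Finset.sum_eq_single i]
  · simp
  · intro j _ hj
    simp [Matrix.diagonal_apply_ne' _ hj]
  · simp

theorem isIntegrallyClosedIn_range {k F : Type*} [Field k] [IsAlgClosed k] [Field F] [Algebra k F] :
    IsIntegrallyClosedIn (algebraMap k F).range F := by
  rw [Subring.isIntegrallyClosedIn_iff]
  intro x hx
  have hint : IsIntegral k x := by
    obtain ⟨p, hp, hpx⟩ := hx
    have hlift : p ∈ lifts (algebraMap k F).rangeRestrict :=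
      (mem_lifts p).2 (Polynomial.map_surjective _ (algebraMap k F).rangeRestrict_surjective p)
    obtain ⟨q, hq, -, hqm⟩ := lifts_and_degree_eq_and_monic hlift hp
    refine ⟨q, hqm, ?_⟩
    rw [← hpx, ← hq, eval₂_map]
    rfl
  have h2 : (minpoly k x).degree = 1 := IsAlgClosed.degree_eq_one_of_irreducible k
    (minpoly.irreducible hint)
  exact minpoly.mem_range_of_degree_eq_one k x h2

/-- Finiteness of the Wronski map: if a space of polynomials over an algebraically closed extension
of `ℂ`, in echelon form with pivots `x^{q_k}`, has its Wronskian in `ℂ[x]`, then its echelon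
coordinates lie in `ℂ`. Otherwise one of them lies outside of some valuation ring containing `ℂ`;
a substitution `x ↦ μx` makes all of them integral, one of them equal to `1`, while the Wronskian
reduces to a monomial over the residue field. -/
theorem coeff_mem_range_of_wrs_eq {F : Type*} [Field F] [IsAlgClosed F] [Algebra ℂ F] {r : ℕ}
    (q : ℕ → ℕ) (v : ℕ → F[X])
    (hq : ∀ i < r, ∀ j < r, q i = q j → i = j) (hdeg : ∀ k < r, (v k).natDegree ≤ q k)
    (hpiv : ∀ k < r, ∀ j < r, (v k).coeff (q j) = if k = j then 1 else 0) {K : ℂ[X]}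
    (hK : K.Monic) {c : F} (hwr : wrs v r = C c * K.map (algebraMap ℂ F)) {k : ℕ} (hk : k < r)
    (m : ℕ) : (v k).coeff m ∈ (algebraMap ℂ F).range := by
  by_contra hnot
  have hm : m < q k := by
    by_contra hle
    refine hnot ?_
    rcases (not_lt.1 hle).lt_or_eq with hlt | rfl
    · rw [coeff_eq_zero_of_natDegree_lt ((hdeg k hk).trans_lt hlt)]
      exact zero_mem _
    · rw [hpiv k hk k hk, if_pos rfl]
      exact one_mem _
  have := isIntegrallyClosedIn_range (k := ℂ) (F := F)
  obtain ⟨O, hO, hmO⟩ := Subring.exists_le_valuationSubring_of_isIntegrallyClosedIn hnot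
  have hCO : ∀ a : ℂ, algebraMap ℂ F a ∈ O := fun a => hO ⟨a, rfl⟩
  have hroot : ∀ k m, ∃ ρ : F, m < q k → ρ ^ (q k - m) = (v k).coeff m := by
    intro k m
    by_cases hm : m < q k
    · obtain ⟨ρ, hρ⟩ := IsAlgClosed.exists_pow_nat_eq ((v k).coeff m)
        (show 0 < q k - m by omega)
      exact ⟨ρ, fun _ => hρ⟩
    · exact ⟨0, fun h => absurd h hm⟩
  choose ρ hρ using hroot
  obtain ⟨⟨k₀, m₀⟩, hkm₀, hmax⟩ := Finset.exists_max_image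
    ((Finset.range r).sigma fun k => Finset.range (q k)) (fun p => O.valuation (ρ p.1 p.2))
    ⟨⟨k, m⟩, by simp [hk, hm]⟩
  simp only [Finset.mem_sigma, Finset.mem_range] at hkm₀ hmax
  obtain ⟨hk₀, hm₀⟩ := hkm₀
  set μ := ρ k₀ m₀ with hμ
  have hval : 1 < O.valuation μ := by
    refine lt_of_lt_of_le ?_ (hmax ⟨k, m⟩ ⟨hk, hm⟩)
    by_contra hle
    refine hmO (O.valuation_le_one_iff _ |>.1 ?_)
    rw [← hρ k m hm, map_pow]
    exact pow_le_one' (not_lt.1 hle) _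
  have hμ0 : μ ≠ 0 := by
    intro h0
    rw [h0, map_zero] at hval
    exact not_lt_zero hval
  -- The rescaled polynomials have coefficients in the valuation ring.
  let v' : ℕ → F[X] := fun k => C (μ⁻¹ ^ q k) * (v k).comp (C μ * X)
  have hv'1 : ∀ k m, (v' k).coeff m = μ⁻¹ ^ q k * ((v k).coeff m * μ ^ m) := by
    intro k m
    rw [coeff_C_mul, comp_C_mul_X_coeff]
  have hv'2 : ∀ k < r, ∀ m < q k, (v' k).coeff m = (ρ k m / μ) ^ (q k - m) := by
    intro k _ m hm
    rw [hv'1, div_pow, hρ k m hm, inv_pow]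
    have : μ ^ q k = μ ^ (q k - m) * μ ^ m := by rw [← pow_add]; congr 1; omega
    rw [this]
    field_simp
  have hv'deg : ∀ k < r, (v' k).natDegree ≤ q k := by
    intro k hk
    rw [natDegree_le_iff_coeff_eq_zero]
    intro m hm
    rw [hv'1, coeff_eq_zero_of_natDegree_lt ((hdeg k hk).trans_lt hm)]
    simp
  have hv'piv : ∀ k < r, ∀ j < r, (v' k).coeff (q j) = if k = j then 1 else 0 := by
    intro k hk j hj
    rw [hv'1, hpiv k hk j hj]
    split_ifs with h
    · subst h
      rw [one_mul, ← mul_pow, inv_mul_cancel₀ hμ0, one_pow]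
    · simp
  have hv'O : ∀ k < r, ∀ m, (v' k).coeff m ∈ O := by
    intro k hk m
    rcases lt_trichotomy m (q k) with hlt | rfl | hlt
    · rw [hv'2 k hk m hlt]
      refine pow_mem (O.valuation_le_one_iff _ |>.1 ?_) _
      rw [map_div₀]
      exact div_le_one_of_le₀ (hmax ⟨k, m⟩ ⟨hk, hlt⟩) zero_le
    · rw [hv'piv k hk k hk, if_pos rfl]
      exact O.one_mem
    · rw [coeff_eq_zero_of_natDegree_lt ((hv'deg k hk).trans_lt hlt)]
      exact O.zero_mem
  -- The rescaled Wronskian.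
  set D := K.natDegree with hD
  let K' : F[X] := C (μ⁻¹ ^ D) * (K.map (algebraMap ℂ F)).comp (C μ * X)
  have hK'1 : ∀ m, K'.coeff m = μ⁻¹ ^ D * (algebraMap ℂ F (K.coeff m) * μ ^ m) := by
    intro m
    rw [coeff_C_mul, comp_C_mul_X_coeff, coeff_map]
  have hK'D : K'.coeff D = 1 := by
    rw [hK'1, hK.coeff_natDegree, map_one, one_mul, ← mul_pow, inv_mul_cancel₀ hμ0, one_pow]
  have hK'gt : ∀ m, D < m → K'.coeff m = 0 := by
    intro m hm
    rw [hK'1, coeff_eq_zero_of_natDegree_lt hm]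
    simp
  have hK'lt : ∀ m, m < D → O.valuation (K'.coeff m) < 1 := by
    intro m hm
    have h1 : K'.coeff m = algebraMap ℂ F (K.coeff m) * (μ⁻¹) ^ (D - m) := by
      rw [hK'1]
      have : μ⁻¹ ^ D = μ⁻¹ ^ (D - m) * μ⁻¹ ^ m := by rw [← pow_add]; congr 1; omega
      have h2 : μ⁻¹ ^ m * μ ^ m = 1 := by rw [← mul_pow, inv_mul_cancel₀ hμ0, one_pow]
      rw [this]
      linear_combination (algebraMap ℂ F (K.coeff m) * μ⁻¹ ^ (D - m)) * h2
    rw [h1, map_mul, map_pow, map_inv₀]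
    exact mul_lt_one_of_nonneg_of_lt_one_right (O.valuation_le_one_iff _ |>.2 (hCO _)) zero_le
      (pow_lt_one₀ zero_le (inv_lt_one_of_one_lt₀ hval) (by omega))
  obtain ⟨c', hc'⟩ : ∃ c', wrs v' r = C c' * K' := by
    refine ⟨(∏ i : Fin r, μ⁻¹ ^ q i) * μ ^ (∑ j : Fin r, (j : ℕ)) * c * μ ^ D, ?_⟩
    have h1 : wrs v' r = C (∏ i : Fin r, μ⁻¹ ^ q i) *
        (C (μ ^ ∑ j : Fin r, (j : ℕ)) * (wrs v r).comp (C μ * X)) := by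
      rw [wrs, wrs, ← wr_comp, ← wr_C_mul]
    have h2 : C (μ ^ D) * C (μ⁻¹ ^ D) = (1 : F[X]) := by
      rw [← C_mul, ← mul_pow, mul_inv_cancel₀ hμ0, one_pow, C_1]
    rw [h1, hwr, mul_comp, C_comp]
    simp only [K', C_mul]
    linear_combination (-(C (∏ i : Fin r, μ⁻¹ ^ q i) * C (μ ^ ∑ j : Fin r, (j : ℕ)) * C c *
      (K.map (algebraMap ℂ F)).comp (C μ * X))) * h2
  have hc'C : c' = algebraMap ℂ F (fallingDet ℂ fun j : Fin r => q j) := by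
    obtain ⟨h1, h2⟩ := natDegree_X_pow_mul_wr_le_and_coeff (fun j : Fin r => v' j)
      (fun j => q j) fun j => hv'deg j j.2
    have hprod : ∏ j : Fin r, (v' j).coeff (q j) = 1 :=
      Finset.prod_eq_one fun j _ => by rw [hv'piv j j.2 j j.2, if_pos rfl]
    have hfall : fallingDet F (fun j : Fin r => q j) =
        algebraMap ℂ F (fallingDet ℂ fun j : Fin r => q j) := by
      unfold fallingDet
      rw [RingHom.map_det]
      congr 1
      ext i j
      simp
    have hne : fallingDet F (fun j : Fin r => q j) ≠ 0 := (isUnit_fallingDet _ fun i j h =>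
      Fin.ext (hq i i.2 j j.2 h)).ne_zero
    rw [hprod, mul_one] at h2
    change (X ^ _ * wrs v' r).coeff _ = _ at h2
    change (X ^ _ * wrs v' r).natDegree ≤ _ at h1
    have hc'0 : c' ≠ 0 := by
      rintro rfl
      rw [hc'] at h2
      simp only [C_0, zero_mul, mul_zero, coeff_zero] at h2
      exact hne h2.symm
    have e1 : ∀ m, (X ^ (∑ j : Fin r, (j : ℕ)) * wrs v' r).coeff ((∑ j : Fin r, (j : ℕ)) + m) =
        c' * K'.coeff m := by
      intro m
      rw [add_comm, coeff_X_pow_mul, hc', coeff_C_mul]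
    have h3 : (∑ j : Fin r, (j : ℕ)) + D ≤ ∑ j : Fin r, q j := by
      refine le_trans (le_natDegree_of_ne_zero ?_) h1
      rw [e1, hK'D, mul_one]
      exact hc'0
    obtain ⟨m, hm⟩ := Nat.exists_eq_add_of_le ((Nat.le_add_right _ D).trans h3)
    rw [hm, e1] at h2
    have h4 : m = D := by
      by_contra hmD
      rw [hK'gt m (by omega), mul_zero] at h2
      exact hne h2.symm
    rw [h4, hK'D, mul_one] at h2
    rw [h2, hfall]
  -- Reduction to the residue field.
  have hlift : ∀ k, ∃ w : O[X], k < r → w.map O.subtype = v' k := by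
    intro k
    by_cases hk : k < r
    · obtain ⟨w, hw⟩ := (mem_lifts (f := O.subtype) (v' k)).1
        ((lifts_iff_coeff_lifts _).2 fun m => ⟨⟨_, hv'O k hk m⟩, rfl⟩)
      exact ⟨w, fun _ => hw⟩
    · exact ⟨0, fun h => absurd h hk⟩
  choose w hw using hlift
  obtain ⟨K'', hK''⟩ := (mem_lifts (f := O.subtype) K').1 ((lifts_iff_coeff_lifts _).2 fun m => by
    rcases lt_trichotomy m D with hlt | rfl | hlt
    · exact ⟨⟨_, O.valuation_le_one_iff _ |>.1 (hK'lt m hlt).le⟩, rfl⟩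
    · exact ⟨1, by rw [hK'D, map_one]⟩
    · exact ⟨0, by rw [hK'gt m hlt, map_zero]⟩)
  let ι : ℂ →+* O := (algebraMap ℂ F).codRestrict O.toSubring hCO
  let res := IsLocalRing.residue O
  let _ : Algebra ℂ (IsLocalRing.ResidueField O) := (res.comp ι).toAlgebra
  have hwcoeff : ∀ k < r, ∀ m, ((w k).coeff m : F) = (v' k).coeff m := by
    intro k hk m
    rw [← hw k hk, coeff_map]
    rfl
  have hwrw : wrs w r = C (ι (fallingDet ℂ fun j : Fin r => q j)) * K'' := by
    refine Polynomial.map_injective O.subtype O.subtype_injective ?_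
    rw [← wrs_map, Polynomial.map_mul, hK'', map_C]
    have h1 : wrs (fun j => (w j).map O.subtype) r = wrs v' r := by
      unfold wrs
      congr 1
      funext j
      exact hw j j.2
    rw [h1, hc', hc'C]
    rfl
  have hKres : K''.map res = X ^ D := by
    ext m
    have h1 : (K''.coeff m : F) = K'.coeff m := by rw [← hK'', coeff_map]; rfl
    rw [coeff_map, coeff_X_pow]
    split_ifs with h
    · have : K''.coeff m = 1 := Subtype.ext (by rw [h1, h, hK'D]; rfl)
      rw [this, map_one]
    · rcases lt_or_gt_of_ne h with hlt | hlt
      · refine (IsLocalRing.residue_eq_zero_iff _).2 ((O.valuation_lt_one_iff _).2 ?_)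
        rw [h1]
        exact hK'lt m hlt
      · have : K''.coeff m = 0 := Subtype.ext (by rw [h1, hK'gt m hlt]; rfl)
        rw [this, map_zero]
  have hfin := eq_X_pow_of_wrs_eq (D := D) q (fun k => (w k).map res) hq
    (fun k hk => natDegree_map_le.trans (by
      rw [natDegree_le_iff_coeff_eq_zero]
      intro m hm
      refine Subtype.ext ((hwcoeff k hk m).trans ?_)
      exact coeff_eq_zero_of_natDegree_lt ((hv'deg k hk).trans_lt hm)))
    (fun k hk j hj => by
      have : (w k).coeff (q j) = if k = j then 1 else 0 := by
        refine Subtype.ext ((hwcoeff k hk (q j)).trans ?_)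
        rw [hv'piv k hk j hj]
        split_ifs <;> rfl
      rw [coeff_map, this]
      split_ifs <;> simp)
    (c := res (ι (fallingDet ℂ fun j : Fin r => q j)))
    (by rw [wrs_map, hwrw, Polynomial.map_mul, map_C, hKres]) hk₀ hm₀.ne
  rw [coeff_map] at hfin
  have h1 : (w k₀).coeff m₀ = 1 := by
    refine Subtype.ext ((hwcoeff k₀ hk₀ m₀).trans ?_)
    rw [hv'2 k₀ hk₀ m₀ hm₀, div_self hμ0, one_pow]
    rfl
  rw [h1, map_one] at hfin
  exact one_ne_zero hfin

end Valuation

/-! ### Local rings of points of affine schemes over the complex numbers -/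

/-- The local ring, at the prime ideal `o`, of the closed subscheme of `Spec A` with ideal `I`. -/
abbrev LocQuot {A : Type*} [CommRing A] (o : Ideal A) [o.IsPrime] (I : Ideal A) : Type _ :=
  Localization.AtPrime o ⧸ I.map (algebraMap A (Localization.AtPrime o))

section LocQuot

variable {A : Type*} [CommRing A] {o : Ideal A} [o.IsPrime] {I : Ideal A}

theorem LocQuot.exists_mul_eq (x : LocQuot o I) :
    ∃ a y, y ∉ o ∧ x * algebraMap A (LocQuot o I) y = algebraMap A (LocQuot o I) a := by
  obtain ⟨x, rfl⟩ := Ideal.Quotient.mk_surjective x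
  obtain ⟨⟨a, y⟩, h⟩ := IsLocalization.surj o.primeCompl x
  exact ⟨a, y, y.2, (congrArg (Ideal.Quotient.mk (I.map (algebraMap A (Localization.AtPrime o)))) h :)⟩

theorem LocQuot.isUnit_algebraMap {a : A} (ha : a ∉ o) : IsUnit (algebraMap A (LocQuot o I) a) :=
  (IsLocalization.map_units (Localization.AtPrime o) (⟨a, ha⟩ : o.primeCompl)).map
    (Ideal.Quotient.mk _)

variable [Algebra ℂ A]

theorem LocQuot.exists_lift {R : Type*} [CommRing R] [Algebra ℂ R] (f : A →ₐ[ℂ] R)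
    (hu : ∀ a ∉ o, IsUnit (f a)) (hI : ∀ a ∈ I, f a = 0) :
    ∃ g : LocQuot o I →ₐ[ℂ] R, ∀ a, g (algebraMap A (LocQuot o I) a) = f a := by
  let g₀ : Localization.AtPrime o →ₐ[ℂ] R :=
    IsLocalization.liftAlgHom (M := o.primeCompl) (f := f) fun y => hu y y.2
  have hg₀ : ∀ a, g₀ (algebraMap A _ a) = f a := fun a => IsLocalization.lift_eq _ a
  refine ⟨Ideal.Quotient.liftₐ _ g₀ fun x hx => ?_, hg₀⟩
  have : I.map (algebraMap A (Localization.AtPrime o)) ≤ RingHom.ker g₀ :=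
    Ideal.map_le_iff_le_comap.2 fun a ha => (hg₀ a).trans (hI a ha)
  exact this hx

theorem LocQuot.algHom_ext {R : Type*} [CommRing R] [Algebra ℂ R] {f g : LocQuot o I →ₐ[ℂ] R}
    (h : ∀ a, f (algebraMap A _ a) = g (algebraMap A _ a)) : f = g := by
  refine AlgHom.ext fun x => ?_
  obtain ⟨a, y, hy, hx⟩ := LocQuot.exists_mul_eq x
  refine ((LocQuot.isUnit_algebraMap (I := I) hy).map f).mul_right_cancel ?_
  conv_rhs => rw [h, ← map_mul, hx]
  rw [← map_mul, hx, h]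

/-- The residue map of a closed point, given by the corresponding `ρ : A → ℂ`. -/
theorem LocQuot.exists_augmentation (ρ : A →ₐ[ℂ] ℂ) (ho : ∀ a, a ∈ o ↔ ρ a = 0) (hI : I ≤ o) :
    ∃ π : LocQuot o I →ₐ[ℂ] ℂ, (∀ a, π (algebraMap A _ a) = ρ a) ∧
      ∀ x, π x ≠ 0 → IsUnit x := by
  obtain ⟨π, hπ⟩ := LocQuot.exists_lift (o := o) (I := I) ρ
    (fun a ha => isUnit_iff_ne_zero.2 fun h => ha ((ho a).2 h)) fun a ha => (ho a).1 (hI ha)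
  refine ⟨π, hπ, fun x hx => ?_⟩
  obtain ⟨a, y, hy, hxy⟩ := LocQuot.exists_mul_eq x
  have h1 := congrArg π hxy
  rw [map_mul, hπ, hπ] at h1
  have ha : a ∉ o := fun h => mul_ne_zero hx (fun h => hy ((ho y).2 h)) (h1.trans ((ho a).1 h))
  have h2 := LocQuot.isUnit_algebraMap (I := I) ha
  rw [← hxy] at h2
  exact isUnit_of_mul_isUnit_left h2

theorem mem_span_of_aeval {σ R : Type*} [CommRing R] [Algebra ℂ R] (c : σ → R)
    (f : MvPolynomial σ ℂ) (hf : MvPolynomial.aeval (0 : σ → ℂ) f = 0) :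
    MvPolynomial.aeval c f ∈ Ideal.span (Set.range c) := by
  rw [← Ideal.Quotient.eq_zero_iff_mem]
  have h1 := MvPolynomial.comp_aeval_apply (f := c) (Ideal.Quotient.mkₐ ℂ (Ideal.span (Set.range c))) f
  refine h1.trans ?_
  have h2 : (fun i => Ideal.Quotient.mkₐ ℂ (Ideal.span (Set.range c)) (c i)) =
      fun i => Algebra.ofId ℂ (R ⧸ Ideal.span (Set.range c)) ((0 : σ → ℂ) i) := by
    funext i
    rw [Pi.zero_apply, map_zero]
    exact Ideal.Quotient.eq_zero_iff_mem.2 (Ideal.subset_span ⟨i, rfl⟩)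
  rw [h2, ← MvPolynomial.comp_aeval_apply, hf, map_zero]

end LocQuot

namespace BasicSituation

variable {N d n : ℕ} {S : BasicSituation N d n}
variable (b : Module.Basis (Fin (N + 1) ⊕ Fin (d - N)) ℂ (polySpace d))

/-! ### The multiplicity of `Ω` is finite -/

theorem mem_span_cv {R : Type*} [CommRing R] [Algebra ℂ R] {c : Fin (N + 1) × Fin (d - N) → R}
    {P : Matrix (Fin (N + 1)) (Fin (N + 1)) R} (hP : IsUnit P.det) (i : Fin (N + 1)) :
    cv b c i = ∑ k, C (P⁻¹ i k) * ∑ i, C (P k i) * cv b c i := by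
  simp only [Finset.mul_sum]
  rw [Finset.sum_comm]
  simp only [← mul_assoc, ← C_mul, ← Finset.sum_mul, ← map_sum]
  have := Matrix.nonsing_inv_mul P hP
  simp only [← Matrix.mul_apply, this, Matrix.one_apply]
  simp

/-- A point of `Ω` with values in an algebraically closed field, in the same big cell at infinity
as a complex point, is a complex point. -/
theorem coord_mem_range {F : Type*} [Field F] [IsAlgClosed F] [Algebra ℂ F]
    {c : Fin (N + 1) × Fin (d - N) → F} {P : Matrix (Fin (N + 1)) (Fin (N + 1)) F}
    (hP : IsUnit P.det) (hlow : ∀ k : Fin (N + 1),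
      S.Low none (S.piv none k) (∑ i, C (P k i) * cv b c i))
    (hpiv : ∀ k j : Fin (N + 1), S.fc F none (S.piv none j) (∑ i, C (P k i) * cv b c i) =
      if k = j then 1 else 0) (hc : ∀ s, S.Adapted b (some s) c)
    (p : Fin (N + 1) × Fin (d - N)) : c p ∈ (algebraMap ℂ F).range := by
  set v : Fin (N + 1) → F[X] := fun k => ∑ i, C (P k i) * cv b c i with hv
  let v' : ℕ → F[X] := fun k => if hk : k < N + 1 then v ⟨k, hk⟩ else 0
  have hv' : ∀ k : Fin (N + 1), v' k = v k := fun k => dif_pos k.2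
  have hwrs : wrs v' (N + 1) = wr v := by
    unfold wrs
    congr 1
    exact funext hv'
  have hspan : ∀ k, v k ∈ Submodule.span F (Set.range (cv b c)) := fun k =>
    Submodule.sum_mem _ fun i _ => by
      rw [← smul_eq_C_mul]
      exact Submodule.smul_mem _ _ (Submodule.subset_span ⟨i, rfl⟩)
  choose Q hQ hQlow using hc
  have hdvd : (S.K (N + 1)).map (algebraMap ℂ F) ∣ wr v := by
    refine K_map_dvd_wr (fun s k => ∑ i, C (Q s k i) * cv b c i) (fun s k => hQlow s k) le_rfl v
      fun s k => Submodule.span_le.2 ?_ (hspan k)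
    rintro _ ⟨i, rfl⟩
    rw [mem_span_cv b (hQ s)]
    exact Submodule.sum_mem _ fun i _ => by
      rw [← smul_eq_C_mul]
      exact Submodule.smul_mem _ _ (Submodule.subset_span ⟨i, rfl⟩)
  obtain ⟨g, hg⟩ := hdvd
  have hg' : g = C (g.coeff 0) := by
    refine eq_C_of_natDegree_le_zero ?_
    have h1 := S.natDegree_wr_le v hlow le_rfl v fun j => Submodule.subset_span ⟨j, rfl⟩
    rw [wdeg_last] at h1
    by_contra hlt
    refine hlt ((natDegree_le_iff_coeff_eq_zero (p := g)).2 fun m hm => ?_)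
    by_contra hne
    have hg0 : g ≠ 0 := fun h0 => hne (by rw [h0, coeff_zero])
    have hKm : ((S.K (N + 1)).map (algebraMap ℂ F)).Monic := (S.K_monic _).map _
    have h2 := h1 (wr v).natDegree (by
      rw [hg, hKm.natDegree_mul' hg0, (S.K_monic _).natDegree_map]
      have := le_natDegree_of_ne_zero hne
      push_cast
      omega)
    rw [coeff_natDegree, leadingCoeff_eq_zero, hg] at h2
    exact mul_ne_zero hKm.ne_zero hg0 h2
  have hcoeff : ∀ k m, (v k).coeff m ∈ (algebraMap ℂ F).range := by
    intro k m
    rw [← hv']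
    refine coeff_mem_range_of_wrs_eq (r := N + 1) (fun k => S.piv none k) v'
      (fun i hi j hj h => S.piv_injective none (by omega) (by omega) h) (fun k hk => ?_)
      (fun k hk j hj => ?_) (S.K_monic (N + 1)) (c := g.coeff 0) ?_ k.2 m
    · rw [show v' k = v ⟨k, hk⟩ from dif_pos hk]
      exact (S.low_iff_natDegree (S.piv_le _ _) _).1 (hlow ⟨k, hk⟩)
    · rw [show v' k = v ⟨k, hk⟩ from dif_pos hk]
      exact (hpiv ⟨k, hk⟩ ⟨j, hj⟩).trans (by simp [Fin.ext_iff])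
    · rw [hwrs, hg, mul_comm, ← hg']
  have hbco : ∀ k x, bco F b x (v k) ∈ (algebraMap ℂ F).range := by
    intro k x
    simp only [bco, LinearMap.sum_apply, LinearMap.smul_apply, lcoeff_apply, smul_eq_mul]
    exact sum_mem fun m _ => mul_mem ⟨_, rfl⟩ (hcoeff k m)
  -- The coordinates solve a linear system with coefficients in `ℂ`.
  have hPC : ∀ k i, P k i ∈ (algebraMap ℂ F).range := by
    intro k i
    rw [← bco_inl_sum_cv b c (P k) i]
    exact hbco k _
  choose P₀ hP₀ using hPC
  have hPP : (Matrix.of P₀).map (algebraMap ℂ F) = P := by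
    ext k i
    exact hP₀ k i
  have hdet : IsUnit (Matrix.of P₀).det := by
    refine isUnit_iff_ne_zero.2 fun h0 => hP.ne_zero ?_
    have h2 : ((Matrix.of P₀).map (algebraMap ℂ F)).det = algebraMap ℂ F (Matrix.of P₀).det :=
      ((algebraMap ℂ F).map_det (Matrix.of P₀)).symm
    rw [← hPP, h2, h0, map_zero]
  obtain ⟨i, j⟩ := p
  have h1 : c (i, j) = ∑ k, algebraMap ℂ F ((Matrix.of P₀)⁻¹ i k) * ∑ i, P k i * c (i, j) := by
    simp only [← hP₀, Finset.mul_sum]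
    rw [Finset.sum_comm]
    simp only [← mul_assoc, ← map_mul, ← Finset.sum_mul, ← map_sum]
    have := Matrix.nonsing_inv_mul (Matrix.of P₀) hdet
    have h2 : ∀ x, ∑ k, (Matrix.of P₀)⁻¹ i k * P₀ k x = if i = x then 1 else 0 := by
      intro x
      have := congrFun (congrFun this i) x
      rwa [Matrix.mul_apply, Matrix.one_apply] at this
    simp [h2]
  rw [h1]
  refine sum_mem fun k _ => mul_mem ⟨_, rfl⟩ ?_
  rw [← bco_inr_sum_cv b c (P k) j]
  exact hbco k _

/-- A prime ideal is the kernel of a homomorphism to an algebraically closed field; the statement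
records only the inclusion which is used. -/
theorem exists_algHom_isAlgClosed.{u} {R : Type u} [CommRing R] [Algebra ℂ R] (p : Ideal R)
    [p.IsPrime] : ∃ (F : Type u) (_ : Field F) (_ : IsAlgClosed F) (_ : Algebra ℂ F)
      (f : R →ₐ[ℂ] F), ∀ a, f a = 0 → a ∈ p := by
  let κ := FractionRing (R ⧸ p)
  let F := AlgebraicClosure κ
  let g : R →+* F := (algebraMap κ F).comp
    ((algebraMap (R ⧸ p) κ).comp (Ideal.Quotient.mk p))
  refine ⟨F, inferInstance, inferInstance, (g.comp (algebraMap ℂ R)).toAlgebra,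
    @AlgHom.mk _ _ _ _ _ _ _ (_) g fun _ => rfl, fun a ha => ?_⟩
  have h1 : algebraMap κ F (algebraMap (R ⧸ p) κ (Ideal.Quotient.mk p a)) = 0 := ha
  refine Ideal.Quotient.eq_zero_iff_mem.1 (IsFractionRing.injective (R ⧸ p) κ ?_)
  rw [map_zero]
  exact (algebraMap κ F).injective (h1.trans (map_zero _).symm)

/-- The chart coordinates of a point of `Ω` with values in a Noetherian local ring are nilpotent if
they vanish at the closed point: over the residue field of any prime ideal they are complex numbers,
by `coord_mem_range`, and a nonzero complex number minus an element of the maximal ideal is a unit. -/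
theorem isNilpotent_span_range_of_adapted {R : Type*} [CommRing R] [Algebra ℂ R]
    [IsNoetherianRing R] (π : R →ₐ[ℂ] ℂ) (hπ : ∀ a, π a ≠ 0 → IsUnit a)
    {c : Fin (N + 1) × Fin (d - N) → R} (hc0 : ∀ p, π (c p) = 0)
    {P : Matrix (Fin (N + 1)) (Fin (N + 1)) R}
    (hP : IsUnit P.det) (hlow : ∀ k : Fin (N + 1),
      S.Low none (S.piv none k) (∑ i, C (P k i) * cv b c i))
    (hpiv : ∀ k j : Fin (N + 1), S.fc R none (S.piv none j) (∑ i, C (P k i) * cv b c i) =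
      if k = j then 1 else 0) (hc : ∀ s, S.Adapted b (some s) c) :
    IsNilpotent (Ideal.span (Set.range c)) := by
  have hle : Ideal.span (Set.range c) ≤ nilradical R := by
    rw [Ideal.span_le]
    rintro _ ⟨x, rfl⟩
    rw [SetLike.mem_coe, nilradical_eq_sInf, Ideal.mem_sInf]
    intro p hp
    have hp : p.IsPrime := hp
    obtain ⟨F, _, _, _, f, hf⟩ := exists_algHom_isAlgClosed p
    have hmap : ∀ k, (∑ i, C (P k i) * cv b c i).map (f : _ →+* F) =
        ∑ i, C (P.map f k i) * cv b (fun p => f (c p)) i := by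
      intro k
      simp [Polynomial.map_sum, cv_map]
    obtain ⟨α, hα⟩ := coord_mem_range (S := S) b (c := fun p => f (c p))
      (P := P.map f)
      (by
        have : (P.map f).det = f P.det := (f.map_det P).symm
        rw [this]; exact hP.map f)
      (fun k => by rw [← hmap]; exact (hlow k).map S f)
      (fun k j => by
        rw [← hmap, fc_map, hpiv k j]
        split_ifs <;> simp)
      (fun s => (hc s).map b f) x
    have h1 : c x - algebraMap ℂ _ α ∈ p := by
      refine hf _ ?_
      rw [map_sub, AlgHom.commutes, hα, sub_self]
    rcases eq_or_ne α 0 with rfl | hα0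
    · simpa using h1
    · exact absurd (p.eq_top_of_isUnit_mem h1 (hπ _ (by
        rw [map_sub, hc0, AlgHom.commutes, zero_sub]
        exact neg_ne_zero.2 hα0))) hp.ne_top
  obtain ⟨k, hk⟩ := IsNoetherianRing.isNilpotent_nilradical R
  exact ⟨k, le_bot_iff.1 ((Ideal.pow_right_mono hle k).trans hk.le)⟩

variable (S) in
/-- The local ring of the scheme `Ω` at the origin of the chart attached to `b`. -/
abbrev OmegaRing : Type :=
  LocQuot (MvPolynomial.pointToPoint (0 : Fin (N + 1) × Fin (d - N) → ℂ)).asIdeal (S.omegaIdeal b)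

variable (S) in
/-- The chart coordinates, as elements of the local ring of `Ω`. -/
def omegaCoord (p : Fin (N + 1) × Fin (d - N)) : S.OmegaRing b :=
  algebraMap (MvPolynomial (Fin (N + 1) × Fin (d - N)) ℂ) _ (MvPolynomial.X p)

theorem aeval_omegaCoord (f : MvPolynomial (Fin (N + 1) × Fin (d - N)) ℂ) :
    MvPolynomial.aeval (S.omegaCoord b) f = algebraMap _ (S.OmegaRing b) f := by
  have : (MvPolynomial.aeval (S.omegaCoord b) : _ →ₐ[ℂ] S.OmegaRing b) =
      IsScalarTower.toAlgHom ℂ _ (S.OmegaRing b) :=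
    MvPolynomial.algHom_ext fun v => by simp [omegaCoord]
  exact DFunLike.congr_fun this f

theorem mem_pointToPoint_zero (f : MvPolynomial (Fin (N + 1) × Fin (d - N)) ℂ) :
    f ∈ (MvPolynomial.pointToPoint (0 : Fin (N + 1) × Fin (d - N) → ℂ)).asIdeal ↔
      MvPolynomial.aeval (0 : Fin (N + 1) × Fin (d - N) → ℂ) f = 0 :=
  MvPolynomial.mem_vanishingIdeal_singleton_iff _ _

variable {b}

/-- The residue map of the local ring of `Ω`, whose kernel is generated by the chart coordinates. -/
theorem exists_omega_augmentation (h0 : ∀ s, chartPoint b 0 ∈ S.cell s) :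
    ∃ π : S.OmegaRing b →ₐ[ℂ] ℂ, (∀ p, π (S.omegaCoord b p) = 0) ∧
      (∀ x, π x ≠ 0 → IsUnit x) ∧
      ∀ x, π x = 0 → x ∈ Ideal.span (Set.range (S.omegaCoord b)) := by
  obtain ⟨π, h1, h2⟩ := LocQuot.exists_augmentation (I := S.omegaIdeal b)
    (MvPolynomial.aeval (0 : Fin (N + 1) × Fin (d - N) → ℂ)) mem_pointToPoint_zero (by
      refine iSup_le fun s => ?_
      exact MvPolynomial.vanishingIdeal_anti_mono (Set.singleton_subset_iff.2 (h0 s)))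
  refine ⟨π, fun p => ?_, h2, fun x hx => ?_⟩
  · rw [omegaCoord, h1]
    simp
  · obtain ⟨a, y, hy, hxy⟩ := LocQuot.exists_mul_eq x
    have h3 : x * algebraMap _ (S.OmegaRing b) y ∈ Ideal.span (Set.range (S.omegaCoord b)) := by
      rw [hxy, ← aeval_omegaCoord]
      refine mem_span_of_aeval _ _ ?_
      rw [← h1, ← hxy, map_mul, hx, zero_mul]
    exact (Ideal.mul_unit_mem_iff_mem _ (LocQuot.isUnit_algebraMap hy)).1 h3

/-- The universal space over the local ring of `Ω` has reduced echelon bases for all flags. -/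
theorem exists_reduced_omegaCoord (h0 : ∀ s, chartPoint b 0 ∈ S.cell s) (s : Option (Fin n)) :
    ∃ P : Matrix (Fin (N + 1)) (Fin (N + 1)) (S.OmegaRing b), IsUnit P.det ∧
      ∀ k : Fin (N + 1), S.Low s (S.piv s k) (∑ i, C (P k i) * cv b (S.omegaCoord b) i) ∧
        ∀ j : Fin (N + 1), S.fc _ s (S.piv s j) (∑ i, C (P k i) * cv b (S.omegaCoord b) i) =
          if k = j then 1 else 0 := by
  obtain ⟨π, hπ1, hπ2, -⟩ := exists_omega_augmentation h0
  refine exists_reduced_of_aeval_eq_zero b π hπ2 hπ1 (h0 s) fun f hf => ?_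
  rw [aeval_omegaCoord]
  refine Ideal.Quotient.eq_zero_iff_mem.2 (Ideal.mem_map_of_mem _ ?_)
  exact le_iSup (fun s => MvPolynomial.vanishingIdeal ℂ {c | chartPoint b c ∈ S.cell s}) s hf

/-- The local ring of `Ω` is Artinian. -/
theorem isNilpotent_span_omegaCoord (h0 : ∀ s, chartPoint b 0 ∈ S.cell s) :
    IsNilpotent (Ideal.span (Set.range (S.omegaCoord b))) := by
  obtain ⟨π, hπ1, hπ2, -⟩ := exists_omega_augmentation h0
  obtain ⟨P, hP, hlow⟩ := exists_reduced_omegaCoord h0 none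
  refine isNilpotent_span_range_of_adapted b π hπ2 hπ1 hP (fun k => (hlow k).1)
    (fun k => (hlow k).2) fun s => ?_
  obtain ⟨Q, hQ, hQlow⟩ := exists_reduced_omegaCoord h0 (some s)
  exact ⟨Q, hQ, fun k => (hQlow k).1⟩

end BasicSituation

namespace BasicSituation

/-! ### From flags of polynomials to the divisibility conditions -/

section

variable {R : Type*} [CommRing R]

theorem wronskian_mul_mul (K y g : R[X]) :
    wronskian (K * y) (K * g) = K ^ 2 * wronskian y g := by
  simp only [wronskian, derivative_mul]
  ring

/-- The divisibility condition expresses the solvability of `Wr(y, g) = q`. -/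
theorem dvd_wronskian_derivative_wronskian (y g : R[X]) :
    y ∣ wronskian (derivative y) (wronskian y g) := by
  refine ⟨derivative y * derivative (derivative g) - derivative (derivative y) * derivative g, ?_⟩
  simp only [wronskian, derivative_sub, derivative_mul]
  ring

end

variable {N d n : ℕ} {S : BasicSituation N d n}
variable {R : Type*} [CommRing R] [Algebra ℂ R]

/-- If the Wronskians of a flag of polynomials in a space satisfying the Schubert conditions at the
finite points are `K_i y_i` up to units, then the `y_i` satisfy the divisibility conditions. -/
theorem dvd_wronskian_of_wrs_eq (η : ℕ → R[X]) (v : Fin n → Fin (N + 1) → R[X])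
    (hv : ∀ s (j : Fin (N + 1)), S.Low (some s) (S.piv (some s) j) (v s j))
    (hη : ∀ s, ∀ j ≤ N, η j ∈ Submodule.span R (Set.range (v s))) (y : ℕ → R[X]) (a : ℕ → Rˣ)
    (hwr : ∀ i ≤ N + 1, wrs η i = C (a i : R) * ((S.K i).map (algebraMap ℂ R) * y i))
    {i : ℕ} (h1 : 1 ≤ i) (hi : i ≤ N) :
    y i ∣ wronskian (derivative (y i))
      ((S.T i).map (algebraMap ℂ R) * y (i - 1) * y (i + 1)) := by
  obtain ⟨i, rfl⟩ : ∃ j, i = j + 1 := ⟨i - 1, by omega⟩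
  obtain ⟨g, hg⟩ : (S.K (i + 1)).map (algebraMap ℂ R) ∣ wrx η i (η (i + 1)) := by
    refine K_map_dvd_wr v hv (by omega) _ fun s j => ?_
    refine Fin.lastCases ?_ (fun j => ?_) j
    · rw [Fin.snoc_last]
      exact hη s _ hi
    · rw [Fin.snoc_castSucc]
      exact hη s _ (by omega)
  have h2 := wronskian_wrs_succ_wrx η i (η (i + 1))
  rw [← wrs_succ, hg, hwr (i + 1) (by omega), hwr i (by omega), hwr (i + 1 + 1) (by omega)] at h2
  have hKT := congrArg (Polynomial.map (algebraMap ℂ R)) (S.K_sq_mul_T (i + 1) h1 hi)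
  simp only [Polynomial.map_mul, Polynomial.map_pow, Nat.add_sub_cancel] at hKT
  set K₁ := (S.K (i + 1)).map (algebraMap ℂ R) with hK₁
  have h3 : K₁ ^ 2 * (C (a (i + 1) : R) * wronskian (y (i + 1)) g) =
      K₁ ^ 2 * (C (a i : R) * C (a (i + 1 + 1) : R) *
        ((S.T (i + 1)).map (algebraMap ℂ R) * y i * y (i + 1 + 1))) := by
    have e1 : wronskian (C (a (i + 1) : R) * (K₁ * y (i + 1))) (K₁ * g) =
        C (a (i + 1) : R) * wronskian (K₁ * y (i + 1)) (K₁ * g) := by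
      simp only [wronskian, derivative_mul, derivative_C]
      ring
    rw [e1, wronskian_mul_mul] at h2
    linear_combination h2 - (C (a i : R) * C (a (i + 1 + 1) : R) * y i * y (i + 1 + 1)) * hKT
  -- The factor `K_{i+1}²` is cancelled; what remains is `T y y = Wr(y, g)` up to a unit.
  have h4 := (((S.K_monic (i + 1)).map (algebraMap ℂ R)).pow 2).isRegular.left h3
  have h5 : (S.T (i + 1)).map (algebraMap ℂ R) * y i * y (i + 1 + 1) =
      C ((↑((a i)⁻¹ * (a (i + 1 + 1))⁻¹ * a (i + 1)) : R)) * wronskian (y (i + 1)) g := by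
    have e1 : C (↑((a i)⁻¹) : R) * C (a i : R) = (1 : R[X]) := by
      rw [← C_mul, Units.inv_mul, C_1]
    have e2 : C (↑((a (i + 1 + 1))⁻¹) : R) * C (a (i + 1 + 1) : R) = (1 : R[X]) := by
      rw [← C_mul, Units.inv_mul, C_1]
    simp only [Units.val_mul, C_mul]
    linear_combination (-(C (↑((a i)⁻¹) : R) * C (↑((a (i + 1 + 1))⁻¹) : R))) * h4 -
      ((S.T (i + 1)).map (algebraMap ℂ R) * y i * y (i + 1 + 1)) *
      (C (↑((a (i + 1 + 1))⁻¹) : R) * C (a (i + 1 + 1) : R) * e1 + e2)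
  rw [Nat.add_sub_cancel, h5]
  have e3 : ∀ (c : R) (p q : R[X]), wronskian p (C c * q) = C c * wronskian p q := by
    intro c p q
    simp only [wronskian, derivative_mul, derivative_C]
    ring
  rw [e3]
  exact (dvd_wronskian_derivative_wronskian _ _).mul_left _

/-- The points of `R̃°` with values in `R`. -/
theorem exists_algHom_of_isUnit_discr (τ : S.Var → R)
    (hτ : IsUnit (MvPolynomial.aeval τ S.discr)) :
    ∃ f : S.RegFun →ₐ[ℂ] R, ∀ p, f (algebraMap (MvPolynomial S.Var ℂ) S.RegFun p) =
      MvPolynomial.aeval τ p := by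
  let f : S.RegFun →ₐ[ℂ] R :=
    IsLocalization.liftAlgHom (M := Submonoid.powers S.discr) (f := MvPolynomial.aeval τ) (by
      rintro ⟨_, k, rfl⟩
      rw [map_pow]
      exact hτ.pow k)
  exact ⟨f, fun p => IsLocalization.lift_eq _ p⟩

theorem univPoly_map (f : S.RegFun →ₐ[ℂ] R) (i : ℕ) :
    (S.univPoly i).map (f : S.RegFun →+* R) = S.polyAt (fun v => f (S.coord v)) i :=
  polyAt_map _ _ _

/-- The points of `Ã` with values in `R`. -/
theorem forall_divisibilityIdeal_eq_zero_iff (f : S.RegFun →ₐ[ℂ] R) :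
    (∀ a ∈ S.divisibilityIdeal, f a = 0) ↔ ∀ i, 1 ≤ i → i ≤ N →
      S.polyAt (fun v => f (S.coord v)) i ∣
        wronskian (derivative (S.polyAt (fun v => f (S.coord v)) i))
          ((S.T i).map (algebraMap ℂ R) * S.polyAt (fun v => f (S.coord v)) (i - 1) *
            S.polyAt (fun v => f (S.coord v)) (i + 1)) := by
  have hw : ∀ p q : S.RegFun[X], (wronskian p q).map (f : S.RegFun →+* R) =
      wronskian (p.map (f : S.RegFun →+* R)) (q.map (f : S.RegFun →+* R)) := by
    intro p q
    simp [wronskian, Polynomial.map_sub, derivative_map]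
  have hT : ∀ i, ((S.T i).map (algebraMap ℂ S.RegFun)).map (f : S.RegFun →+* R) =
      (S.T i).map (algebraMap ℂ R) := by
    intro i
    rw [Polynomial.map_map]
    congr 1
    exact f.comp_algebraMap
  have key : ∀ i : ℕ, (wronskian (derivative (S.univPoly (i + 1)))
      ((S.T (i + 1)).map (algebraMap ℂ S.RegFun) * S.univPoly i * S.univPoly (i + 2)) %ₘ
        S.univPoly (i + 1)).map (f : S.RegFun →+* R) = 0 ↔
      S.polyAt (fun v => f (S.coord v)) (i + 1) ∣
        wronskian (derivative (S.polyAt (fun v => f (S.coord v)) (i + 1)))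
          ((S.T (i + 1)).map (algebraMap ℂ R) * S.polyAt (fun v => f (S.coord v)) i *
            S.polyAt (fun v => f (S.coord v)) (i + 2)) := by
    intro i
    have hm : (S.univPoly (i + 1)).Monic := polyAt_monic _ _
    rw [map_modByMonic _ hm, modByMonic_eq_zero_iff_dvd (hm.map _), hw, ← derivative_map, Polynomial.map_mul, Polynomial.map_mul, hT,
      univPoly_map, univPoly_map, univPoly_map]
  constructor
  · intro h i h1 hi
    obtain ⟨i, rfl⟩ : ∃ j, i = j + 1 := ⟨i - 1, by omega⟩
    refine (key i).1 (Polynomial.ext fun k => ?_)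
    rw [coeff_map, coeff_zero]
    exact h _ (Ideal.subset_span ⟨⟨i, hi⟩, k, rfl⟩)
  · intro h
    have : S.divisibilityIdeal ≤ RingHom.ker f := by
      refine Ideal.span_le.2 ?_
      rintro _ ⟨i, k, rfl⟩
      have h1 := (key i).2 (h (i + 1) (by omega) i.2)
      have h2 := congrArg (fun p => p.coeff k) h1
      simp only [coeff_map, coeff_zero] at h2
      exact h2
    exact fun a ha => this ha

theorem Bases.exists_wrs_eq {V : Submodule ℂ ℂ[X]} {t : S.Var → ℂ}
    {u : Option (Fin n) → ℕ → ℂ[X]} (h : S.Bases V t u) : ∃ a : ℕ → ℂˣ, ∀ i ≤ N + 1,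
      wrs (u none) i = C (a i : ℂ) * (S.K i * S.polyAt t i) := by
  have ha : ∀ i, ∃ a : ℂˣ, i ≤ N + 1 →
      wrs (u none) i = C (a : ℂ) * (S.K i * S.polyAt t i) := by
    intro i
    by_cases hi : i ≤ N + 1
    · obtain ⟨c, hc⟩ := (h.wrs_associated none i hi).symm
      obtain ⟨x, hx, hxc⟩ := Polynomial.isUnit_iff.1 c.isUnit
      obtain ⟨x, rfl⟩ := hx
      exact ⟨x, fun _ => by rw [← hc, ← hxc, mul_comm]⟩
    · exact ⟨1, fun h => absurd h hi⟩
  choose a ha using ha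
  exact ⟨a, ha⟩

end BasicSituation

namespace BasicSituation

variable {N d n : ℕ} {S : BasicSituation N d n}
variable {R : Type*} [CommRing R] [Algebra ℂ R]

/-! ### From the divisibility conditions to adapted families of polynomials -/

theorem isUnit_coord_sub_z (v : S.Var) (s : Fin n) :
    IsUnit (S.coord v - algebraMap ℂ S.RegFun (S.z s)) := by
  have h : (MvPolynomial.X v - MvPolynomial.C (S.z s) : MvPolynomial S.Var ℂ) ∣ S.discr := by
    refine Dvd.dvd.mul_right (Dvd.dvd.mul_right ?_ _) _
    exact (Finset.dvd_prod_of_mem (fun s : Fin n =>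
      (MvPolynomial.X v - MvPolynomial.C (S.z s) : MvPolynomial S.Var ℂ))
        (Finset.mem_univ s)).trans
      (Finset.dvd_prod_of_mem (fun v : S.Var => ∏ s : Fin n,
        (MvPolynomial.X v - MvPolynomial.C (S.z s) : MvPolynomial S.Var ℂ)) (Finset.mem_univ v))
  have h2 := isUnit_of_dvd_unit
    (map_dvd (algebraMap (MvPolynomial S.Var ℂ) S.RegFun) h) S.isUnit_discr
  have e : algebraMap (MvPolynomial S.Var ℂ) S.RegFun (MvPolynomial.C (S.z s)) =
      algebraMap ℂ S.RegFun (S.z s) :=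
    (IsScalarTower.algebraMap_apply ℂ (MvPolynomial S.Var ℂ) S.RegFun (S.z s)).symm
  rwa [map_sub, e] at h2

variable (f : S.RegFun →ₐ[ℂ] R)

/-- The polynomials `y_i` of an `R`-valued point of `R̃°`. -/
abbrev pointPoly (i : ℕ) : R[X] := S.polyAt (fun v => f (S.coord v)) i

theorem isCoprime_pointPoly_derivative (i : ℕ) :
    IsCoprime (pointPoly f i) (derivative (pointPoly f i)) := by
  refine separable_prod' (fun v hv w hw hvw => isCoprime_X_sub_C_of_isUnit_sub ?_)
    fun v _ => separable_X_sub_C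
  rw [← map_sub]
  simp only [Finset.mem_filter, Finset.mem_univ, true_and] at hv hw
  exact (isUnit_coord_sub_of_level_eq hvw (Fin.ext (by omega))).map f

theorem isCoprime_pointPoly_succ (i : ℕ) : IsCoprime (pointPoly f i) (pointPoly f (i + 1)) := by
  refine IsCoprime.prod_left fun v hv => IsCoprime.prod_right fun w hw =>
    isCoprime_X_sub_C_of_isUnit_sub ?_
  rw [← map_sub]
  simp only [Finset.mem_filter, Finset.mem_univ, true_and] at hv hw
  exact (isUnit_coord_sub_of_level_succ (Or.inl (by omega))).map f

theorem isUnit_eval_pointPoly (i : ℕ) (s : Fin n) :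
    IsUnit ((pointPoly f i).eval (algebraMap ℂ R (S.z s))) := by
  rw [pointPoly, polyAt, eval_prod]
  refine Finset.prod_induction _ (fun x => IsUnit x) (fun _ _ => IsUnit.mul) isUnit_one fun v _ => ?_
  have := ((S.isUnit_coord_sub_z v s).map f).neg
  rw [map_sub, AlgHom.commutes, neg_sub] at this
  rwa [eval_sub, eval_X, eval_C]

variable {f}

/-- The chains of solutions of the Wronskian equations over a point of `Ã`, for a given
normalisation `nrm` of the solutions, and the Wronskians of the flag of polynomials obtained from
them. -/
theorem exists_chain_family (hf : ∀ a ∈ S.divisibilityIdeal, f a = 0) (nrm : ℕ → R[X] → Prop)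
    (hn : ∀ i p, 1 ≤ i → i ≤ N → ∃ c : R, nrm i (p + C c * pointPoly f i)) :
    ∃ p : ℕ → ℕ → R[X], (∀ k, 1 ≤ k → k ≤ N + 1 → p k k = pointPoly f k) ∧
      (∀ k, k ≤ N + 1 → ∀ i, 1 ≤ i → i < k → wronskian (pointPoly f i) (p k i) =
        (S.T i).map (algebraMap ℂ R) * pointPoly f (i - 1) * p k (i + 1) ∧ nrm i (p k i)) ∧
      ∀ i ≤ N + 1, wrs (fun j => (S.K 1).map (algebraMap ℂ R) * p (j + 1) 1) i =
        (S.K i).map (algebraMap ℂ R) * pointPoly f i := by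
  have hdiv := (forall_divisibilityIdeal_eq_zero_iff f).1 hf
  have h := fun k : ℕ => exists_chain N (fun i => pointPoly f i)
    (fun i => (S.T i).map (algebraMap ℂ R)) nrm hn
    (fun i _ _ => polyAt_monic _ i) (fun i _ _ => isCoprime_pointPoly_derivative f i)
    (fun i _ _ => isCoprime_pointPoly_succ f i) hdiv k
  choose! p hp hpw using h
  refine ⟨p, fun k _ hk => hp k hk, hpw, fun i hi => ?_⟩
  refine (wrx_chain N (fun i => (S.K i).map (algebraMap ℂ R)) (fun i => pointPoly f i)
    (fun i => (S.T i).map (algebraMap ℂ R)) p (by simp [K_zero]) (polyAt_zero _)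
    (fun i _ => (S.K_monic i).map _) (fun i _ => polyAt_monic _ i) (fun i h1 hi => ?_)
    (fun k _ hk => hp k hk) (fun k hk i h1 hi => (hpw k hk i h1 hi).1) i).1 hi
  rw [← Polynomial.map_pow, ← Polynomial.map_mul, ← Polynomial.map_mul, S.K_sq_mul_T i h1 hi]

theorem natDegree_T_add {i : ℕ} (h1 : 1 ≤ i) (hi : i ≤ N) :
    2 * (S.K i).natDegree + (S.T i).natDegree =
      (S.K (i - 1)).natDegree + (S.K (i + 1)).natDegree := by
  have h := congrArg natDegree (S.K_sq_mul_T i h1 hi)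
  rwa [((S.K_monic i).pow 2).natDegree_mul (S.T_monic i), (S.K_monic i).natDegree_pow,
    (S.K_monic _).natDegree_mul (S.K_monic _)] at h

theorem wdeg_succ {i : ℕ} (hi : i ≤ N) : S.wdeg (i + 1) = S.wdeg i + S.piv none i - i := by
  have := S.piv_add_ex none hi
  unfold wdeg ex at *
  rw [sa_succ]
  push_cast
  zify at this
  linear_combination -this

/-- The flag of polynomials attached to a point of `Ã` has a basis adapted to the flag at infinity:
the solutions are normalised by removing the coefficient in the degree of `y_i`. -/
theorem exists_family_none [Nontrivial R] (hf : ∀ a ∈ S.divisibilityIdeal, f a = 0)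
    (hl : ∀ i ≤ N + 1, S.wdeg i = S.l i + (S.K i).natDegree) :
    ∃ η : ℕ → R[X], (∀ i ≤ N + 1, wrs η i = (S.K i).map (algebraMap ℂ R) * pointPoly f i) ∧
      ∀ k ≤ N, S.Low none (S.piv none k) (η k) := by
  have hdeg : ∀ i, 1 ≤ i → i ≤ N → (pointPoly f i).natDegree = S.l i := fun i h1 hi =>
    natDegree_polyAt _ h1 hi
  have hdeg' : ∀ i, i ≤ N + 1 → ((pointPoly f i).natDegree : ℤ) =
      S.wdeg i - (S.K i).natDegree := by
    intro i hi
    rcases Nat.eq_zero_or_pos i with rfl | h1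
    · rw [pointPoly, polyAt_zero, K_zero]
      simp [wdeg, sa]
    rcases hi.lt_or_eq with hlt | rfl
    · rw [hdeg i h1 (by omega), hl i hi]
      ring
    · rw [pointPoly, polyAt_last, wdeg_last]
      simp
  have hcoeff : ∀ i, 1 ≤ i → i ≤ N → (pointPoly f i).coeff (S.l i) = 1 := by
    intro i h1 hi
    rw [← hdeg i h1 hi]
    exact polyAt_monic _ i
  obtain ⟨p, hp, hpw, hwrs⟩ := exists_chain_family hf (fun i p => p.coeff (S.l i) = 0)
    fun i p h1 hi => ⟨-p.coeff (S.l i), by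
      rw [coeff_add, coeff_C_mul, hcoeff i h1 hi, mul_one, add_neg_cancel]⟩
  refine ⟨_, hwrs, fun k hk => (S.low_iff_natDegree (S.piv_le _ _) _).2 ?_⟩
  -- The degrees along a chain, downwards from `i = k + 1`.
  have key : ∀ j i, 1 ≤ i → i + j = k + 1 → p (k + 1) i = 0 ∨ ((p (k + 1) i).natDegree : ℤ) ≤
      S.wdeg (i - 1) + S.piv none k - (i - 1 : ℕ) - (S.K i).natDegree := by
    intro j
    induction j with
    | zero =>
      intro i h1 hi
      rw [add_zero] at hi
      subst hi
      right
      rw [hp _ h1 (by omega), hdeg' _ (by omega), wdeg_succ hk]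
      simp
    | succ j ih =>
      intro i h1 hi
      obtain ⟨hw, hc⟩ := hpw (k + 1) (by omega) i h1 (by omega)
      refine eq_zero_or_natDegree_le_of_wronskian (hdeg i h1 (by omega)).le
        (by rw [hcoeff i h1 (by omega)]; exact isUnit_one) hc ?_
      rw [hw]
      rcases ih (i + 1) (by omega) (by omega) with h0 | h0
      · left
        rw [h0, mul_zero]
      right
      have e1 := natDegree_mul_le (p := (S.T i).map (algebraMap ℂ R) * pointPoly f (i - 1))
        (q := p (k + 1) (i + 1))
      have e2 := natDegree_mul_le (p := (S.T i).map (algebraMap ℂ R)) (q := pointPoly f (i - 1))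
      rw [(S.T_monic i).natDegree_map] at e2
      have e3 := hdeg' (i - 1) (by omega)
      have e4 := S.natDegree_T_add h1 (by omega)
      have e5 := hl i (by omega)
      rw [Nat.add_sub_cancel] at h0
      omega
  rcases key k 1 le_rfl (by omega) with h0 | h0
  · rw [h0, mul_zero, natDegree_zero]
    exact Nat.zero_le _
  · have e1 := natDegree_mul_le (p := (S.K 1).map (algebraMap ℂ R)) (q := p (k + 1) 1)
    rw [(S.K_monic 1).natDegree_map] at e1
    simp only [Nat.sub_self, wdeg, sa, Finset.range_zero, Finset.sum_empty] at h0
    push_cast at h0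
    omega

/-- The flag of polynomials attached to a point of `Ã` has a basis adapted to the flag at `z_s`:
the solutions are normalised by their vanishing at `z_s`. -/
theorem exists_family_some (hf : ∀ a ∈ S.divisibilityIdeal, f a = 0) (s : Fin n) :
    ∃ η : ℕ → R[X], (∀ i ≤ N + 1, wrs η i = (S.K i).map (algebraMap ℂ R) * pointPoly f i) ∧
      ∀ k ≤ N, (X - C (algebraMap ℂ R (S.z s))) ^ S.ex (some s) k ∣ η k := by
  set z := algebraMap ℂ R (S.z s) with hz
  obtain ⟨p, hp, hpw, hwrs⟩ := exists_chain_family hf (fun i p => p.eval z = 0)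
    fun i p h1 hi => ⟨-p.eval z * ↑(isUnit_eval_pointPoly f i s).unit⁻¹, by
      rw [eval_add, eval_mul, eval_C, mul_assoc, IsUnit.val_inv_mul, mul_one, add_neg_cancel]⟩
  refine ⟨_, hwrs, fun k hk => ?_⟩
  -- The orders of vanishing along a chain, downwards from `i = k + 1`.
  have key : ∀ j i, 1 ≤ i → i + j = k + 1 →
      (X - C z) ^ (S.ex (some s) k - S.ex (some s) (i - 1)) ∣ p (k + 1) i := by
    intro j
    induction j with
    | zero =>
      intro i h1 hi
      rw [show i - 1 = k by omega, Nat.sub_self, pow_zero]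
      exact one_dvd _
    | succ j ih =>
      intro i h1 hi
      obtain ⟨hw, hc⟩ := hpw (k + 1) (by omega) i h1 (by omega)
      have hT : (X - C z) ^ (S.a (some s) (N + 1 - i) - S.a (some s) (N + 2 - i)) ∣
          (S.T i).map (algebraMap ℂ R) := by
        have := Finset.dvd_prod_of_mem (fun s : Fin n => (X - C (S.z s)) ^
          (S.a (some s) (N + 1 - i) - S.a (some s) (N + 2 - i))) (Finset.mem_univ s)
        simpa [hz, T, Polynomial.map_prod] using map_dvd (mapRingHom (algebraMap ℂ R)) this
      have h2 := mul_dvd_mul (hT.mul_right (pointPoly f (i - 1))) (ih (i + 1) (by omega) (by omega))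
      rw [← hw, ← pow_add, X_sub_C_pow_dvd_iff_taylor, Nat.add_sub_cancel] at h2
      have h3 : taylor z (wronskian (pointPoly f i) (p (k + 1) i)) =
          wronskian (taylor z (pointPoly f i)) (taylor z (p (k + 1) i)) := by
        simp [wronskian, taylor_apply, derivative_comp]
      rw [h3] at h2
      have h4 := pow_dvd_of_wronskian (by
        rw [taylor_coeff_zero]
        exact isUnit_eval_pointPoly f i s) (by rw [taylor_coeff_zero, hc]) h2
      rw [X_sub_C_pow_dvd_iff_taylor]
      refine (pow_dvd_pow _ ?_).trans h4
      have e1 := S.a_antitone (some s) (show N + 1 - i ≤ N + 2 - i by omega)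
      have e2 := (S.ex_strictMono (some s)).monotone (show i ≤ k by omega)
      unfold ex at *
      rw [show N + 1 - (i - 1) = N + 2 - i by omega]
      omega
  have h1 := key k 1 le_rfl (by omega)
  have h2 : (X - C z) ^ S.ex (some s) 0 ∣ (S.K 1).map (algebraMap ℂ R) := by
    rw [S.K_eq 1 (by omega)]
    have := Finset.dvd_prod_of_mem (fun s : Fin n => (X - C (S.z s)) ^ S.sa (some s) 1)
      (Finset.mem_univ s)
    simpa [hz, sa, ex, Polynomial.map_prod] using map_dvd (mapRingHom (algebraMap ℂ R)) this
  have h3 := mul_dvd_mul h2 h1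
  rwa [← pow_add, Nat.sub_self, Nat.add_sub_cancel'
    ((S.ex_strictMono (some s)).monotone (Nat.zero_le k))] at h3

end BasicSituation

section Triangular

/-! ### Triangular matrices -/

theorem Fin.sum_univ_castLE {M : Type*} [AddCommMonoid M] {k m : ℕ} (h : k ≤ m) (g : Fin m → M)
    (hg : ∀ l : Fin m, k ≤ l → g l = 0) : ∑ l, g l = ∑ l : Fin k, g (Fin.castLE h l) := by
  symm
  refine Finset.sum_of_injOn (Fin.castLE h) (Fin.castLE_injective h).injOn (by simp)
    (fun l _ hl => hg l ?_) fun _ _ => rfl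
  by_contra hlt
  exact hl ⟨⟨l, by omega⟩, by simp, rfl⟩

variable {R : Type*} [CommRing R]

/-- A lower triangular matrix carrying one upper unitriangular matrix to another is the identity. -/
theorem eq_one_of_lowerTriangular_mul {m : ℕ} {L U U' : Matrix (Fin m) (Fin m) R}
    (hL : ∀ k l, k < l → L k l = 0) (hU : ∀ k l, l < k → U k l = 0) (hU1 : ∀ k, U k k = 1)
    (hU' : ∀ k l, l < k → U' k l = 0) (hU1' : ∀ k, U' k k = 1) (h : U' = L * U) : L = 1 := by
  have key : ∀ l k : Fin m, l < k → L k l = 0 := by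
    intro l
    induction l using WellFoundedLT.induction with
    | _ l ih =>
      intro k hk
      have h1 := congrFun (congrFun h k) l
      rw [hU' k l hk, Matrix.mul_apply, Finset.sum_eq_single l] at h1
      · rw [h1, hU1, mul_one]
      · intro j _ hj
        rcases lt_or_gt_of_ne hj with hlt | hlt
        · rw [ih j hlt k (hlt.trans hk), zero_mul]
        · rw [hU j l hlt, mul_zero]
      · simp
  ext k l
  rcases lt_trichotomy k l with hlt | rfl | hlt
  · rw [hL k l hlt, Matrix.one_apply_ne hlt.ne]
  · have h1 := congrFun (congrFun h k) k
    rw [hU1', Matrix.mul_apply, Finset.sum_eq_single k] at h1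
    · rw [Matrix.one_apply_eq, h1, hU1, mul_one]
    · intro j _ hj
      rcases lt_or_gt_of_ne hj with hlt | hlt
      · rw [key j k hlt, zero_mul]
      · rw [hL k j hlt, zero_mul]
    · simp
  · rw [key l k hlt, Matrix.one_apply_ne hlt.ne']

/-- The triangular decomposition, over a local ring, of a matrix whose reduction is lower
triangular. -/
theorem exists_lowerTriangular_mul {F : Type*} [Field F] (π : R →+* F)
    (hπ : ∀ a, π a ≠ 0 → IsUnit a) {m : ℕ}
    (G : Matrix (Fin m) (Fin m) R) (hG : ∀ k l, k < l → π (G k l) = 0)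
    (hG1 : ∀ k, π (G k k) ≠ 0) : ∃ L : Matrix (Fin m) (Fin m) R, (∀ k l, k < l → L k l = 0) ∧
      (∀ k, IsUnit (L k k)) ∧ (∀ k l, l < k → (L * G) k l = 0) ∧ (∀ k, (L * G) k k = 1) ∧
      ∀ k l, k < l → π ((L * G) k l) = 0 := by
  -- The row `k` of `L` is the last row of the inverse of the leading block of size `k + 1`.
  have hex : ∀ k : Fin m, ∃ r : Fin m → R, (∀ l, k < l → r l = 0) ∧
      ∀ j ≤ k, ∑ l, r l * G l j = if k = j then 1 else 0 := by
    intro k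
    have hk : (k : ℕ) + 1 ≤ m := k.2
    let H : Matrix (Fin (k + 1)) (Fin (k + 1)) R :=
      G.submatrix (Fin.castLE hk) (Fin.castLE hk)
    have hH : IsUnit H.det := by
      refine hπ _ ?_
      rw [RingHom.map_det, Matrix.det_of_isLowerTriangular]
      · exact Finset.prod_ne_zero_iff.2 fun i _ => hG1 _
      · intro i j hij
        exact hG _ _ hij
    refine ⟨fun l => if h : (l : ℕ) < k + 1 then H⁻¹ (Fin.last k) ⟨l, h⟩ else 0,
      fun l hl => dif_neg (by omega), fun j hj => ?_⟩
    rw [Fin.sum_univ_castLE hk _ fun l hl => by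
      simp only
      rw [dif_neg (by omega), zero_mul]]
    have h1 := congrFun (congrFun (Matrix.nonsing_inv_mul H hH) (Fin.last k)) ⟨j, by omega⟩
    rw [Matrix.mul_apply, Matrix.one_apply] at h1
    refine Eq.trans (Finset.sum_congr rfl fun l _ => ?_) (h1.trans ?_)
    · simp only
      rw [dif_pos (show ((Fin.castLE hk l : Fin m) : ℕ) < k + 1 from l.2)]
      rfl
    · simp [Fin.ext_iff]
  choose r hr1 hr2 using hex
  have hdiag : ∀ k l j, k ≤ j → π (r k l * G l j) = if k = l ∧ l = j then π (r k k * G k k) else 0 := by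
    intro k l j hkj
    split_ifs with h
    · obtain ⟨rfl, rfl⟩ := h
      rfl
    · rcases lt_or_ge k l with hlt | hge
      · rw [hr1 k l hlt, zero_mul, map_zero]
      · rw [map_mul, hG l j (lt_of_le_of_ne (hge.trans hkj) fun hlj => h ⟨by
          exact le_antisymm (hlj ▸ hkj) hge, hlj⟩), mul_zero]
  refine ⟨Matrix.of r, hr1, fun k => hπ _ fun h0 => ?_, fun k l hl => ?_, fun k => ?_,
    fun k l hkl => ?_⟩
  · have h1 := congrArg π (hr2 k k le_rfl)
    rw [map_sum, Finset.sum_congr rfl fun l _ => hdiag k l k le_rfl] at h1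
    rw [Matrix.of_apply] at h0
    simp [h0] at h1
  · exact (hr2 k l hl.le).trans (if_neg hl.ne')
  · exact (hr2 k k le_rfl).trans (if_pos rfl)
  · rw [Matrix.mul_apply, map_sum]
    refine Finset.sum_eq_zero fun j _ => (hdiag k j l hkl.le).trans (if_neg ?_)
    rintro ⟨rfl, rfl⟩
    exact lt_irrefl _ hkl

end Triangular

namespace BasicSituation

variable {N d n : ℕ} {S : BasicSituation N d n}

/-! ### Flags in a space with given chart coordinates -/

section FlagVec

variable (b : Module.Basis (Fin (N + 1) ⊕ Fin (d - N)) ℂ (polySpace d))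
variable {R R' : Type*} [CommRing R] [Algebra ℂ R] [CommRing R'] [Algebra ℂ R']

/-- The sequence of vectors with coefficient matrix `M`, with respect to the basis `cv b c` of the
space with chart coordinates `c`; it is continued by zeros. -/
def flagVec (M : Matrix (Fin (N + 1)) (Fin (N + 1)) R) (c : Fin (N + 1) × Fin (d - N) → R)
    (k : ℕ) : R[X] :=
  if hk : k < N + 1 then ∑ i, C (M ⟨k, hk⟩ i) * cv b c i else 0

theorem flagVec_coe (M : Matrix (Fin (N + 1)) (Fin (N + 1)) R)
    (c : Fin (N + 1) × Fin (d - N) → R) (k : Fin (N + 1)) :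
    flagVec b M c k = ∑ i, C (M k i) * cv b c i := dif_pos k.2

theorem flagVec_map (f : R →ₐ[ℂ] R') (M : Matrix (Fin (N + 1)) (Fin (N + 1)) R)
    (c : Fin (N + 1) × Fin (d - N) → R) (k : ℕ) :
    (flagVec b M c k).map (f : R →+* R') = flagVec b (M.map f) (fun p => f (c p)) k := by
  unfold flagVec
  split_ifs
  · simp [Polynomial.map_sum, cv_map]
  · exact Polynomial.map_zero _

theorem flagVec_mul (L M : Matrix (Fin (N + 1)) (Fin (N + 1)) R)
    (c : Fin (N + 1) × Fin (d - N) → R) (k : Fin (N + 1)) :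
    flagVec b (L * M) c k = ∑ l : Fin (N + 1), C (L k l) * flagVec b M c l := by
  simp only [flagVec_coe, Finset.mul_sum]
  rw [Finset.sum_comm]
  refine Finset.sum_congr rfl fun i _ => ?_
  rw [Matrix.mul_apply, map_sum, Finset.sum_mul]
  simp only [C_mul, mul_assoc]

theorem wrs_flagVec_lowerTriangular_mul {L M : Matrix (Fin (N + 1)) (Fin (N + 1)) R}
    (hL : ∀ k l, k < l → L k l = 0) (c : Fin (N + 1) × Fin (d - N) → R) {i : ℕ} (hi : i ≤ N + 1) :
    wrs (flagVec b (L * M) c) i =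
      C (∏ j : Fin i, L (Fin.castLE hi j) (Fin.castLE hi j)) * wrs (flagVec b M c) i := by
  have h1 := wr_linearCombination (L.submatrix (Fin.castLE hi) (Fin.castLE hi))
    fun j : Fin i => flagVec b M c j
  rw [Matrix.det_of_isLowerTriangular] at h1
  · refine Eq.trans ?_ h1
    unfold wrs
    congr 1
    funext j
    refine (flagVec_mul b L M c (Fin.castLE hi j)).trans ?_
    rw [Fin.sum_univ_castLE hi _ fun l hl => ?_]
    · rfl
    · rw [hL _ _ (show Fin.castLE hi j < l from Fin.lt_def.2 (lt_of_lt_of_le j.2 hl)), C_0, zero_mul]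
  · intro j l hjl
    exact hL _ _ hjl

/-- The chart coordinates and the coefficient matrix are determined by the vectors. -/
theorem eq_of_flagVec_eq {M M' : Matrix (Fin (N + 1)) (Fin (N + 1)) R}
    {c c' : Fin (N + 1) × Fin (d - N) → R}
    (h : ∀ k : Fin (N + 1), flagVec b M' c' k = flagVec b M c k) (hM : IsUnit M.det) :
    M' = M ∧ c' = c := by
  have h1 : M' = M := by
    ext k i
    have := congrArg (bco R b (Sum.inl i)) (h k)
    rwa [flagVec_coe, flagVec_coe, bco_inl_sum_cv, bco_inl_sum_cv] at this
  subst h1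
  refine ⟨rfl, ?_⟩
  have h2 : M' * Matrix.of (fun i j => c' (i, j)) = M' * Matrix.of (fun i j => c (i, j)) := by
    ext k j
    have := congrArg (bco R b (Sum.inr j)) (h k)
    rwa [flagVec_coe, flagVec_coe, bco_inr_sum_cv, bco_inr_sum_cv] at this
  have h3 := congrArg (fun Z => M'⁻¹ * Z) h2
  simp only [← Matrix.mul_assoc, Matrix.nonsing_inv_mul M' hM, Matrix.one_mul] at h3
  funext p
  exact congrFun (congrFun h3 p.1) p.2

/-- The normal form of a flag is determined by its Wronskians. -/
theorem eq_of_wrs_flagVec_eq {A U U' : Matrix (Fin (N + 1)) (Fin (N + 1)) R}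
    {c c' : Fin (N + 1) × Fin (d - N) → R} (hA : IsUnit A.det)
    (hU : ∀ k l, l < k → U k l = 0) (hU1 : ∀ k, U k k = 1)
    (hU' : ∀ k l, l < k → U' k l = 0) (hU1' : ∀ k, U' k k = 1) (F : ℕ → R[X])
    (hF : ∀ i ≤ N + 1, (F i).Monic) (a a' : ℕ → Rˣ)
    (h : ∀ i ≤ N + 1, wrs (flagVec b (U * A) c) i = C (a i : R) * F i)
    (h' : ∀ i ≤ N + 1, wrs (flagVec b (U' * A) c') i = C (a' i : R) * F i) :
    U' = U ∧ c' = c := by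
  have hex := exists_eq_sum_of_wrs_eq (flagVec b (U * A) c) (flagVec b (U' * A) c') (N + 1)
    (fun i hi => by
      rw [h i hi, leadingCoeff_mul_monic (hF i hi), leadingCoeff_C]
      exact (a i).isUnit)
    (fun i hi => ⟨a' i * (a i)⁻¹, by
      rw [h i hi, h' i hi, ← mul_assoc, ← C_mul, ← Units.val_mul, inv_mul_cancel_right]⟩)
  choose! r hr using hex
  let L : Matrix (Fin (N + 1)) (Fin (N + 1)) R := Matrix.of fun k l => if l ≤ k then r k l else 0
  have hLv : ∀ k : Fin (N + 1), flagVec b (U' * A) c' k = flagVec b (L * (U * A)) c k := by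
    intro k
    rw [hr k k.2, flagVec_mul, Fin.sum_univ_castLE (show (k : ℕ) + 1 ≤ N + 1 from k.2) _
      fun l hl => by
        have hkl : ¬ l ≤ k := not_le.2 (Fin.lt_def.2 hl)
        simp [L, hkl],
      ← Fin.sum_univ_eq_sum_range fun l => C (r k l) * flagVec b (U * A) c l]
    refine Finset.sum_congr rfl fun l _ => ?_
    have : Fin.castLE k.2 l ≤ k := Nat.lt_succ_iff.1 l.2
    simp [L, this]
  have hUdet : U'.det = 1 := by
    rw [Matrix.det_of_isUpperTriangular fun k l hlk => hU' k l hlk]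
    exact Finset.prod_eq_one fun k _ => hU1' k
  obtain ⟨h1, h2⟩ := eq_of_flagVec_eq b (fun k => (hLv k).symm) (by
    rw [Matrix.det_mul, hUdet, one_mul]; exact hA)
  have h3 : U' = L * U := by
    have h3 := congrArg (fun Z => Z * A⁻¹) h1
    simp only [Matrix.mul_assoc, Matrix.mul_nonsing_inv A hA, Matrix.mul_one] at h3
    exact h3.symm
  have hL := eq_one_of_lowerTriangular_mul (fun k l hkl => by simp [L, hkl]) hU hU1 hU' hU1' h3
  rw [hL, Matrix.one_mul] at h3
  exact ⟨h3, h2.symm⟩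

end FlagVec

end BasicSituation

namespace BasicSituation

variable {N d n : ℕ} {S : BasicSituation N d n}
variable {R : Type*} [CommRing R] [Algebra ℂ R] {f : S.RegFun →ₐ[ℂ] R}

/-! ### The point of `Ω` attached to a point of `Ã` -/

/-- The flags of polynomials arising from different normalisations have the same Wronskians, hence
coincide. So the span of one family satisfies the Schubert conditions at all points. -/
theorem exists_family [Nontrivial R] (hf : ∀ a ∈ S.divisibilityIdeal, f a = 0)
    (hl : ∀ i ≤ N + 1, S.wdeg i = S.l i + (S.K i).natDegree) :
    ∃ η : ℕ → R[X], (∀ i ≤ N + 1, wrs η i = (S.K i).map (algebraMap ℂ R) * pointPoly f i) ∧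
      (∀ k ≤ N, (η k).natDegree ≤ d) ∧
      ∀ s, ∃ L : Matrix (Fin (N + 1)) (Fin (N + 1)) R, IsUnit L.det ∧
        ∀ k : Fin (N + 1), S.Low s (S.piv s k) (∑ l : Fin (N + 1), C (L k l) * η l) := by
  obtain ⟨η, hη, hlow⟩ := exists_family_none hf hl
  have hmon : ∀ i, ((S.K i).map (algebraMap ℂ R) * pointPoly f i).Monic := fun i =>
    ((S.K_monic i).map _).mul (polyAt_monic _ i)
  refine ⟨η, hη, fun k hk => (hlow k hk).1, fun s => ?_⟩
  rcases s with _ | s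
  · refine ⟨1, by simp, fun k => ?_⟩
    rw [Finset.sum_eq_single k (fun l _ hl => by simp [Matrix.one_apply_ne hl.symm]) (by simp)]
    simpa using hlow k (Nat.lt_succ_iff.1 k.2)
  obtain ⟨η', hη', hdvd⟩ := exists_family_some hf s
  have hex := exists_eq_sum_of_wrs_eq η η' (N + 1) (fun i hi => by
    rw [hη i hi, (hmon i).leadingCoeff]
    exact isUnit_one) (fun i hi => ⟨1, by rw [hη i hi, hη' i hi]; simp⟩)
  choose! r hr using hex
  let L : Matrix (Fin (N + 1)) (Fin (N + 1)) R := Matrix.of fun k l => if l ≤ k then r k l else 0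
  have hL : ∀ k : Fin (N + 1), η' k = ∑ l : Fin (N + 1), C (L k l) * η l := by
    intro k
    rw [hr k k.2, Fin.sum_univ_castLE (show (k : ℕ) + 1 ≤ N + 1 from k.2) _
      fun l hl => by
        have hkl : ¬ l ≤ k := not_le.2 (Fin.lt_def.2 hl)
        simp [L, hkl],
      ← Fin.sum_univ_eq_sum_range fun l => C (r k l) * η l]
    refine Finset.sum_congr rfl fun l _ => ?_
    have : Fin.castLE k.2 l ≤ k := Nat.lt_succ_iff.1 l.2
    simp [L, this]
  -- The Wronskians of the full families coincide, so that the change of basis is invertible.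
  have hdet : L.det = 1 := by
    have h1 : wrs η' (N + 1) = C L.det * wrs η (N + 1) := by
      unfold wrs
      rw [← wr_linearCombination]
      congr 1
      exact funext hL
    rw [hη _ le_rfl, hη' _ le_rfl] at h1
    have h2 := congrArg leadingCoeff h1
    rw [leadingCoeff_mul_monic (hmon _), (hmon _).leadingCoeff, leadingCoeff_C] at h2
    exact h2.symm
  refine ⟨L, by rw [hdet]; exact isUnit_one, fun k => (S.low_iff_dvd s _ _).2 ⟨?_, ?_⟩⟩
  · exact natDegree_sum_le_of_forall_le _ _ fun l _ =>
      (natDegree_C_mul_le _ _).trans (hlow l (Nat.lt_succ_iff.1 l.2)).1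
  · rw [← hL]
    have h1 := S.piv_add_ex (some s) (Nat.lt_succ_iff.1 k.2)
    rw [show d - S.piv (some s) k = S.ex (some s) k by omega]
    exact hdvd k (Nat.lt_succ_iff.1 k.2)

variable {V : Submodule ℂ ℂ[X]} {t : S.Var → ℂ} {u : Option (Fin n) → ℕ → ℂ[X]}
variable {b : Module.Basis (Fin (N + 1) ⊕ Fin (d - N)) ℂ (polySpace d)}

/-- The coordinates of the basis of `V` adapted to `E` and to the flag at infinity. -/
theorem Bases.exists_matrix (h : S.Bases V t u) (hb : chartPoint b 0 = V) :
    ∃ A : Matrix (Fin (N + 1)) (Fin (N + 1)) ℂ, IsUnit A.det ∧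
      ∀ k : Fin (N + 1), u none k = flagVec b A 0 k := by
  have hex : ∀ k : Fin (N + 1), ∃ A : Fin (N + 1) → ℂ, u none k = ∑ i, C (A i) * cv b 0 i := by
    intro k
    have h1 : u none k ∈ Submodule.span ℂ (Set.range (cv b (0 : Fin (N + 1) × Fin (d - N) → ℂ))) := by
      rw [← chartPoint_eq, hb, ← h.span_last none]
      exact Submodule.subset_span ⟨k, rfl⟩
    obtain ⟨A, hA⟩ := (Submodule.mem_span_range_iff_exists_fun ℂ).1 h1
    exact ⟨A, by rw [← hA]; simp only [smul_eq_C_mul]⟩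
  choose A hA using hex
  refine ⟨Matrix.of A, isUnit_iff_ne_zero.2 fun h0 => ?_, fun k => ?_⟩
  · have h1 := wr_linearCombination (Matrix.of A) (cv b 0)
    rw [h0, C_0, zero_mul] at h1
    refine ((h.exact none).natDegree_wrs le_rfl).1 (Eq.trans ?_ h1)
    unfold wrs
    congr 1
    exact funext hA
  · rw [flagVec_coe]
    exact hA k

/-- A point of `Ã` near `t` defines a point of `Ω` near `V`, together with a flag, which is brought
into a normal form. -/
theorem Bases.exists_normalForm (h : S.Bases V t u) {A : Matrix (Fin (N + 1)) (Fin (N + 1)) ℂ}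
    (hA : IsUnit A.det) (hAu : ∀ k : Fin (N + 1), u none k = flagVec b A 0 k)
    (hf : ∀ a ∈ S.divisibilityIdeal, f a = 0) (π : R →ₐ[ℂ] ℂ) (hπ : ∀ a, π a ≠ 0 → IsUnit a)
    (ht : ∀ v, π (f (S.coord v)) = t v) :
    ∃ (c : Fin (N + 1) × Fin (d - N) → R) (U : Matrix (Fin (N + 1)) (Fin (N + 1)) R),
      (∀ p, π (c p) = 0) ∧ (∀ s, S.Adapted b s c) ∧ (∀ k l, l < k → U k l = 0) ∧
      (∀ k, U k k = 1) ∧ (∀ k l, k < l → π (U k l) = 0) ∧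
      ∃ a : ℕ → Rˣ, ∀ i ≤ N + 1, wrs (flagVec b (U * A.map (algebraMap ℂ R)) c) i =
        C (a i : R) * ((S.K i).map (algebraMap ℂ R) * pointPoly f i) := by
  have : Nontrivial R := π.toRingHom.domain_nontrivial
  obtain ⟨η, hη, hdeg, hL⟩ := exists_family hf fun i hi => h.wdeg_eq hi
  obtain ⟨M, hMb⟩ : ∃ M : Matrix (Fin (N + 1)) (Fin (N + 1)) R,
      ∀ k i, M k i = bco R b (Sum.inl i) (η k) := ⟨_, fun _ _ => Matrix.of_apply _ _ _⟩
  obtain ⟨Q, hQb⟩ : ∃ Q : Matrix (Fin (N + 1)) (Fin (d - N)) R,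
      ∀ k j, Q k j = bco R b (Sum.inr j) (η k) := ⟨_, fun _ _ => Matrix.of_apply _ _ _⟩
  -- The reduction of `η` modulo the maximal ideal spans the flag of `V`.
  have hwrs : ∀ i ≤ N + 1, wrs (fun k => (η k).map (π : R →+* ℂ)) i = S.K i * S.polyAt t i := by
    intro i hi
    rw [wrs_map, hη i hi, Polynomial.map_mul, Polynomial.map_map, pointPoly, polyAt_map,
      show (π : R →+* ℂ).comp (algebraMap ℂ R) = RingHom.id ℂ from π.comp_algebraMap,
      Polynomial.map_id]
    congr 2
    exact funext ht
  obtain ⟨a, ha⟩ := h.exists_wrs_eq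
  have hmon : ∀ i, (S.K i * S.polyAt t i).Monic := fun i => (S.K_monic i).mul (polyAt_monic t i)
  have hex := exists_eq_sum_of_wrs_eq (u none) (fun k => (η k).map (π : R →+* ℂ)) (N + 1)
    (fun i hi => by
      rw [ha i hi, leadingCoeff_mul_monic (hmon i), leadingCoeff_C]
      exact (a i).isUnit)
    (fun i hi => ⟨(a i)⁻¹, by
      rw [hwrs i hi, ha i hi, ← mul_assoc, ← C_mul, Units.inv_mul, C_1, one_mul]⟩)
  choose! r hr using hex
  obtain ⟨T, hT⟩ : ∃ T : Matrix (Fin (N + 1)) (Fin (N + 1)) ℂ,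
      ∀ k l, T k l = if l ≤ k then r k l else 0 := ⟨_, fun _ _ => Matrix.of_apply _ _ _⟩
  have hT0 : ∀ k l, k < l → T k l = 0 := fun k l hkl => by simp [hT, hkl]
  have hηT : ∀ k : Fin (N + 1), (η k).map (π : R →+* ℂ) = flagVec b (T * A) 0 k := by
    intro k
    rw [hr k k.2, flagVec_mul, Fin.sum_univ_castLE (show (k : ℕ) + 1 ≤ N + 1 from k.2) _
      fun l hl => by rw [hT0 _ _ (Fin.lt_def.2 hl), C_0, zero_mul],
      ← Fin.sum_univ_eq_sum_range fun l => C (r k l) * u none l]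
    refine Finset.sum_congr rfl fun l _ => ?_
    have : Fin.castLE k.2 l ≤ k := Nat.lt_succ_iff.1 l.2
    rw [← hAu, hT, if_pos this]
    rfl
  have hTdiag : ∀ k, T k k ≠ 0 := by
    have h1 : wrs (fun k => (η k).map (π : R →+* ℂ)) (N + 1) =
        wrs (flagVec b (T * A) 0) (N + 1) := by
      unfold wrs
      congr 1
      exact funext hηT
    rw [hwrs _ le_rfl, wrs_flagVec_lowerTriangular_mul b hT0 0 le_rfl] at h1
    intro k hk
    refine (hmon (N + 1)).ne_zero ?_
    have h2 : ∏ j : Fin (N + 1), T (Fin.castLE le_rfl j) (Fin.castLE le_rfl j) = 0 :=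
      Finset.prod_eq_zero (i := k) (Finset.mem_univ k) hk
    rw [h1, h2, C_0, zero_mul]
  have hM : M.map π = T * A := by
    ext k i
    rw [Matrix.map_apply, hMb, ← bco_map, hηT, flagVec_coe, bco_inl_sum_cv]
  have hQ : ∀ k j, π (Q k j) = 0 := by
    intro k j
    rw [hQb, ← bco_map, hηT, flagVec_coe, bco_inr_sum_cv]
    simp
  have hMdet : IsUnit M.det := by
    refine hπ _ ?_
    have h1 : π M.det = (M.map π).det := π.map_det M
    rw [h1, hM, Matrix.det_mul, Matrix.det_of_isLowerTriangular T fun k l hkl => hT0 k l hkl]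
    exact mul_ne_zero (Finset.prod_ne_zero_iff.2 fun k _ => hTdiag k) hA.ne_zero
  -- The chart coordinates of the span of `η`, by Cramer's rule.
  let c : Fin (N + 1) × Fin (d - N) → R := fun p => (M⁻¹ * Q) p.1 p.2
  have hc0 : ∀ p, π (c p) = 0 := by
    intro p
    simp only [c, Matrix.mul_apply, map_sum, map_mul, hQ, mul_zero, Finset.sum_const_zero]
  have hMc : ∀ k : Fin (N + 1), η k = flagVec b M c k := by
    intro k
    rw [flagVec_coe]
    refine sum_cv_eq b (hdeg k (Nat.lt_succ_iff.1 k.2)) (fun i => (hMb k i).symm) fun j => ?_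
    have h1 : M * (M⁻¹ * Q) = Q := by
      rw [← Matrix.mul_assoc, Matrix.mul_nonsing_inv M hMdet, Matrix.one_mul]
    have h2 := congrFun (congrFun h1 k) j
    rw [Matrix.mul_apply, hQb] at h2
    exact h2.symm
  let G : Matrix (Fin (N + 1)) (Fin (N + 1)) R := M * A⁻¹.map (algebraMap ℂ R)
  have hGA : G * A.map (algebraMap ℂ R) = M := by
    rw [Matrix.mul_assoc, ← Matrix.map_mul, Matrix.nonsing_inv_mul A hA, Matrix.map_one _
      (map_zero _) (map_one _), Matrix.mul_one]
  have hG : ∀ k l, π (G k l) = T k l := by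
    have h1 : G.map π = T := by
      have h2 : (A⁻¹.map (algebraMap ℂ R)).map π = A⁻¹ := by
        ext i j
        exact π.commutes _
      rw [Matrix.map_mul, hM, h2, Matrix.mul_assoc, Matrix.mul_nonsing_inv A hA, Matrix.mul_one]
    exact fun k l => congrFun (congrFun h1 k) l
  obtain ⟨Λ, hΛ, hΛu, hU, hU1, hU0⟩ := exists_lowerTriangular_mul (π : R →+* ℂ) hπ G
    (fun k l hkl => (hG k l).trans (hT0 k l hkl)) fun k hk => hTdiag k ((hG k k).symm.trans hk)
  refine ⟨c, Λ * G, hc0, fun s => ?_, hU, hU1, hU0, ?_⟩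
  · obtain ⟨L, hLdet, hlow⟩ := hL s
    refine ⟨L * M, by rw [Matrix.det_mul]; exact hLdet.mul hMdet, fun k => ?_⟩
    rw [← flagVec_coe, flagVec_mul]
    simp only [← hMc]
    exact hlow k
  · rw [Matrix.mul_assoc, hGA]
    have hu : ∀ i, ∃ x : Rˣ, ∀ hi : i ≤ N + 1,
        ∏ j : Fin i, Λ (Fin.castLE hi j) (Fin.castLE hi j) = x := by
      intro i
      by_cases hi : i ≤ N + 1
      · refine ⟨IsUnit.unit (Finset.prod_induction (s := Finset.univ) _ (fun x => IsUnit x) (fun _ _ => IsUnit.mul)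
          isUnit_one fun j _ => hΛu (Fin.castLE hi j)), fun _ => ?_⟩
        rw [IsUnit.unit_spec]
      · exact ⟨1, fun h => absurd h hi⟩
    choose x hx using hu
    refine ⟨x, fun i hi => ?_⟩
    rw [wrs_flagVec_lowerTriangular_mul b hΛ c hi, hx, ← hη i hi]
    congr 1
    unfold wrs
    congr 1
    funext j
    exact (hMc (Fin.castLE hi j)).symm

end BasicSituation

namespace BasicSituation

variable {N d n : ℕ} {S : BasicSituation N d n}
variable {V : Submodule ℂ ℂ[X]} {t : S.Var → ℂ} {u : Option (Fin n) → ℕ → ℂ[X]}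
variable {b : Module.Basis (Fin (N + 1) ⊕ Fin (d - N)) ℂ (polySpace d)}

/-! ### The point of `Ã` attached to a flag in a point of `Ω` -/

theorem Bases.natDegree_polyAt {R : Type*} [CommRing R] [Nontrivial R]
    (h : S.Bases V t u) (τ : S.Var → R) {i : ℕ}
    (hi : i ≤ N + 1) : (S.polyAt τ i).natDegree = S.l i := by
  rcases Nat.eq_zero_or_pos i with rfl | h1
  · have := h.wdeg_eq hi
    rw [K_zero] at this
    simp only [wdeg, sa, Finset.range_zero, Finset.sum_empty, natDegree_one] at this
    rw [polyAt_zero, natDegree_one]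
    push_cast at this
    omega
  rcases hi.lt_or_eq with hlt | rfl
  · exact BasicSituation.natDegree_polyAt τ h1 (by omega)
  · have := h.wdeg_eq hi
    rw [wdeg_last] at this
    rw [polyAt_last, natDegree_one]
    omega

theorem Bases.ne_of_level_eq (h : S.Bases V t u) {v w : S.Var} (hvw : v ≠ w)
    (h1 : (v.1 : ℕ) = w.1) : t v ≠ t w := by
  intro h2
  refine h.not_sq_dvd (i := v.1 + 1) (by omega) v.1.2 (t v) ?_
  have h3 : ∏ x ∈ {v, w}, (X - C (t x)) ∣ S.polyAt t (v.1 + 1) := by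
    refine Finset.prod_dvd_prod_of_subset _ _ _ fun x hx => ?_
    rcases Finset.mem_insert.1 hx with rfl | hx
    · simp
    · rw [Finset.mem_singleton] at hx
      simp [hx, h1]
  rwa [Finset.prod_pair hvw, ← h2, ← pow_two] at h3

variable {R : Type*} [CommRing R] [Algebra ℂ R]

theorem Adapted.cv_mem_span {s : Option (Fin n)} {c : Fin (N + 1) × Fin (d - N) → R}
    (h : S.Adapted b s c) : ∃ v : Fin (N + 1) → R[X], (∀ k : Fin (N + 1), S.Low s (S.piv s k) (v k)) ∧
      ∀ i, cv b c i ∈ Submodule.span R (Set.range v) := by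
  obtain ⟨P, hP, hlow⟩ := h
  refine ⟨_, hlow, fun i => ?_⟩
  rw [mem_span_cv b hP]
  exact Submodule.sum_mem _ fun i _ => by
    rw [← smul_eq_C_mul]
    exact Submodule.smul_mem _ _ (Submodule.subset_span ⟨i, rfl⟩)

theorem flagVec_mem_span {c : Fin (N + 1) × Fin (d - N) → R} {W : Submodule R R[X]}
    (hW : ∀ i, cv b c i ∈ W) (M : Matrix (Fin (N + 1)) (Fin (N + 1)) R) (k : ℕ) :
    flagVec b M c k ∈ W := by
  unfold flagVec
  split_ifs
  · exact Submodule.sum_mem _ fun i _ => by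
      rw [← smul_eq_C_mul]
      exact Submodule.smul_mem _ _ (hW i)
  · exact W.zero_mem

/-- The Wronskians of a flag in an `R`-valued point of `Ω` near `V`. -/
theorem Bases.exists_wrs_flagVec_eq (h : S.Bases V t u)
    {A : Matrix (Fin (N + 1)) (Fin (N + 1)) ℂ}
    (hAu : ∀ k : Fin (N + 1), u none k = flagVec b A 0 k)
    (π : R →ₐ[ℂ] ℂ) (hπ : ∀ a, π a ≠ 0 → IsUnit a) {c : Fin (N + 1) × Fin (d - N) → R}
    (hc0 : ∀ p, π (c p) = 0) (hc : ∀ s, S.Adapted b s c)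
    {U : Matrix (Fin (N + 1)) (Fin (N + 1)) R} (hU : U.map π = 1) {i : ℕ} (hi : i ≤ N + 1) :
    ∃ (a : Rˣ) (y : R[X]), wrs (flagVec b (U * A.map (algebraMap ℂ R)) c) i =
        C (a : R) * ((S.K i).map (algebraMap ℂ R) * y) ∧ y.Monic ∧ y.natDegree = S.l i ∧
      y.map (π : R →+* ℂ) = S.polyAt t i := by
  have : Nontrivial R := π.toRingHom.domain_nontrivial
  obtain ⟨a, ha⟩ := h.exists_wrs_eq
  set η := flagVec b (U * A.map (algebraMap ℂ R)) c with hη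
  have hKm : ((S.K i).map (algebraMap ℂ R)).Monic := (S.K_monic i).map _
  have hηmap : ∀ k : Fin (N + 1), (η k).map (π : R →+* ℂ) = u none k := by
    intro k
    rw [hη, flagVec_map, hAu]
    congr 1
    · rw [Matrix.map_mul, hU, Matrix.one_mul]
      ext i j
      exact π.commutes _
    · exact funext hc0
  have hmap : (wrs η i).map (π : R →+* ℂ) = C (a i : ℂ) * (S.K i * S.polyAt t i) := by
    rw [← wrs_map, ← ha i hi]
    unfold wrs
    congr 1
    funext k
    exact hηmap (Fin.castLE hi k)
  have hmem : ∀ s, ∃ v : Fin (N + 1) → R[X], (∀ k : Fin (N + 1), S.Low s (S.piv s k) (v k)) ∧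
      ∀ j, η j ∈ Submodule.span R (Set.range v) := by
    intro s
    obtain ⟨v, hv, hvs⟩ := (hc s).cv_mem_span
    exact ⟨v, hv, fun j => flagVec_mem_span hvs _ j⟩
  choose v hv hvs using hmem
  obtain ⟨g, hg⟩ : (S.K i).map (algebraMap ℂ R) ∣ wrs η i :=
    K_map_dvd_wr (fun s k => v (some s) k) (fun s j => hv (some s) j) hi _ fun s j => hvs _ _
  have hgmap : g.map (π : R →+* ℂ) = C (a i : ℂ) * S.polyAt t i := by
    rw [hg, Polynomial.map_mul, Polynomial.map_map,
      show (π : R →+* ℂ).comp (algebraMap ℂ R) = RingHom.id ℂ from π.comp_algebraMap,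
      Polynomial.map_id] at hmap
    refine mul_left_cancel₀ (S.K_monic i).ne_zero ?_
    rw [hmap]
    ring
  have hl := h.natDegree_polyAt (R := ℂ) t hi
  have hcoeff : π (g.coeff (S.l i)) = a i := by
    have h1 := congrArg (fun p => p.coeff (S.l i)) hgmap
    have h2 : (S.polyAt t i).coeff (S.l i) = 1 := by
      rw [← hl]
      exact polyAt_monic t i
    simp only [coeff_map, coeff_C_mul, h2, mul_one] at h1
    exact h1
  obtain ⟨x, hx⟩ := hπ (g.coeff (S.l i)) (by rw [hcoeff]; exact (a i).ne_zero)
  have hg0 : g ≠ 0 := by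
    rintro rfl
    rw [coeff_zero, map_zero] at hcoeff
    exact (a i).ne_zero hcoeff.symm
  -- The quotient has degree `l_i` and an invertible leading coefficient, namely the one of its
  -- reduction; it is made monic.
  have hgdeg : g.natDegree ≤ S.l i := by
    have h1 := S.natDegree_wr_le (v none) (hv none) hi (fun j : Fin i => η j) fun j => hvs none j
    by_contra hlt
    have h2 := h1 (wrs η i).natDegree (by
      rw [hg, hKm.natDegree_mul' hg0, (S.K_monic i).natDegree_map, h.wdeg_eq hi]
      push_cast
      omega)
    have h3 : (wrs η i).leadingCoeff = 0 := h2
    rw [leadingCoeff_eq_zero, hg] at h3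
    exact hg0 ((hKm.mul_right_eq_zero_iff).1 h3)
  have hcoeff1 : (C (↑x⁻¹ : R) * g).coeff (S.l i) = 1 := by
    rw [coeff_C_mul, ← hx, Units.inv_mul]
  have hdeg1 : (C (↑x⁻¹ : R) * g).natDegree ≤ S.l i := (natDegree_C_mul_le _ _).trans hgdeg
  refine ⟨x, C (↑x⁻¹ : R) * g, ?_, monic_of_natDegree_le_of_coeff_eq_one _ hdeg1 hcoeff1,
    le_antisymm hdeg1 (le_natDegree_of_ne_zero (by rw [hcoeff1]; exact one_ne_zero)), ?_⟩
  · have e1 : C (x : R) * C (↑x⁻¹ : R) = (1 : R[X]) := by rw [← C_mul, Units.mul_inv, C_1]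
    rw [hg]
    linear_combination (-((S.K i).map (algebraMap ℂ R)) * g) * e1
  · have e2 : π (↑x⁻¹ : R) * (a i : ℂ) = 1 := by
      rw [← hcoeff, ← hx, ← map_mul, Units.inv_mul, map_one]
    rw [Polynomial.map_mul, hgmap, map_C, ← mul_assoc, ← C_mul]
    refine (congrArg (fun z => C z * S.polyAt t i) e2).trans ?_
    rw [C_1, one_mul]

/-- A monic polynomial over a Henselian ring splits if its reduction has simple roots. -/
theorem Bases.exists_roots (h : S.Bases V t u) (π : R →ₐ[ℂ] ℂ) (hπ : ∀ a, π a ≠ 0 → IsUnit a)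
    (hens : ∀ (F : R[X]) (x : ℂ), F.Monic → (F.map (π : R →+* ℂ)).eval x = 0 →
      (derivative (F.map (π : R →+* ℂ))).eval x ≠ 0 → ∃ a, F.eval a = 0 ∧ π a = x)
    (y : ℕ → R[X]) (hy : ∀ i ≤ N + 1, (y i).Monic ∧ (y i).natDegree = S.l i ∧
      (y i).map (π : R →+* ℂ) = S.polyAt t i) :
    ∃ τ : S.Var → R, (∀ v, π (τ v) = t v) ∧ ∀ i ≤ N + 1, y i = S.polyAt τ i := by
  have : Nontrivial R := π.toRingHom.domain_nontrivial
  have hex : ∀ v : S.Var, ∃ a, (y (v.1 + 1)).eval a = 0 ∧ π a = t v := by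
    intro v
    obtain ⟨h1, -, h3⟩ := hy (v.1 + 1) (by omega)
    refine hens _ _ h1 ?_ ?_
    · rw [h3, ← IsRoot.def, ← dvd_iff_isRoot]
      exact Finset.dvd_prod_of_mem (fun v => X - C (t v)) (by simp)
    · rw [h3]
      intro h0
      obtain ⟨g, hg⟩ : X - C (t v) ∣ S.polyAt t (v.1 + 1) :=
        Finset.dvd_prod_of_mem (fun v => X - C (t v)) (by simp)
      have h4 : g.IsRoot (t v) := by
        rw [hg] at h0
        simpa [derivative_mul] using h0
      refine h.not_sq_dvd (i := v.1 + 1) (by omega) v.1.2 (t v) ?_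
      rw [hg, pow_two]
      exact mul_dvd_mul_left _ (dvd_iff_isRoot.2 h4)
  choose τ hτ hτt using hex
  refine ⟨τ, hτt, fun i hi => ?_⟩
  obtain ⟨h1, h2, -⟩ := hy i hi
  refine eq_of_monic_of_dvd_of_natDegree_le (polyAt_monic τ i) h1 ?_
    (by rw [h2, h.natDegree_polyAt τ hi])
  refine Finset.prod_dvd_of_coprime (fun v hv w hw hvw => ?_) fun v hv => ?_
  · simp only [Finset.coe_filter, Finset.mem_univ, true_and, Set.mem_ofPred_eq] at hv hw
    refine isCoprime_X_sub_C_of_isUnit_sub (hπ _ ?_)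
    rw [map_sub, hτt, hτt]
    exact sub_ne_zero.2 (h.ne_of_level_eq hvw (by omega))
  · simp only [Finset.mem_filter, Finset.mem_univ, true_and] at hv
    rw [dvd_iff_isRoot, ← hv]
    exact hτ v

/-- A flag in a point of `Ω` near `V` defines a point of `Ã` near `t`. -/
theorem Bases.exists_point (h : S.Bases V t u)
    {A : Matrix (Fin (N + 1)) (Fin (N + 1)) ℂ}
    (hAu : ∀ k : Fin (N + 1), u none k = flagVec b A 0 k)
    (π : R →ₐ[ℂ] ℂ) (hπ : ∀ a, π a ≠ 0 → IsUnit a)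
    (hens : ∀ (F : R[X]) (x : ℂ), F.Monic → (F.map (π : R →+* ℂ)).eval x = 0 →
      (derivative (F.map (π : R →+* ℂ))).eval x ≠ 0 → ∃ a, F.eval a = 0 ∧ π a = x)
    {c : Fin (N + 1) × Fin (d - N) → R} (hc0 : ∀ p, π (c p) = 0) (hc : ∀ s, S.Adapted b s c)
    {U : Matrix (Fin (N + 1)) (Fin (N + 1)) R} (hU : U.map π = 1) :
    ∃ f : S.RegFun →ₐ[ℂ] R, (∀ a ∈ S.divisibilityIdeal, f a = 0) ∧
      (∀ v, π (f (S.coord v)) = t v) ∧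
      ∃ a : ℕ → Rˣ, ∀ i ≤ N + 1, wrs (flagVec b (U * A.map (algebraMap ℂ R)) c) i =
        C (a i : R) * ((S.K i).map (algebraMap ℂ R) * pointPoly f i) := by
  have hex : ∀ i, ∃ (a : Rˣ) (y : R[X]), i ≤ N + 1 →
      wrs (flagVec b (U * A.map (algebraMap ℂ R)) c) i =
        C (a : R) * ((S.K i).map (algebraMap ℂ R) * y) ∧ y.Monic ∧ y.natDegree = S.l i ∧
      y.map (π : R →+* ℂ) = S.polyAt t i := by
    intro i
    by_cases hi : i ≤ N + 1
    · obtain ⟨a, y, hay⟩ := h.exists_wrs_flagVec_eq hAu π hπ hc0 hc hU hi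
      exact ⟨a, y, fun _ => hay⟩
    · exact ⟨1, 0, fun h => absurd h hi⟩
  choose a y hay using hex
  obtain ⟨τ, hτ, hyτ⟩ := h.exists_roots π hπ hens y fun i hi => (hay i hi).2
  obtain ⟨f, hf⟩ := exists_algHom_of_isUnit_discr τ (hπ _ (by
    have h1 : π (MvPolynomial.aeval τ S.discr) = MvPolynomial.aeval (fun v => π (τ v)) S.discr :=
      MvPolynomial.comp_aeval_apply (f := τ) π S.discr
    rw [h1, funext hτ, MvPolynomial.aeval_eq_eval]
    exact h.eval_discr_ne_zero))
  have hfτ : (fun v => f (S.coord v)) = τ := by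
    funext v
    rw [coord, hf, MvPolynomial.aeval_X]
  have hwr : ∀ i ≤ N + 1, wrs (flagVec b (U * A.map (algebraMap ℂ R)) c) i =
      C (a i : R) * ((S.K i).map (algebraMap ℂ R) * pointPoly f i) := by
    intro i hi
    rw [pointPoly, hfτ, ← hyτ i hi]
    exact (hay i hi).1
  refine ⟨f, (forall_divisibilityIdeal_eq_zero_iff f).2 fun i h1 hi => ?_, fun v => ?_, a, hwr⟩
  · choose v hv hvs using fun s => (hc (some s)).cv_mem_span
    exact dvd_wronskian_of_wrs_eq _ v hv (fun s j _ => flagVec_mem_span (hvs s) _ j) _ a hwr h1 hi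
  · rw [congrFun hfτ v, hτ]

end BasicSituation

/-! ### Power series over an Artinian local ring -/

namespace MvPowerSeries

theorem mem_span_range_X {σ B : Type*} [Finite σ] [CommRing B] (f : MvPowerSeries σ B)
    (hf : constantCoeff f = 0) : f ∈ Ideal.span (Set.range (X : σ → MvPowerSeries σ B)) := by
  classical
  have := Fintype.ofFinite σ
  -- Every nonconstant monomial is attributed to one of the variables which divide it.
  have hex : ∀ m : σ →₀ ℕ, ∃ i : Option σ, m ≠ 0 → ∃ j ∈ m.support, i = some j := by
    intro m
    by_cases hm : m = 0
    · exact ⟨none, fun h => absurd hm h⟩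
    · obtain ⟨j, hj⟩ := Finsupp.support_nonempty_iff.2 hm
      exact ⟨some j, fun _ => ⟨j, hj, rfl⟩⟩
  choose ι hι using hex
  let g : σ → MvPowerSeries σ B := fun i m =>
    if ι (m + Finsupp.single i 1) = some i then coeff (m + Finsupp.single i 1) f else 0
  have hg : ∀ i m, coeff m (g i) =
      if ι (m + Finsupp.single i 1) = some i then coeff (m + Finsupp.single i 1) f else 0 :=
    fun _ _ => rfl
  have key : f = ∑ i, X i * g i := by
    ext m
    have hcoeff : ∀ i, coeff m (X i * g i) =
        if Finsupp.single i 1 ≤ m ∧ ι m = some i then coeff m f else 0 := by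
      intro i
      rw [X_def, coeff_monomial_mul]
      by_cases hi : Finsupp.single i 1 ≤ m
      · simp only [hi, if_true, true_and, hg, tsub_add_cancel_of_le hi, one_mul]
      · simp [hi]
    rw [map_sum]
    simp only [hcoeff]
    by_cases hm : m = 0
    · subst hm
      have h0 : coeff 0 f = 0 := hf
      simp [h0]
    · obtain ⟨j, hj, hj2⟩ := hι m hm
      have hjm : Finsupp.single j 1 ≤ m := by
        rw [Finsupp.single_le_iff]
        exact Nat.one_le_iff_ne_zero.2 (Finsupp.mem_support_iff.1 hj)
      rw [Finset.sum_eq_single j, if_pos ⟨hjm, hj2⟩]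
      · intro i _ hi
        rw [if_neg]
        rintro ⟨-, h⟩
        rw [hj2] at h
        exact hi (Option.some_injective _ h).symm
      · exact fun h => absurd (Finset.mem_univ j) h
  rw [key]
  exact Ideal.sum_mem _ fun i _ => Ideal.mul_mem_right _ _ (Ideal.subset_span ⟨i, rfl⟩)

variable {B : Type*} [CommRing B] [Algebra ℂ B]

/-- The residue map of the ring of power series over a local ring with residue map `π`. -/
def augmentation (σ : Type*) (π : B →ₐ[ℂ] ℂ) : MvPowerSeries σ B →ₐ[ℂ] ℂ :=
  { (π : B →+* ℂ).comp (constantCoeff (σ := σ) (R := B)) with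
    commutes' := fun r => by
      change π (constantCoeff (algebraMap ℂ (MvPowerSeries σ B) r)) = _
      rw [algebraMap_apply, constantCoeff_C]
      exact π.commutes r }

variable {σ : Type*}

theorem augmentation_apply (π : B →ₐ[ℂ] ℂ) (f : MvPowerSeries σ B) :
    augmentation σ π f = π (constantCoeff f) := rfl

theorem isUnit_of_augmentation_ne_zero {π : B →ₐ[ℂ] ℂ} (hπ : ∀ a, π a ≠ 0 → IsUnit a)
    (f : MvPowerSeries σ B) (hf : augmentation σ π f ≠ 0) : IsUnit f :=
  isUnit_iff_constantCoeff.2 (hπ _ hf)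

/-- Simple roots lift to power series over an Artinian local ring: at first to the Artinian ring by
Newton's method, and then to the power series by Hensel's lemma. -/
theorem exists_eval_eq_zero [Finite σ] {π : B →ₐ[ℂ] ℂ} (hπ : ∀ a, π a ≠ 0 → IsUnit a)
    (hnil : ∀ a, π a = 0 → IsNilpotent a) (F : (MvPowerSeries σ B)[X]) (x : ℂ) (hF : F.Monic)
    (h0 : (F.map (augmentation σ π : MvPowerSeries σ B →+* ℂ)).eval x = 0)
    (h1 : (derivative (F.map (augmentation σ π : MvPowerSeries σ B →+* ℂ))).eval x ≠ 0) :
    ∃ a, F.eval a = 0 ∧ augmentation σ π a = x := by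
  let P : B[X] := F.map constantCoeff
  have hP : ∀ G : (MvPowerSeries σ B)[X], ∀ r : B,
      π ((G.map (constantCoeff (σ := σ) (R := B))).eval r) =
        (G.map (augmentation σ π : MvPowerSeries σ B →+* ℂ)).eval (π r) := by
    intro G r
    have h2 := eval₂_at_apply (p := G.map (constantCoeff (σ := σ) (R := B))) (π : B →+* ℂ) r
    rw [← eval_map, Polynomial.map_map] at h2
    exact h2.symm
  have hπx : π (algebraMap ℂ B x) = x := π.commutes x
  obtain ⟨r, ⟨hr1, hr2⟩, -⟩ := existsUnique_nilpotent_sub_and_aeval_eq_zero (P := P)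
    (x := algebraMap ℂ B x)
    (by
      refine hnil _ ?_
      rw [coe_aeval_eq_eval, hP, hπx, h0])
    (by
      refine hπ _ ?_
      rw [coe_aeval_eq_eval, derivative_map, hP, hπx, ← derivative_map]
      exact h1)
  rw [coe_aeval_eq_eval] at hr2
  have hr : π r = x := by
    have h2 := (hr1.map π).eq_zero
    rw [map_sub, hπx, sub_eq_zero] at h2
    exact h2.symm
  have hev : ∀ G : (MvPowerSeries σ B)[X],
      constantCoeff (G.eval (C r)) = (G.map (constantCoeff (σ := σ) (R := B))).eval r := by
    intro G
    have h2 := eval₂_at_apply (p := G) (constantCoeff (σ := σ) (R := B)) (C r)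
    rw [← h2, ← eval_map, constantCoeff_C]
  obtain ⟨a, ha1, ha2⟩ := HenselianRing.is_henselian
    (I := Ideal.span (Set.range (X : σ → MvPowerSeries σ B))) F hF (C r)
    (mem_span_range_X _ ((hev F).trans hr2)) (by
      refine IsUnit.map _ (isUnit_of_augmentation_ne_zero hπ _ ?_)
      rw [augmentation_apply, hev, hP, hr, ← derivative_map]
      exact h1)
  refine ⟨a, ha1, ?_⟩
  have h3 : constantCoeff (a - C r) = 0 := by
    have : Ideal.span (Set.range (X : σ → MvPowerSeries σ B)) ≤
        RingHom.ker (constantCoeff (σ := σ) (R := B)) := by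
      refine Ideal.span_le.2 ?_
      rintro _ ⟨i, rfl⟩
      exact constantCoeff_X i
    exact this ha2
  rw [map_sub, constantCoeff_C, sub_eq_zero] at h3
  rw [augmentation_apply, h3, hr]

end MvPowerSeries

namespace BasicSituation

variable {N d n : ℕ} {S : BasicSituation N d n}
variable {V : Submodule ℂ ℂ[X]} {t : S.Var → ℂ} {u : Option (Fin n) → ℕ → ℂ[X]}
variable {b : Module.Basis (Fin (N + 1) ⊕ Fin (d - N)) ℂ (polySpace d)}

/-! ### Comparison of the local rings -/

theorem regFun_algHom_ext {R : Type*} [CommRing R] [Algebra ℂ R] {f g : S.RegFun →ₐ[ℂ] R}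
    (h : ∀ v, f (S.coord v) = g (S.coord v)) : f = g := by
  refine IsLocalization.algHom_ext (W := Submonoid.powers S.discr) ?_
  refine MvPolynomial.algHom_ext fun v => ?_
  exact h v

theorem pointPoly_comp {R R' : Type*} [CommRing R] [Algebra ℂ R] [CommRing R'] [Algebra ℂ R']
    (f : S.RegFun →ₐ[ℂ] R) (g : R →ₐ[ℂ] R') (i : ℕ) :
    (pointPoly f i).map (g : R →+* R') = pointPoly (g.comp f) i := polyAt_map _ _ _

theorem eq_of_C_mul_monic_eq {R : Type*} [CommRing R] {a a' : R} {K P Q : R[X]} (ha : IsUnit a)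
    (hK : K.Monic) (hP : P.Monic) (hQ : Q.Monic) (h : C a * (K * P) = C a' * (K * Q)) : P = Q := by
  have h1 := congrArg leadingCoeff h
  rw [leadingCoeff_mul_monic (hK.mul hP), leadingCoeff_mul_monic (hK.mul hQ), leadingCoeff_C,
    leadingCoeff_C] at h1
  rw [← h1] at h
  exact hK.isRegular.left ((ha.map C).mul_left_cancel h)

/-- The pairs of indices of the entries of a matrix above the diagonal. -/
abbrev UpperIdx (N : ℕ) : Type := {p : Fin (N + 1) × Fin (N + 1) // p.1 < p.2}

/-- The generic upper unitriangular matrix. -/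
def genericUpper (N : ℕ) (B : Type*) [CommRing B] :
    Matrix (Fin (N + 1)) (Fin (N + 1)) (MvPowerSeries (UpperIdx N) B) :=
  Matrix.of fun k l => if h : k < l then MvPowerSeries.X ⟨(k, l), h⟩ else if k = l then 1 else 0

/-- The relation between a flag and its Wronskians is preserved by base change. -/
theorem flagVec_wrs_map {R R' : Type*} [CommRing R] [Algebra ℂ R] [CommRing R'] [Algebra ℂ R']
    (F : R →ₐ[ℂ] R') {A : Matrix (Fin (N + 1)) (Fin (N + 1)) ℂ}
    {U : Matrix (Fin (N + 1)) (Fin (N + 1)) R} {c : Fin (N + 1) × Fin (d - N) → R}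
    {f : S.RegFun →ₐ[ℂ] R} {a : R} {i : ℕ}
    (h : wrs (flagVec b (U * A.map (algebraMap ℂ R)) c) i =
      C a * ((S.K i).map (algebraMap ℂ R) * pointPoly f i)) :
    wrs (flagVec b (U.map F * A.map (algebraMap ℂ R')) fun p => F (c p)) i =
      C (F a) * ((S.K i).map (algebraMap ℂ R') * pointPoly (F.comp f) i) := by
  have h1 := congrArg (Polynomial.map (F : R →+* R')) h
  rw [← wrs_map, Polynomial.map_mul, Polynomial.map_mul, map_C, pointPoly_comp,
    Polynomial.map_map, show (F : R →+* R').comp (algebraMap ℂ R) = algebraMap ℂ R' from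
      F.comp_algebraMap] at h1
  refine Eq.trans ?_ h1
  congr 1
  funext k
  rw [flagVec_map, Matrix.map_mul]
  congr 2
  ext i j
  exact (F.commutes _).symm

/-- A homomorphism which kills the coordinates of the normal form kills the maximal ideal of the
local ring of `Ã` at `t`; that is, these coordinates generate the maximal ideal. -/
theorem Bases.map_eq_zero (h : S.Bases V t u) {A : Matrix (Fin (N + 1)) (Fin (N + 1)) ℂ}
    (hAu : ∀ k : Fin (N + 1), u none k = flagVec b A 0 k)
    {o : Ideal S.RegFun} [o.IsPrime] {J : Ideal S.RegFun} (ρ : S.RegFun →ₐ[ℂ] ℂ)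
    (hρ : ∀ v, ρ (S.coord v) = t v) (π : LocQuot o J →ₐ[ℂ] ℂ)
    (hπρ : ∀ a, π (algebraMap S.RegFun _ a) = ρ a) (hπ : ∀ a, π a ≠ 0 → IsUnit a)
    {c : Fin (N + 1) × Fin (d - N) → LocQuot o J}
    {U : Matrix (Fin (N + 1)) (Fin (N + 1)) (LocQuot o J)}
    (hU : ∀ k l, l < k → U k l = 0) (hU1 : ∀ k, U k k = 1) (a : ℕ → (LocQuot o J)ˣ)
    (ha : ∀ i ≤ N + 1, wrs (flagVec b (U * A.map (algebraMap ℂ _)) c) i = C (a i : LocQuot o J) *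
      ((S.K i).map (algebraMap ℂ _) *
        pointPoly (IsScalarTower.toAlgHom ℂ S.RegFun (LocQuot o J)) i))
    {D : Type*} [CommRing D] [Algebra ℂ D] (q : LocQuot o J →ₐ[ℂ] D) (hqc : ∀ p, q (c p) = 0)
    (hqU : ∀ k l, k < l → q (U k l) = 0) (x : LocQuot o J) (hx : π x = 0) : q x = 0 := by
  let f₀ := IsScalarTower.toAlgHom ℂ S.RegFun (LocQuot o J)
  have hUq : U.map q = 1 := by
    ext k l
    rw [Matrix.map_apply]
    rcases lt_trichotomy k l with hlt | rfl | hlt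
    · rw [hqU k l hlt, Matrix.one_apply_ne hlt.ne]
    · rw [hU1, Matrix.one_apply_eq, map_one]
    · rw [hU k l hlt, Matrix.one_apply_ne hlt.ne', map_zero]
  have hcq : (fun p => q (c p)) = fun p => Algebra.ofId ℂ D
      ((0 : Fin (N + 1) × Fin (d - N) → ℂ) p) := by
    funext p
    rw [hqc, Pi.zero_apply, map_zero]
  obtain ⟨a', ha'⟩ := h.exists_wrs_eq
  -- Over `D` the normal form is constant, and therefore so are the polynomials `y_i`.
  have hpoly : ∀ i ≤ N + 1, pointPoly (q.comp f₀) i =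
      S.polyAt (fun v => algebraMap ℂ D (t v)) i := by
    intro i hi
    have h1 := flagVec_wrs_map q (ha i hi)
    have h2 : wrs (u none) i = wrs (flagVec b A 0) i := by
      unfold wrs
      congr 1
      exact funext fun k : Fin i => hAu (Fin.castLE hi k)
    have h3 := congrArg (Polynomial.map (algebraMap ℂ D)) (ha' i hi)
    have h4 : ∀ k, (flagVec b A 0 k).map (algebraMap ℂ D) =
        flagVec b (A.map (algebraMap ℂ D))
          (fun p => Algebra.ofId ℂ D
            ((0 : Fin (N + 1) × Fin (d - N) → ℂ) p)) k := fun k =>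
      flagVec_map b (Algebra.ofId ℂ D) A 0 k
    rw [h2, ← wrs_map, Polynomial.map_mul, Polynomial.map_mul, map_C, polyAt_map, funext h4] at h3
    rw [hUq, Matrix.one_mul, hcq, h3] at h1
    exact (eq_of_C_mul_monic_eq ((a' i).isUnit.map _) ((S.K_monic i).map _) (polyAt_monic _ i)
      (polyAt_monic _ i) h1).symm
  -- The roots are simple, and two roots with the same reduction coincide.
  have hcoord : ∀ v, q (f₀ (S.coord v)) = algebraMap ℂ _ (t v) := by
    intro v
    have h1 : (pointPoly (q.comp f₀) (v.1 + 1)).eval (q (f₀ (S.coord v))) = 0 := by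
      rw [← IsRoot.def, ← dvd_iff_isRoot]
      exact Finset.dvd_prod_of_mem (fun v => X - C (q.comp f₀ (S.coord v))) (by simp)
    rw [hpoly _ (by omega), polyAt, eval_prod, ← Finset.mul_prod_erase _ _ (a := v) (by simp)] at h1
    have h2 : IsUnit (∏ w ∈ (Finset.univ.filter fun w : S.Var => (w.1 : ℕ) + 1 = v.1 + 1).erase v,
        (X - C (algebraMap ℂ D (t w))).eval (q (f₀ (S.coord v)))) := by
      refine Finset.prod_induction _ (fun x => IsUnit x) (fun _ _ => IsUnit.mul) isUnit_one
        fun w hw => ?_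
      simp only [Finset.mem_erase, Finset.mem_filter, Finset.mem_univ, true_and] at hw
      have h3 : IsUnit (f₀ (S.coord v) - algebraMap ℂ _ (t w)) := by
        refine hπ _ ?_
        rw [map_sub, AlgHom.commutes]
        refine sub_ne_zero.2 fun h4 => h.ne_of_level_eq hw.1.symm (by omega) ?_
        rw [← hρ v, ← hπρ]
        exact h4
      have h4 := h3.map q
      rw [map_sub, AlgHom.commutes] at h4
      rwa [eval_sub, eval_X, eval_C]
    rw [h2.mul_left_eq_zero, eval_sub, eval_X, eval_C, sub_eq_zero] at h1
    exact h1
  have hqρ : q.comp f₀ = (Algebra.ofId ℂ _).comp ρ := regFun_algHom_ext fun v => by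
    rw [AlgHom.comp_apply, AlgHom.comp_apply, hρ]
    exact hcoord v
  obtain ⟨r, y, hy, hxy⟩ := LocQuot.exists_mul_eq x
  have hr : ρ r = 0 := by rw [← hπρ, ← hxy, map_mul, hx, zero_mul]
  have h1 : q (algebraMap S.RegFun _ r) = 0 := by
    have h2 := DFunLike.congr_fun hqρ r
    rw [AlgHom.comp_apply, AlgHom.comp_apply, hr, map_zero] at h2
    exact h2
  rw [← hxy, map_mul, ((LocQuot.isUnit_algebraMap hy).map q).mul_left_eq_zero] at h1
  exact h1

end BasicSituation

namespace BasicSituation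

variable {N d n : ℕ} {S : BasicSituation N d n}
variable {V : Submodule ℂ ℂ[X]} {t : S.Var → ℂ} {u : Option (Fin n) → ℕ → ℂ[X]}
variable {b : Module.Basis (Fin (N + 1) ⊕ Fin (d - N)) ℂ (polySpace d)}

/-- Every ideal is the kernel of a homomorphism. In this form the construction of the quotient is
hidden, so that quotients of quotients of localizations are never unfolded. -/
theorem exists_algHom_ker.{v} {R : Type v} [CommRing R] [Algebra ℂ R] (I : Ideal R) :
    ∃ (D : Type v) (_ : CommRing D) (_ : Algebra ℂ D) (q : R →ₐ[ℂ] D), ∀ x, q x = 0 ↔ x ∈ I :=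
  ⟨R ⧸ I, inferInstance, inferInstance, Ideal.Quotient.mkₐ ℂ I,
    fun _ => Ideal.Quotient.eq_zero_iff_mem⟩

/-- The universal property of the local ring of `Ω`: a space over a local ring which satisfies the
Schubert conditions and specialises to `V` is pulled back from the local ring of `Ω`. -/
theorem exists_omega_lift {R : Type*} [CommRing R] [Algebra ℂ R] (π : R →ₐ[ℂ] ℂ)
    (hπ : ∀ a, π a ≠ 0 → IsUnit a) {c : Fin (N + 1) × Fin (d - N) → R} (hc0 : ∀ p, π (c p) = 0)
    (hc : ∀ s, S.Adapted b s c) :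
    ∃ g : S.OmegaRing b →ₐ[ℂ] R, ∀ p, g (S.omegaCoord b p) = c p := by
  obtain ⟨g, hg⟩ := LocQuot.exists_lift
    (o := (MvPolynomial.pointToPoint (0 : Fin (N + 1) × Fin (d - N) → ℂ)).asIdeal)
    (I := S.omegaIdeal b) (MvPolynomial.aeval c)
    (fun a ha => hπ _ fun h0 => ha ((mem_pointToPoint_zero a).2 (by
      have h1 : π (MvPolynomial.aeval c a) = MvPolynomial.aeval (fun p => π (c p)) a :=
        MvPolynomial.comp_aeval_apply (f := c) π a
      rw [h0, funext hc0] at h1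
      exact h1.symm)))
    (fun a ha => by
      have h1 : S.omegaIdeal b ≤ RingHom.ker (MvPolynomial.aeval c : _ →ₐ[ℂ] R) :=
        iSup_le fun s a ha => (hc s).aeval_eq_zero b ha
      exact h1 ha)
  exact ⟨g, fun p => by rw [omegaCoord, hg, MvPolynomial.aeval_X]⟩

theorem omega_algHom_ext {R : Type*} [CommRing R] [Algebra ℂ R] {f g : S.OmegaRing b →ₐ[ℂ] R}
    (h : ∀ p, f (S.omegaCoord b p) = g (S.omegaCoord b p)) : f = g := by
  refine LocQuot.algHom_ext fun a => ?_
  rw [← aeval_omegaCoord]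
  have h1 := MvPolynomial.comp_aeval_apply (f := S.omegaCoord b) f a
  have h2 := MvPolynomial.comp_aeval_apply (f := S.omegaCoord b) g a
  rw [h1, h2]
  congr 2
  exact funext h

/-- The universal flag near `(V, E)` in the universal family of spaces over the local ring of `Ω`
defines a homomorphism `f` from the regular functions on `R̃°` to power series over this local
ring. It extends to the local ring of `Ã` at `t`, and the coordinates of the normal form show that
the local ring of `Ã` at `t` and the power series ring agree up to completion. -/
theorem Bases.exists_comparison (h : S.Bases V t u) (hb : chartPoint b 0 = V)
    (hcell : ∀ s, chartPoint b 0 ∈ S.cell s) :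
    ∃ (πB : S.OmegaRing b →ₐ[ℂ] ℂ)
      (f : S.RegFun →ₐ[ℂ] MvPowerSeries (UpperIdx N) (S.OmegaRing b)),
      (∀ x, πB x ≠ 0 → IsUnit x) ∧ IsNilpotent (RingHom.ker πB) ∧
      (∀ a ∈ S.divisibilityIdeal, f a = 0) ∧
      (∀ v, MvPowerSeries.augmentation _ πB (f (S.coord v)) = t v) ∧
      ∀ (o : Ideal S.RegFun) [o.IsPrime],
        (∀ a, a ∈ o ↔ MvPowerSeries.augmentation _ πB (f a) = 0) →
        ∃ (g : S.OmegaRing b →ₐ[ℂ] LocQuot o S.divisibilityIdeal)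
          (r : UpperIdx N → LocQuot o S.divisibilityIdeal)
          (F : LocQuot o S.divisibilityIdeal →ₐ[ℂ]
            MvPowerSeries (UpperIdx N) (S.OmegaRing b)),
          (∀ a, F (algebraMap S.RegFun _ a) = f a) ∧ (∀ x, F (g x) = MvPowerSeries.C x) ∧
          (∀ i, F (r i) = MvPowerSeries.X i) ∧
          ∀ x, MvPowerSeries.augmentation _ πB (F x) = 0 →
            x ∈ (RingHom.ker πB).map g ⊔ Ideal.span (Set.range r) := by
  obtain ⟨A, hA, hAu⟩ := h.exists_matrix hb
  obtain ⟨πB, hπB0, hπB, hker⟩ := exists_omega_augmentation hcell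
  have hle : RingHom.ker πB ≤ Ideal.span (Set.range (S.omegaCoord b)) := fun x hx => hker x hx
  obtain ⟨k, hk⟩ := isNilpotent_span_omegaCoord hcell
  have hnil : IsNilpotent (RingHom.ker πB) :=
    ⟨k, le_bot_iff.1 ((Ideal.pow_right_mono hle k).trans hk.le)⟩
  have hnil' : ∀ x, πB x = 0 → IsNilpotent x := fun x hx =>
    ⟨k, (Ideal.mem_bot (R := S.OmegaRing b)).1 (hk.le (Ideal.pow_mem_pow (hker x hx) k))⟩
  let ι := IsScalarTower.toAlgHom ℂ (S.OmegaRing b) (MvPowerSeries (UpperIdx N) (S.OmegaRing b))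
  have hι : ∀ x, ι x = MvPowerSeries.C x := fun x => MvPowerSeries.algebraMap_apply
  let πs := MvPowerSeries.augmentation (UpperIdx N) πB
  have hπs : ∀ a, πs a ≠ 0 → IsUnit a := MvPowerSeries.isUnit_of_augmentation_ne_zero hπB
  have had : ∀ s, S.Adapted b s (S.omegaCoord b) := by
    intro s
    obtain ⟨Q, hQ, hQlow⟩ := exists_reduced_omegaCoord hcell s
    exact ⟨Q, hQ, fun k => (hQlow k).1⟩
  have hX : ∀ k l, k < l → πs (genericUpper N (S.OmegaRing b) k l) = 0 := by
    intro k l hkl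
    rw [genericUpper, Matrix.of_apply, dif_pos hkl]
    exact (congrArg πB (MvPowerSeries.constantCoeff_X _)).trans (map_zero _)
  have hX0 : ∀ k l, l < k → genericUpper N (S.OmegaRing b) k l = 0 := by
    intro k l hkl
    rw [genericUpper, Matrix.of_apply, dif_neg hkl.not_gt, if_neg hkl.ne']
  have hX1 : ∀ k, genericUpper N (S.OmegaRing b) k k = 1 := by
    intro k
    rw [genericUpper, Matrix.of_apply, dif_neg (lt_irrefl _), if_pos rfl]
  -- The point of `Ã` attached to the generic flag in the universal space.
  obtain ⟨f, hfJ, hft, a₁, ha₁⟩ := h.exists_point hAu πs hπs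
    (MvPowerSeries.exists_eval_eq_zero hπB hnil') (c := fun p => ι (S.omegaCoord b p))
    (fun p => by
      rw [hι]
      exact (congrArg πB (MvPowerSeries.constantCoeff_C _)).trans (hπB0 p))
    (fun s => (had s).map b ι) (U := genericUpper N (S.OmegaRing b)) (by
      ext k l
      rw [Matrix.map_apply]
      rcases lt_trichotomy k l with hlt | rfl | hlt
      · rw [hX k l hlt, Matrix.one_apply_ne hlt.ne]
      · rw [hX1, map_one, Matrix.one_apply_eq]
      · rw [hX0 k l hlt, map_zero, Matrix.one_apply_ne hlt.ne'])
  refine ⟨πB, f, hπB, hnil, hfJ, hft, fun o _ ho => ?_⟩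
  obtain ⟨π, hπf, hπ⟩ := LocQuot.exists_augmentation (I := S.divisibilityIdeal) (πs.comp f) ho
    fun a ha => (ho a).2 (by rw [hfJ a ha, map_zero])
  obtain ⟨F, hF⟩ := LocQuot.exists_lift (o := o) (I := S.divisibilityIdeal) f
    (fun a ha => hπs _ fun h0 => ha ((ho a).2 h0)) hfJ
  have hπF : πs.comp F = π := LocQuot.algHom_ext fun a => by
    rw [AlgHom.comp_apply, hF, hπf, AlgHom.comp_apply]
  let f₀ := IsScalarTower.toAlgHom ℂ S.RegFun (LocQuot o S.divisibilityIdeal)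
  have hf₀ : F.comp f₀ = f := AlgHom.ext hF
  -- The normal form of the flag attached to the universal point of `Ã`.
  obtain ⟨c, U, hc0, hc, hU, hU1, hU0, a₂, ha₂⟩ := h.exists_normalForm (b := b) hA hAu (f := f₀)
    (fun a ha => Ideal.Quotient.eq_zero_iff_mem.2 (Ideal.mem_map_of_mem _ ha)) π hπ
    fun v => (hπf _).trans (hft v)
  obtain ⟨g, hg⟩ := exists_omega_lift π hπ hc0 hc
  have hA' : IsUnit (A.map
      (algebraMap ℂ (MvPowerSeries (UpperIdx N) (S.OmegaRing b)))).det := by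
    have h1 := RingHom.map_det (algebraMap ℂ (MvPowerSeries (UpperIdx N) (S.OmegaRing b))) A
    rw [RingHom.mapMatrix_apply] at h1
    rw [← h1]
    exact hA.map _
  -- The image of this normal form under `F` has the same Wronskians as the generic flag, and
  -- therefore coincides with it.
  obtain ⟨hUX, hcX⟩ := eq_of_wrs_flagVec_eq b hA' hX0 hX1 (U' := U.map F)
    (c' := fun p => F (c p)) (fun k l hkl => by rw [Matrix.map_apply, hU k l hkl, map_zero])
    (fun k => by rw [Matrix.map_apply, hU1, map_one])
    (fun i => (S.K i).map (algebraMap ℂ _) * pointPoly f i)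
    (fun i _ => ((S.K_monic i).map _).mul (polyAt_monic _ i)) a₁
    (fun i => Units.map (F : LocQuot o S.divisibilityIdeal →* _) (a₂ i)) ha₁ fun i hi => by
      have h1 := flagVec_wrs_map F (ha₂ i hi)
      rw [hf₀] at h1
      exact h1
  have hFg : F.comp g = ι := omega_algHom_ext fun p => by
    rw [AlgHom.comp_apply, hg]
    exact congrFun hcX p
  refine ⟨g, fun i => U i.1.1 i.1.2, F, hF, fun x => ?_, fun i => ?_, fun x hx => ?_⟩
  · rw [← hι, ← hFg, AlgHom.comp_apply]
  · have h1 := congrFun (congrFun hUX i.1.1) i.1.2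
    rw [Matrix.map_apply, genericUpper, Matrix.of_apply, dif_pos i.2] at h1
    exact h1
  · obtain ⟨D, _, _, q, hq⟩ := exists_algHom_ker
      ((RingHom.ker πB).map g ⊔ Ideal.span (Set.range fun i : UpperIdx N => U i.1.1 i.1.2))
    refine (hq x).1 (h.map_eq_zero hAu (πs.comp f) hft π hπf hπ hU hU1 a₂ ha₂ q (fun p => ?_)
      (fun k l hkl => ?_) x ?_)
    · refine (hq _).2 (Ideal.mem_sup_left ?_)
      rw [← hg]
      exact Ideal.mem_map_of_mem _ (hπB0 p)
    · exact (hq _).2 (Ideal.mem_sup_right (Ideal.subset_span ⟨⟨(k, l), hkl⟩, rfl⟩))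
    · rw [← hπF]
      exact hx

end BasicSituation

/-! ### Lengths and extensions of local rings -/

section Length

open IsLocalRing

theorem Module.length_eq_add_ker_factor {R : Type*} [CommRing R] {I I' : Ideal R} (h : I ≤ I') :
    Module.length R (R ⧸ I) = Module.length R (LinearMap.ker (Submodule.factor h)) +
      Module.length R (R ⧸ I') :=
  Module.length_eq_add_of_exact (Submodule.subtype _) (Submodule.factor h)
    (Submodule.subtype_injective _)
    (fun q => by
      obtain ⟨x, rfl⟩ := Ideal.Quotient.mk_surjective q
      exact ⟨Ideal.Quotient.mk I x, rfl⟩)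
    (LinearMap.exact_subtype_ker_map _)

/-- Let `B` be a Noetherian ring with a nilpotent ideal `n`, and let `Q` be a local extension of `B`
such that `n` generates the maximal ideal of `Q` and all ideals of `B` are contracted from `Q`. Then
`B` and `Q` have the same length: the extension of ideals is strictly monotone, and it maps
a minimal extension of ideals to an extension with a quotient of length at most one. -/
theorem Module.length_eq_of_extension {B Q : Type*} [CommRing B] [IsNoetherianRing B] [CommRing Q]
    [IsLocalRing Q] (g : B →+* Q) {n : Ideal B} (hn : IsNilpotent n)
    (hm : maximalIdeal Q ≤ n.map g) (hg : ∀ (I : Ideal B) b, g b ∈ I.map g → b ∈ I) :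
    Module.length B B = Module.length Q Q := by
  -- Chains of ideals of `B` extend to chains of ideals of `Q`.
  refine le_antisymm ?_ ?_
  · rw [← WithBot.coe_le_coe, Module.coe_length, Module.coe_length]
    refine Order.krullDim_le_of_strictMono (fun I : Ideal B => (I.map g : Ideal Q)) fun I I' h => ?_
    refine lt_of_le_of_ne (Ideal.map_mono h.le) fun he => ?_
    refine h.not_ge fun b hb => hg I b ?_
    simp only at he
    rw [he]
    exact Ideal.mem_map_of_mem g hb
  have key : ∀ I : Ideal B, Module.length Q (Q ⧸ I.map g) ≤ Module.length B (B ⧸ I) := by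
    intro I
    induction I using IsNoetherian.induction with
    | _ I ih =>
      by_cases hI : I = ⊤
      · subst hI
        have : Subsingleton (Q ⧸ (⊤ : Ideal B).map g) := by
          rw [Ideal.map_top]
          exact Ideal.Quotient.subsingleton_iff.2 rfl
        rw [Module.length_eq_zero]
        exact zero_le
      -- An element of the socle of `B ⧸ I`.
      obtain ⟨b, hb, hnb⟩ : ∃ b ∉ I, ∀ x ∈ n, x * b ∈ I := by
        classical
        have hex : ∃ k, n ^ k ≤ I := by
          obtain ⟨k, hk⟩ := hn
          exact ⟨k, hk.le.trans bot_le⟩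
        have hk := Nat.find_spec hex
        have hk0 : Nat.find hex ≠ 0 := by
          intro h0
          rw [h0, pow_zero, Ideal.one_eq_top, top_le_iff] at hk
          exact hI hk
        obtain ⟨j, hj⟩ := Nat.exists_eq_succ_of_ne_zero hk0
        obtain ⟨b, hb, hbI⟩ := SetLike.not_le_iff_exists.1 (Nat.find_min hex (m := j) (by omega))
        refine ⟨b, hbI, fun x hx => hk ?_⟩
        rw [hj, pow_succ']
        exact Ideal.mul_mem_mul hx hb
      have hle : I ≤ I ⊔ Ideal.span {b} := le_sup_left
      have hbI' : b ∈ I ⊔ Ideal.span {b} := Ideal.mem_sup_right (Ideal.mem_span_singleton_self b)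
      have h1 := ih _ (lt_of_le_of_ne hle fun h => hb (h ▸ hbI'))
      have hle' : Ideal.map g I ≤ Ideal.map g (I ⊔ Ideal.span {b}) := Ideal.map_mono hle
      rw [Module.length_eq_add_ker_factor hle, Module.length_eq_add_ker_factor hle']
      refine add_le_add (le_trans ?_ (Order.one_le_iff_pos.2 (Module.length_pos_iff.2 ?_))) h1
      · have hlen : Module.length Q (Q ⧸ maximalIdeal Q) = 1 := by
          rw [Module.length_eq_one_iff, isSimpleModule_iff_isCoatom]
          exact (inferInstance : (maximalIdeal Q).IsMaximal).out
        rw [← hlen]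
        let φ : Q →ₗ[Q] Q ⧸ Ideal.map g I := LinearMap.toSpanSingleton Q _ (Ideal.Quotient.mk _ (g b))
        have hφ : maximalIdeal Q ≤ LinearMap.ker φ := by
          refine hm.trans (Ideal.map_le_iff_le_comap.2 fun x hx => ?_)
          change Ideal.Quotient.mk _ (g x * g b) = 0
          rw [← map_mul]
          exact Ideal.Quotient.eq_zero_iff_mem.2 (Ideal.mem_map_of_mem g (hnb x hx))
        let ψ : (Q ⧸ maximalIdeal Q) →ₗ[Q] Q ⧸ Ideal.map g I := Submodule.liftQ _ φ hφ
        have hker : LinearMap.ker (Submodule.factor hle') ≤ LinearMap.range ψ := by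
          intro q hq
          obtain ⟨q, rfl⟩ := Ideal.Quotient.mk_surjective q
          have hq' : q ∈ Ideal.map g (I ⊔ Ideal.span {b}) := Ideal.Quotient.eq_zero_iff_mem.1 hq
          rw [Ideal.map_sup, Ideal.map_span, Set.image_singleton, Submodule.mem_sup] at hq'
          obtain ⟨x, hx, y, hy, rfl⟩ := hq'
          obtain ⟨c, rfl⟩ := Ideal.mem_span_singleton'.1 hy
          refine ⟨Ideal.Quotient.mk _ c, ?_⟩
          change Ideal.Quotient.mk _ (c * g b) = Ideal.Quotient.mk _ (x + c * g b)
          rw [map_add, Ideal.Quotient.eq_zero_iff_mem.2 hx, zero_add]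
        exact (Module.length_le_of_injective (Submodule.inclusion hker)
          (Submodule.inclusion_injective hker)).trans
          (Module.length_le_of_surjective ψ.rangeRestrict ψ.surjective_rangeRestrict)
      · refine ⟨⟨Ideal.Quotient.mk I b, ?_⟩, 0, fun h => hb ?_⟩
        · exact Ideal.Quotient.eq_zero_iff_mem.2 hbI'
        · exact Ideal.Quotient.eq_zero_iff_mem.1 (congrArg Subtype.val h)
  have h1 := key ⊥
  rwa [(Submodule.quotEquivOfEqBot _ Ideal.map_bot).length_eq,
    (Submodule.quotEquivOfEqBot (⊥ : Ideal B) rfl).length_eq] at h1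

end Length

namespace MvPowerSeries

theorem coeff_map_eval_of_isHomogeneous {σ R B : Type*} [CommRing R] [CommRing B]
    (F : R →+* MvPowerSeries σ B) (r : σ → R) (hr : ∀ i, F (r i) = X i) {p : MvPolynomial σ R}
    {k : ℕ} (hp : p.IsHomogeneous k) {m : σ →₀ ℕ} (hm : m.degree = k) :
    coeff m (F (p.eval r)) = constantCoeff (F (p.coeff m)) := by
  classical
  have h1 : F (p.eval r) = ∑ m' ∈ p.support, F (p.coeff m') * monomial m' 1 := by
    rw [MvPolynomial.eval_eq, map_sum]
    refine Finset.sum_congr rfl fun m' _ => ?_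
    rw [map_mul, map_prod, monomial_eq', map_one, one_mul, Finsupp.prod]
    simp only [map_pow, hr]
  have h2 : ∀ m' ∈ p.support, coeff m (F (p.coeff m') * monomial m' 1) =
      if m' = m then constantCoeff (F (p.coeff m)) else 0 := by
    intro m' hm'
    rw [coeff_mul_monomial]
    split_ifs with h h' h'
    · subst h'
      rw [tsub_self, mul_one]
      rfl
    · exfalso
      have h3 : m'.degree = k := by
        rw [Finsupp.degree_eq_weight_one]
        exact hp (MvPolynomial.mem_support_iff.1 hm')
      have h4 := congrArg Finsupp.degree (tsub_add_cancel_of_le h)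
      rw [map_add] at h4
      have h5 : (m - m').degree = 0 := by omega
      rw [Finsupp.degree_eq_zero_iff] at h5
      exact h' (le_antisymm h (tsub_eq_zero_iff_le.1 h5))
    · exact absurd (h'.le) h
    · rfl
  rw [h1, map_sum, Finset.sum_congr rfl h2, Finset.sum_ite_eq']
  split_ifs with h
  · rfl
  · rw [MvPolynomial.notMem_support_iff.1 h, map_zero, map_zero]

end MvPowerSeries

section Comparison

open IsLocalRing

variable {B σ R : Type*} [CommRing B] [Algebra ℂ B] [CommRing R] [Algebra ℂ R]
  {πB : B →ₐ[ℂ] ℂ} {g : B →ₐ[ℂ] R} {r : σ → R} {F : R →ₐ[ℂ] MvPowerSeries σ B}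

/-- If the maximal ideal of `R` is generated by that of `B` and by elements `r i` which become the
variables of a ring of power series over `B`, then the kernel of the reduction of `R → B⟦X⟧` modulo
the maximal ideal of `B` is generated by this ideal. -/
theorem mem_map_ker_of_map_eq_zero [IsNoetherianRing R] [IsLocalRing R]
    (hFg : ∀ x, F (g x) = MvPowerSeries.C x) (hFr : ∀ i, F (r i) = MvPowerSeries.X i)
    (hker : ∀ x, MvPowerSeries.augmentation σ πB (F x) = 0 →
      x ∈ (RingHom.ker πB).map g ⊔ Ideal.span (Set.range r)) (x : R)
    (hx : MvPowerSeries.map (πB : B →+* ℂ) (F x) = 0) : x ∈ (RingHom.ker πB).map g := by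
  set 𝔞 := (RingHom.ker πB).map g with h𝔞
  set 𝔯 := Ideal.span (Set.range r) with h𝔯
  have h𝔞0 : ∀ a ∈ 𝔞, MvPowerSeries.map (πB : B →+* ℂ) (F a) = 0 := by
    have : 𝔞 ≤ RingHom.ker ((MvPowerSeries.map (σ := σ) (πB : B →+* ℂ)).comp (F : R →+* _)) := by
      refine Ideal.map_le_iff_le_comap.2 fun a ha => ?_
      change MvPowerSeries.map (πB : B →+* ℂ) (F (g a)) = 0
      rw [hFg, MvPowerSeries.map_C]
      exact (congrArg MvPowerSeries.C ha).trans (map_zero _)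
    exact fun a ha => this ha
  have hpow : ∀ k, x ∈ 𝔞 ⊔ 𝔯 ^ k := by
    intro k
    induction k with
    | zero =>
      rw [pow_zero, Ideal.one_eq_top, sup_top_eq]
      trivial
    | succ k ih =>
      obtain ⟨a, ha, y, hy, rfl⟩ := Submodule.mem_sup.1 ih
      refine Ideal.add_mem _ (Ideal.mem_sup_left ha) ?_
      obtain ⟨p, hp, rfl⟩ := (Ideal.mem_span_pow_iff_exists_isHomogeneous r y).1 hy
      rw [map_add, map_add, h𝔞0 a ha, zero_add] at hx
      rw [MvPolynomial.eval_eq]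
      refine Ideal.sum_mem _ fun m hm => ?_
      have hdeg : m.degree = k := by
        rw [Finsupp.degree_eq_weight_one]
        exact hp (MvPolynomial.mem_support_iff.1 hm)
      -- The coefficients of a homogeneous form which vanishes modulo `𝔞` are in the maximal ideal.
      have h1 : p.coeff m ∈ 𝔞 ⊔ 𝔯 := by
        refine hker _ ?_
        rw [MvPowerSeries.augmentation_apply]
        have h2 := congrArg (MvPowerSeries.coeff m) hx
        have h3 : MvPowerSeries.coeff m (F (p.eval r)) =
            MvPowerSeries.constantCoeff (F (p.coeff m)) :=
          MvPowerSeries.coeff_map_eval_of_isHomogeneous (F : R →+* MvPowerSeries σ B) r hFr hp hdeg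
        rw [MvPowerSeries.coeff_map, map_zero, h3] at h2
        exact h2
      have h2 : ∏ i ∈ m.support, r i ^ m i ∈ 𝔯 ^ k := by
        refine (Ideal.mem_span_pow_iff_exists_isHomogeneous r _).2
          ⟨MvPolynomial.monomial m 1, MvPolynomial.isHomogeneous_monomial 1 hdeg, ?_⟩
        rw [MvPolynomial.eval_monomial, one_mul, Finsupp.prod]
      obtain ⟨a', ha', y', hy', h3⟩ := Submodule.mem_sup.1 h1
      rw [← h3, add_mul]
      refine Ideal.add_mem _ (Ideal.mem_sup_left (Ideal.mul_mem_right _ _ ha'))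
        (Ideal.mem_sup_right ?_)
      rw [pow_succ']
      exact Ideal.mul_mem_mul hy' h2
  have h𝔯 : 𝔯 ≠ ⊤ := by
    intro h
    have h1 : 𝔯 ≤ RingHom.ker ((MvPowerSeries.augmentation σ πB).comp F) := by
      refine Ideal.span_le.2 ?_
      rintro _ ⟨i, rfl⟩
      change MvPowerSeries.augmentation σ πB (F (r i)) = 0
      rw [hFr, MvPowerSeries.augmentation_apply, MvPowerSeries.constantCoeff_X, map_zero]
    rw [h, top_le_iff] at h1
    exact RingHom.ker_ne_top _ h1
  -- Krull's intersection theorem for `R ⧸ 𝔞`.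
  have hKrull := 𝔯.iInf_pow_smul_eq_bot_of_isLocalRing (M := R ⧸ 𝔞) h𝔯
  have hmem : Ideal.Quotient.mk 𝔞 x ∈ (⨅ k : ℕ, 𝔯 ^ k • ⊤ : Submodule R (R ⧸ 𝔞)) := by
    refine Submodule.mem_iInf _ |>.2 fun k => ?_
    obtain ⟨a, ha, y, hy, h1⟩ := Submodule.mem_sup.1 (hpow k)
    rw [← h1, map_add, Ideal.Quotient.eq_zero_iff_mem.2 ha, zero_add]
    have h2 : Ideal.Quotient.mk 𝔞 y = y • (1 : R ⧸ 𝔞) := by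
      rw [Algebra.smul_def, mul_one]
      rfl
    rw [h2]
    exact Submodule.smul_mem_smul hy trivial
  rw [hKrull] at hmem
  exact Ideal.Quotient.eq_zero_iff_mem.1 hmem

end Comparison

/-! ### Irreducible components and their multiplicities -/

section Component

open IsLocalRing

namespace LocQuot

variable {A : Type*} [CommRing A] {o : Ideal A} [o.IsPrime] {I : Ideal A}

theorem algebraMap_eq_zero_iff {a : A} :
    algebraMap A (LocQuot o I) a = 0 ↔ ∃ y ∉ o, y * a ∈ I := by
  have h := IsLocalization.algebraMap_mem_map_algebraMap_iff o.primeCompl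
    (Localization.AtPrime o) I a
  rw [← Ideal.Quotient.eq_zero_iff_mem] at h
  refine h.trans ?_
  exact ⟨fun ⟨y, hy, h⟩ => ⟨y, hy, h⟩, fun ⟨y, hy, h⟩ => ⟨y, hy, h⟩⟩

theorem length_self : Module.length (LocQuot o I) (LocQuot o I) =
    Module.length (Localization.AtPrime o) (LocQuot o I) :=
  (Module.length_eq_of_surjective (S := Localization.AtPrime o) (R := LocQuot o I)
    Ideal.Quotient.mk_surjective).symm

theorem nontrivial (h : I ≤ o) : Nontrivial (LocQuot o I) := by
  refine ⟨1, 0, fun h1 => ?_⟩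
  rw [← map_one (algebraMap A (LocQuot o I)), algebraMap_eq_zero_iff] at h1
  obtain ⟨y, hy, hyI⟩ := h1
  rw [mul_one] at hyI
  exact hy (h hyI)

theorem isLocalRing (h : I ≤ o) : IsLocalRing (LocQuot o I) :=
  have := nontrivial h
  .of_surjective' (Ideal.Quotient.mk _) Ideal.Quotient.mk_surjective

end LocQuot

variable {B σ A : Type*} [CommRing B] [Algebra ℂ B] [CommRing A] [Algebra ℂ A]
  {J o q : Ideal A} [o.IsPrime] [q.IsPrime] {πB : B →ₐ[ℂ] ℂ}
  {f : A →ₐ[ℂ] MvPowerSeries σ B} {g : B →ₐ[ℂ] LocQuot o J}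
  {F : LocQuot o J →ₐ[ℂ] MvPowerSeries σ B} {G : LocQuot o J →ₐ[ℂ] LocQuot q J}

/-- The kernel of a localization map between local rings of a scheme. -/
theorem LocQuot.exists_mul_eq_zero (hG : ∀ a, G (algebraMap A _ a) = algebraMap A _ a)
    {w : LocQuot o J} (hw : G w = 0) : ∃ y ∉ q, algebraMap A _ y * w = 0 := by
  obtain ⟨a, s, hs, h⟩ := LocQuot.exists_mul_eq w
  have h1 : algebraMap A (LocQuot q J) a = 0 := by
    rw [← hG, ← h, map_mul, hw, zero_mul]
  obtain ⟨y, hy, hya⟩ := LocQuot.algebraMap_eq_zero_iff.1 h1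
  refine ⟨y, hy, (LocQuot.isUnit_algebraMap (I := J) hs).mul_right_cancel ?_⟩
  rw [mul_assoc, h, ← map_mul, zero_mul, LocQuot.algebraMap_eq_zero_iff]
  exact ⟨1, fun h1 => Ideal.IsPrime.ne_top ‹_› ((Ideal.eq_top_iff_one _).2 h1), by rwa [one_mul]⟩

/-- Let `q` be the kernel of the reduction of `f : A → B⟦X⟧` modulo the maximal ideal of `B`. The
local ring of `Spec (A ⧸ J)` at `q` is obtained from the one at `o` by inverting elements whose
images in `B⟦X⟧` have an invertible coefficient; hence all ideals of `B` are contracted from it. -/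
theorem mem_of_mem_map_comp (hπ : ∀ x, πB x ≠ 0 → IsUnit x)
    (hF : ∀ a, F (algebraMap A _ a) = f a) (hFg : ∀ x, F (g x) = MvPowerSeries.C x)
    (hG : ∀ a, G (algebraMap A _ a) = algebraMap A _ a)
    (hq : ∀ a, a ∈ q ↔ MvPowerSeries.map (πB : B →+* ℂ) (f a) = 0) (I : Ideal B) (b : B)
    (hb : G (g b) ∈ I.map (G.comp g)) : b ∈ I := by
  have h1q : (1 : A) ∉ q := fun h => Ideal.IsPrime.ne_top ‹_› ((Ideal.eq_top_iff_one _).2 h)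
  -- Up to denominators, the extension of `I` lies over the power series with coefficients in `I`.
  have key : ∀ x ∈ I.map (G.comp g), ∃ y ∉ q, ∃ z, x * algebraMap A _ y = G z ∧
      MvPowerSeries.map (Ideal.Quotient.mk I) (F z) = 0 := by
    intro x hx
    induction hx using Submodule.span_induction with
    | mem x hx =>
      obtain ⟨c, hc, rfl⟩ := hx
      refine ⟨1, h1q, g c, by rw [map_one, mul_one]; rfl, ?_⟩
      rw [hFg, MvPowerSeries.map_C, Ideal.Quotient.eq_zero_iff_mem.2 hc, map_zero]
    | zero => exact ⟨1, h1q, 0, by rw [zero_mul, map_zero], by rw [map_zero, map_zero]⟩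
    | add x₁ x₂ _ _ h₁ h₂ =>
      obtain ⟨y₁, hy₁, z₁, hz₁, hF₁⟩ := h₁
      obtain ⟨y₂, hy₂, z₂, hz₂, hF₂⟩ := h₂
      refine ⟨y₁ * y₂, fun h => (Ideal.IsPrime.mem_or_mem ‹_› h).elim hy₁ hy₂,
        z₁ * algebraMap A _ y₂ + z₂ * algebraMap A _ y₁, ?_, ?_⟩
      · rw [map_add, map_mul, map_mul, map_mul, hG, hG, ← hz₁, ← hz₂]
        ring
      · rw [map_add, map_mul, map_mul, map_add, map_mul, map_mul, hF₁, hF₂, zero_mul, zero_mul,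
          add_zero]
    | smul a x _ h =>
      obtain ⟨y, hy, z, hz, hFz⟩ := h
      obtain ⟨a', y', hy', ha'⟩ := LocQuot.exists_mul_eq a
      refine ⟨y' * y, fun h => (Ideal.IsPrime.mem_or_mem ‹_› h).elim hy' hy,
        algebraMap A _ a' * z, ?_, ?_⟩
      · rw [map_mul, map_mul, hG, ← hz, ← ha', smul_eq_mul]
        ring
      · rw [map_mul, map_mul, hFz, mul_zero]
  obtain ⟨y, hy, z, hz, hFz⟩ := key _ hb
  obtain ⟨y', hy', hw⟩ := LocQuot.exists_mul_eq_zero hG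
    (w := g b * algebraMap A _ y - z) (by rw [map_sub, map_mul, hG, hz, sub_self])
  have h1 := congrArg (fun x => MvPowerSeries.map (Ideal.Quotient.mk I) (F x)) hw
  simp only [map_mul, map_sub, hFz, hF, hFg, sub_zero, map_zero, MvPowerSeries.map_C] at h1
  have h2 : y' * y ∉ q := fun h => (Ideal.IsPrime.mem_or_mem ‹_› h).elim hy' hy
  rw [hq] at h2
  -- Elements outside `q` map to power series with an invertible coefficient.
  obtain ⟨m, hm⟩ : ∃ m, πB (MvPowerSeries.coeff m (f (y' * y))) ≠ 0 := by
    by_contra! h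
    refine h2 (MvPowerSeries.ext fun m => ?_)
    rw [MvPowerSeries.coeff_map, map_zero]
    exact h m
  have h3 : MvPowerSeries.map (Ideal.Quotient.mk I) (f (y' * y)) *
      MvPowerSeries.C (Ideal.Quotient.mk I b) = 0 := by
    rw [map_mul, map_mul, ← h1]
    ring
  have h4 := congrArg (MvPowerSeries.coeff m) h3
  rw [MvPowerSeries.coeff_mul_C, MvPowerSeries.coeff_map, map_zero, ← map_mul,
    Ideal.Quotient.eq_zero_iff_mem] at h4
  exact (Ideal.unit_mul_mem_iff_mem _ (hπ _ hm)).1 h4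

/-- Let the local ring of `Spec (A ⧸ J)` at `o` contain the Artinian local ring `B` and elements
`r i` which together with the maximal ideal of `B` generate the maximal ideal, and let it map to
`B⟦X⟧` in such a way that `r i` goes to `X i`. Then there is a unique irreducible component through
`o`, and its multiplicity is the length of `B`. -/
theorem exists_component_lengthAt_eq {B A : Type} {σ : Type*} [CommRing B] [Algebra ℂ B]
    [IsNoetherianRing B] [CommRing A] [Algebra ℂ A] [IsNoetherianRing A] {J o : Ideal A} [o.IsPrime]
    {πB : B →ₐ[ℂ] ℂ} (hπ : ∀ x, πB x ≠ 0 → IsUnit x) (hnil : IsNilpotent (RingHom.ker πB))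
    {f : A →ₐ[ℂ] MvPowerSeries σ B} (hfJ : ∀ a ∈ J, f a = 0)
    (ho : ∀ a, a ∈ o ↔ MvPowerSeries.augmentation σ πB (f a) = 0)
    {g : B →ₐ[ℂ] LocQuot o J} {r : σ → LocQuot o J} {F : LocQuot o J →ₐ[ℂ] MvPowerSeries σ B}
    (hF : ∀ a, F (algebraMap A _ a) = f a) (hFg : ∀ x, F (g x) = MvPowerSeries.C x)
    (hFr : ∀ i, F (r i) = MvPowerSeries.X i)
    (hker : ∀ x, MvPowerSeries.augmentation σ πB (F x) = 0 →
      x ∈ (RingHom.ker πB).map g ⊔ Ideal.span (Set.range r)) :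
    ∃ x : PrimeSpectrum A, J ≤ x.asIdeal ∧ x.asIdeal ≤ o ∧
      (∀ q : Ideal A, q.IsPrime → J ≤ q → q ≤ o → x.asIdeal ≤ q) ∧
      Module.length B B = lengthAt J x := by
  let q : Ideal A := RingHom.ker ((MvPowerSeries.map (σ := σ) (πB : B →+* ℂ)).comp (f : A →+* _))
  have hqp : q.IsPrime :=
    have : IsDomain (MvPowerSeries σ ℂ) := NoZeroDivisors.to_isDomain _
    RingHom.ker_isPrime _
  have hq : ∀ a, a ∈ q ↔ MvPowerSeries.map (πB : B →+* ℂ) (f a) = 0 := fun a => Iff.rfl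
  have hJq : J ≤ q := fun a ha => by rw [hq, hfJ a ha, map_zero]
  have hqo : q ≤ o := fun a ha => by
    rw [ho, MvPowerSeries.augmentation_apply]
    have h := congrArg MvPowerSeries.constantCoeff ((hq a).1 ha)
    rw [MvPowerSeries.constantCoeff_map, map_zero] at h
    exact h
  have := LocQuot.isLocalRing (hJq.trans hqo)
  have := LocQuot.isLocalRing hJq
  have hmem : ∀ a ∈ q, algebraMap A (LocQuot o J) a ∈ (RingHom.ker πB).map g := fun a ha =>
    mem_map_ker_of_map_eq_zero hFg hFr hker _ (by rw [hF]; exact (hq a).1 ha)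
  refine ⟨⟨q, hqp⟩, hJq, hqo, fun p hp hJp hpo a ha => ?_, ?_⟩
  -- The image of `q` in the local ring is nilpotent, because it is generated by elements of the
  -- maximal ideal of `B`.
  · obtain ⟨k, hk⟩ := hnil
    have h1 : algebraMap A (LocQuot o J) (a ^ k) = 0 := by
      have h2 := Ideal.pow_mem_pow (hmem a ha) k
      rw [← Ideal.map_pow, hk] at h2
      rw [map_pow]
      have h3 : Ideal.map g (0 : Ideal B) = ⊥ := Ideal.map_bot
      rwa [h3] at h2
    obtain ⟨y, hy, hya⟩ := LocQuot.algebraMap_eq_zero_iff.1 h1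
    exact hp.mem_of_pow_mem _ ((hp.mem_or_mem (hJp hya)).resolve_left fun h => hy (hpo h))
  · obtain ⟨G, hG⟩ := LocQuot.exists_lift (o := o) (I := J)
      (IsScalarTower.toAlgHom ℂ A (LocQuot q J))
      (fun a ha => LocQuot.isUnit_algebraMap fun h => ha (hqo h))
      (fun a ha => LocQuot.algebraMap_eq_zero_iff.2
        ⟨1, fun h => hqp.ne_top ((Ideal.eq_top_iff_one _).2 h), by rwa [one_mul]⟩)
    refine (Module.length_eq_of_extension ((G.comp g : B →ₐ[ℂ] LocQuot q J) : B →+* LocQuot q J)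
      hnil (fun z hz => ?_)
      (fun I b hb => mem_of_mem_map_comp hπ hF hFg hG hq I b hb)).trans LocQuot.length_self
    obtain ⟨a, y, hy, h⟩ := LocQuot.exists_mul_eq z
    have ha : a ∈ q := by
      by_contra ha
      have h1 := LocQuot.isUnit_algebraMap (I := J) ha
      rw [← h] at h1
      exact (IsLocalRing.mem_maximalIdeal _).1 hz (isUnit_of_mul_isUnit_left h1)
    have h1 := Ideal.mem_map_of_mem (G : LocQuot o J →+* LocQuot q J) (hmem a ha)
    have h2 : (G : LocQuot o J →+* LocQuot q J) (algebraMap A _ a) = algebraMap A _ a := hG a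
    have h3 : Ideal.map (G : LocQuot o J →+* LocQuot q J) ((RingHom.ker πB).map g) =
        (RingHom.ker πB).map ((G.comp g : B →ₐ[ℂ] LocQuot q J) : B →+* LocQuot q J) :=
      Ideal.map_map (g : B →+* LocQuot o J) (G : LocQuot o J →+* LocQuot q J)
    rw [h3, h2, ← h] at h1
    exact (Ideal.mul_unit_mem_iff_mem _ (LocQuot.isUnit_algebraMap hy)).1 h1

end Component

namespace BasicSituation

variable {N d n : ℕ} (S : BasicSituation N d n)

/-- A subvariety of `R̃°` passes through `t` if and only if its ideal is contained in the kernel of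
the evaluation at `t`. -/
theorem comap_le_pointToPoint_iff {t : S.Var → ℂ} {φ : S.RegFun →ₐ[ℂ] ℂ}
    (hφ : ∀ v, φ (S.coord v) = t v) (x : PrimeSpectrum S.RegFun) :
    PrimeSpectrum.comap (algebraMap (MvPolynomial S.Var ℂ) S.RegFun) x ≤
      MvPolynomial.pointToPoint t ↔ x.asIdeal ≤ RingHom.ker φ := by
  have hev : ∀ p, φ (algebraMap (MvPolynomial S.Var ℂ) S.RegFun p) = MvPolynomial.aeval t p := by
    intro p
    have : φ.comp (IsScalarTower.toAlgHom ℂ (MvPolynomial S.Var ℂ) S.RegFun) =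
        (MvPolynomial.aeval t : _ →ₐ[ℂ] ℂ) := MvPolynomial.algHom_ext fun v => by
      rw [MvPolynomial.aeval_X]
      exact hφ v
    exact DFunLike.congr_fun this p
  have hmem : ∀ p : MvPolynomial S.Var ℂ, p ∈ (MvPolynomial.pointToPoint t).asIdeal ↔
      MvPolynomial.aeval t p = (0 : ℂ) :=
    fun p => MvPolynomial.mem_vanishingIdeal_singleton_iff t p
  constructor
  · intro h a ha
    obtain ⟨⟨p, y⟩, hp⟩ := IsLocalization.surj (Submonoid.powers S.discr) a
    have h1 : p ∈ (MvPolynomial.pointToPoint t).asIdeal := by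
      refine h ?_
      change algebraMap _ S.RegFun p ∈ x.asIdeal
      rw [← hp]
      exact x.asIdeal.mul_mem_right _ ha
    rw [hmem, ← hev, ← hp, map_mul] at h1
    exact (mul_eq_zero.1 h1).resolve_right
      ((IsLocalization.map_units S.RegFun y).map φ).ne_zero
  · intro h p hp
    rw [hmem, ← hev]
    exact h hp

end BasicSituation

end

theorem mainTheorem3 {N d n : ℕ} (S : BasicSituation N d n)
    (V : Submodule ℂ ℂ[X]) (E : ℕ → Submodule ℂ ℂ[X]) (hVE : S.InFlo V E)
    (t : S.Var → ℂ) (ht : S.GamEqTheta t E)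
    (b : Module.Basis (Fin (N + 1) ⊕ Fin (d - N)) ℂ (polySpace d)) (hb : chartPoint b 0 = V) :
    ((∃! x, S.IsComponentThrough S.criticalIdeal t x) ∧
      ∀ x, S.IsComponentThrough S.criticalIdeal t x →
        S.omegaMultiplicity b = lengthAt S.criticalIdeal x) ∧
    ((∃! x, S.IsComponentThrough S.divisibilityIdeal t x) ∧
      ∀ x, S.IsComponentThrough S.divisibilityIdeal t x →
        S.omegaMultiplicity b = lengthAt S.divisibilityIdeal x) := by
  obtain ⟨u, hu⟩ := hVE.exists_bases ht
  obtain ⟨πB, f, hπ, hnil, hfJ, hft, hcomp⟩ := hu.exists_comparison hb fun s => hb ▸ hVE.1 s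
  let φ : S.RegFun →ₐ[ℂ] ℂ := (MvPowerSeries.augmentation _ πB).comp f
  have hφ : ∀ v, φ (S.coord v) = t v := hft
  have : (RingHom.ker φ).IsPrime := RingHom.ker_isPrime _
  obtain ⟨g, r, F, hF, hFg, hFr, hker⟩ := hcomp (RingHom.ker φ) fun a => Iff.rfl
  obtain ⟨x, hJx, hxo, hmin, hlen⟩ :=
    exists_component_lengthAt_eq hπ hnil hfJ (fun a => Iff.rfl) hF hFg hFr hker
  rw [BasicSituation.criticalIdeal_eq_divisibilityIdeal, and_self]
  have hx : S.IsComponentThrough S.divisibilityIdeal t x :=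
    ⟨⟨⟨x.2, hJx⟩, fun q hq hqx => hmin q hq.1 hq.2 (hqx.trans hxo)⟩,
      (S.comap_le_pointToPoint_iff hφ x).2 hxo⟩
  have huniq : ∀ y, S.IsComponentThrough S.divisibilityIdeal t y → y = x := fun y hy => by
    have h1 := hmin y.asIdeal y.2 hy.1.1.2 ((S.comap_le_pointToPoint_iff hφ y).1 hy.2)
    exact PrimeSpectrum.ext (le_antisymm (hy.1.2 ⟨x.2, hJx⟩ h1) h1)
  refine ⟨⟨x, hx, huniq⟩, fun y hy => ?_⟩
  rw [huniq y hy, ← hlen]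
  exact LocQuot.length_self.symm
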